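/- **Conventions.** $\mathbb N=\{1,2,\dots\}$. For a unital C*-algebra $B$, $B_+$ is its set of positive elements and $a\precsim_B b$ means that $a$ is Cuntz subequivalent to $b$ relative to $B$: there are $v_n\in B$ with $v_nbv_n^*\to a$. A unital C*-algebra is *stably finite* if every isometry in every $M_n(B)$ is unitary. $QT(B)$ is the set of normalized 2-quasitraces on $B$ (extended canonically to all $M_n(B)$), $d_\tau(a)=\lim_k\tau(a^{1/k})$, and $B$ has *strict comparison* if for all $n$ and all $a,b\in M_n(B)_+$, $d_\tau(a)<d_\tau(b)$ for all $\tau\in QT(B)$ implies $a\precsim_{M_n(B)} b$. *Tracial Rokhlin property.* An action $\alpha\colon G\to\operatorname{Aut}(B)$ of a finite group on an infinite dimensional simple unital C*-algebra $B$ has the tracial Rokhlin property if for every finite $F\subseteq B$, every $\varepsilon>0$ and every $x\in B_+$ with $\|x\|=1$ there are mutually orthogonal projections $e_g\in B$ ($g\in G$) such that, with $e=\sum_g e_g$: $\|\alpha_g(e_h)-e_{gh}\|<\varepsilon$ for all $g,h\in G$; $\|e_ga-ae_g\|<\varepsilon$ for all $g\in G$, $a\in F$; $1-e$ is Murray–von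 Neumann equivalent to a projection in $\overline{xBx}$; and $\|exe\|>1-\varepsilon$. *Restricted tracial Rokhlin property with comparison.* Let $\alpha\colon G\to\operatorname{Aut}(B)$ be a continuous action of a second countable compact group on an infinite dimensional simple unital C*-algebra $B$, with fixed point algebra $B^\alpha$, and let $(\mathtt{Lt}_gf)(h)=f(g^{-1}h)$ for $f\in C(G)$. The action has this property if for all finite sets $F\subseteq B$ and $S\subseteq C(G)$, every $\varepsilon>0$, every $x\in B_+\setminus\{0\}$ and every $y\in(B^\alpha)_+\setminus\{0\}$ there are a projection $p\in B^\alpha$ and a unital completely positive map $\varphi\colon C(G)\to pBp$ such that 1. $\|\varphi(f_1f_2)-\varphi(f_1)\varphi(f_2)\|<\varepsilon$, $\|\varphi(f)a-a\varphi(f)\|<\varepsilon$ and $\sup_{g\in G}\|\varphi(\mathtt{Lt}_g f)-\alpha_g(\varphi(f))\|<\varepsilon$ for all $f,f_1,f_2\in S$ and $a\in F$; 2. $1-p\precsim_B x$; 3. $1-p\precsim_{B^\alpha}y$; 4. $1-p\precsim_{B^\alpha}p$. **Theorem.** Let $A_1,A_2,\dots$ be simple unital C*-algebras, let $G_1,G_2,\dots$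 be finite groups, and for each $k$ let $\alpha^{(k)}\colon G_k\to\operatorname{Aut}(A_k)$ be an action with the tracial Rokhlin property (in particular $A_k$ is infinite dimensional). Let $A=\bigotimes_{n=1}^\infty A_n=\varinjlim_n A_1\otimes_{\min}\cdots\otimes_{\min}A_n$ be the infinite minimal tensor product. Assume that $A$ is stably finite and that for every $n\in\mathbb N$ the algebra $A_1\otimes_{\min}\cdots\otimes_{\min}A_n$ has strict comparison. Let $G=\prod_{n=1}^\infty G_n$ (with the product topology) and let $\alpha\colon G\to\operatorname{Aut}(A)$ be the infinite minimal tensor product action, that is, the continuous action with $$\alpha_{(g_1,g_2,\dots)}(a_1\otimes\cdots\otimes a_n\otimes 1)=\alpha^{(1)}_{g_1}(a_1)\otimes\cdots\otimes\alpha^{(n)}_{g_n}(a_n)\otimes 1 .$$ Then $A$ is an infinite dimensional simple unital C*-algebra and $\alpha$ has the restricted tracial Rokhlin property with comparison. -/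

import Mathlib

open scoped ComplexOrder ComplexConjugate InnerProductSpace

noncomputable section

/-- The vector space with basis `δ_x`, `x ∈ S`, with the semi-inner product
`⟪δ_x, δ_y⟫ = K x y` given by a positive semidefinite kernel `K`. -/
@[nolint unusedArguments]
def PreKernelSpace {S : Type*} {K : Matrix S S ℂ} (_hK : K.PosSemidef) : Type _ := S →₀ ℂ

namespace PreKernelSpace

variable {S : Type*} {K : Matrix S S ℂ} (hK : K.PosSemidef)

instance : AddCommGroup (PreKernelSpace hK) := inferInstanceAs (AddCommGroup (S →₀ ℂ))
instance : Module ℂ (PreKernelSpace hK) := inferInstanceAs (Module ℂ (S →₀ ℂ))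

/-- The defining coordinates of an element. -/
def coord : PreKernelSpace hK ≃ₗ[ℂ] (S →₀ ℂ) := LinearEquiv.refl ℂ _

/-- The semi-inner product on finite linear combinations of the symbols `δ_x`. -/
@[reducible]
def core : PreInnerProductSpace.Core ℂ (PreKernelSpace hK) where
  inner f g := (coord hK f).sum fun x c => (coord hK g).sum fun y d => star c * K x y * d
  conj_inner_symm f g := by
    rw [Finsupp.sum_comm]
    simp only [map_finsuppSum]
    refine Finsupp.sum_congr fun x _ => Finsupp.sum_congr fun y _ => ?_
    rw [← hK.isHermitian.apply y x]
    simp [mul_comm, mul_left_comm]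
  add_left f g h := by
    rw [map_add, Finsupp.sum_add_index'] <;> simp [← Finsupp.sum_add, add_mul]
  smul_left f g c := by
    rw [map_smul, Finsupp.sum_smul_index] <;> simp [Finsupp.mul_sum, mul_assoc]
  re_inner_nonneg f := (Complex.nonneg_iff.mp (hK.2 (coord hK f))).1

instance : SeminormedAddCommGroup (PreKernelSpace hK) :=
  InnerProductSpace.Core.toSeminormedAddCommGroup (c := core hK)

instance : InnerProductSpace ℂ (PreKernelSpace hK) := InnerProductSpace.ofCore (core hK)

/-- The basis vector `δ_x`. -/
def delta (x : S) : PreKernelSpace hK := (coord hK).symm (Finsupp.single x 1)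

lemma inner_delta (x y : S) : ⟪delta hK x, delta hK y⟫_ℂ = K x y := by
  change ((coord hK (delta hK x)).sum fun x c =>
    (coord hK (delta hK y)).sum fun y d => star c * K x y * d) = _
  simp [delta]

lemma span_delta : Submodule.span ℂ (Set.range (delta hK)) = ⊤ := by
  have h : Set.range (delta hK)
      = (coord hK).symm '' Set.range (fun x : S => Finsupp.single x (1 : ℂ)) := by
    rw [← Set.range_comp]; rfl
  have h' : Submodule.span ℂ (Set.range (fun x : S => Finsupp.single x (1 : ℂ))) = ⊤ := by
    simpa using (Finsupp.basisSingleOne (R := ℂ) (ι := S)).span_eq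
  rw [h]
  erw [Submodule.span_image (coord hK).symm.toLinearMap, h']
  simp

/-- A map of the index set induces a linear map, `δ_x ↦ δ_{s x}`. -/
def push (s : S → S) : PreKernelSpace hK →ₗ[ℂ] PreKernelSpace hK :=
  (coord hK).symm.toLinearMap ∘ₗ Finsupp.lmapDomain ℂ ℂ s ∘ₗ (coord hK).toLinearMap

lemma push_delta (s : S → S) (x : S) : push hK s (delta hK x) = delta hK (s x) := by
  simp [push, delta]

/-- To bound `δ_x ↦ δ_{s x}` by `c`, it is enough to write `c ^ 2 * K` as the sum of the pull-back
of `K` by `s` and the pull-back of `K` by another map. -/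
lemma norm_push_le (s t : S → S) (c : ℝ) (hc : 0 ≤ c)
    (h : ∀ x y, K (s x) (s y) + K (t x) (t y) = (c : ℂ) ^ 2 * K x y) (v : PreKernelSpace hK) :
    ‖push hK s v‖ ≤ c * ‖v‖ := by
  have key : ∀ v w : PreKernelSpace hK, ⟪push hK s v, push hK s w⟫_ℂ
      + ⟪push hK t v, push hK t w⟫_ℂ = (c : ℂ) ^ 2 * ⟪v, w⟫_ℂ := by
    intro v w
    have hv : v ∈ Submodule.span ℂ (Set.range (delta hK)) := by rw [span_delta]; trivial
    have hw : w ∈ Submodule.span ℂ (Set.range (delta hK)) := by rw [span_delta]; trivial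
    induction hv using Submodule.span_induction with
    | zero => simp
    | add a b _ _ ha hb =>
      simp only [map_add, inner_add_left, mul_add, ← ha, ← hb]; ring
    | smul r a _ ha =>
      simp only [map_smul, inner_smul_left]
      rw [mul_left_comm, ← ha]; ring
    | mem a ha =>
      obtain ⟨x, rfl⟩ := ha
      induction hw using Submodule.span_induction with
      | zero => simp
      | add a b _ _ ha hb =>
        simp only [map_add, inner_add_right, mul_add, ← ha, ← hb]; ring
      | smul r a _ ha =>
        simp only [map_smul, inner_smul_right]
        rw [mul_left_comm, ← ha]; ring
      | mem a ha =>
        obtain ⟨y, rfl⟩ := ha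
        simp only [push_delta, inner_delta, h]
  have h1 := key v v
  simp only [inner_self_eq_norm_sq_to_K] at h1
  have h2 : ‖push hK s v‖ ^ 2 + ‖push hK t v‖ ^ 2 = c ^ 2 * ‖v‖ ^ 2 := by
    apply Complex.ofReal_injective
    push_cast
    exact h1
  refine le_of_sq_le_sq ?_ (by positivity)
  nlinarith [sq_nonneg ‖push hK t v‖]

end PreKernelSpace

/-- The Hilbert space of a positive semidefinite kernel. -/
abbrev KernelSpace {S : Type*} {K : Matrix S S ℂ} (hK : K.PosSemidef) : Type _ :=
  UniformSpace.Completion (PreKernelSpace hK)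

namespace KernelSpace

variable {S : Type*} {K : Matrix S S ℂ} (hK : K.PosSemidef)

/-- The vector `δ_x`. -/
def delta (x : S) : KernelSpace hK := (PreKernelSpace.delta hK x : PreKernelSpace hK)

lemma inner_delta (x y : S) : ⟪delta hK x, delta hK y⟫_ℂ = K x y := by
  simp [delta, PreKernelSpace.inner_delta]

lemma dense_span_delta : Dense (Submodule.span ℂ (Set.range (delta hK)) : Set (KernelSpace hK)) := by
  have h : Submodule.span ℂ (Set.range (delta hK)) = LinearMap.range
      (UniformSpace.Completion.toComplL (𝕜 := ℂ) (E := PreKernelSpace hK)).toLinearMap := by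
    rw [← Submodule.map_top, ← PreKernelSpace.span_delta hK, Submodule.map_span, ← Set.range_comp]
    rfl
  rw [h]
  exact UniformSpace.Completion.denseRange_coe

variable {hK} in
lemma ext_inner {v w : KernelSpace hK} (h : ∀ x, ⟪delta hK x, v⟫_ℂ = ⟪delta hK x, w⟫_ℂ) :
    v = w := by
  refine (dense_span_delta hK).eq_of_inner_right ℂ fun u hu => ?_
  induction hu using Submodule.span_induction with
  | zero => simp
  | add a b _ _ ha hb => rw [inner_add_left, inner_add_left, ha, hb]
  | smul r a _ ha => rw [inner_smul_left, inner_smul_left, ha]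
  | mem a ha => obtain ⟨x, rfl⟩ := ha; exact h x

variable {hK} in
lemma op_ext {T U : KernelSpace hK →L[ℂ] KernelSpace hK}
    (h : ∀ x y, ⟪delta hK x, T (delta hK y)⟫_ℂ = ⟪delta hK x, U (delta hK y)⟫_ℂ) : T = U :=
  ContinuousLinearMap.ext_on (dense_span_delta hK) <| by
    rintro _ ⟨y, rfl⟩
    exact ext_inner fun x => h x y

/-- The bounded operator `δ_x ↦ δ_{s x}`, where `s` is a map for which `c ^ 2 * K` is the sum of
the pull-back of `K` by `s` and the pull-back of `K` by another map. -/
def op (s t : S → S) (c : ℝ) (hc : 0 ≤ c)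
    (h : ∀ x y, K (s x) (s y) + K (t x) (t y) = (c : ℂ) ^ 2 * K x y) :
    KernelSpace hK →L[ℂ] KernelSpace hK :=
  ((PreKernelSpace.push hK s).mkContinuous c (PreKernelSpace.norm_push_le hK s t c hc h)).completion

lemma op_delta (s t : S → S) (c : ℝ) (hc : 0 ≤ c)
    (h : ∀ x y, K (s x) (s y) + K (t x) (t y) = (c : ℂ) ^ 2 * K x y) (x : S) :
    op hK s t c hc h (delta hK x) = delta hK (s x) := by
  simp [op, delta, PreKernelSpace.push_delta]

end KernelSpace
end


noncomputable section

/-- A state of a unital C*-algebra: a positive linear functional with value `1` at the unit. -/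
@[ext]
structure CStarState (A : Type*) [CStarAlgebra A] where
  /-- the underlying linear functional -/
  toLin : A →ₗ[ℂ] ℂ
  map_one : toLin 1 = 1
  nonneg : ∀ a, 0 ≤ toLin (star a * a)

namespace CStarState

variable {A : Type*} [CStarAlgebra A] (φ : CStarState A)

lemma map_star (a : A) : φ.toLin (star a) = conj (φ.toLin a) := by
  have h0 : (φ.toLin (star a * a)).im = 0 := (Complex.nonneg_iff.mp (φ.nonneg a)).2.symm
  have h1 := (Complex.nonneg_iff.mp (φ.nonneg (1 + a))).2
  have h2 := (Complex.nonneg_iff.mp (φ.nonneg (1 + Complex.I • a))).2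
  simp [add_mul, mul_add, φ.map_one, smul_smul, h0] at h1 h2
  apply Complex.ext
  · simp; linarith
  · simp; linarith

/-- The composition of a state with an automorphism. -/
def comp (β : A ≃⋆ₐ[ℂ] A) : CStarState A where
  toLin := φ.toLin ∘ₗ ((β : A →⋆ₐ[ℂ] A) : A →ₗ[ℂ] A)
  map_one := by simp [φ.map_one]
  nonneg a := by simpa [StarHomClass.map_star β] using φ.nonneg (β a)

@[simp]
lemma comp_toLin (β : A ≃⋆ₐ[ℂ] A) (a : A) : (φ.comp β).toLin a = φ.toLin (β a) := rfl

/-- The Gram matrix of a family of elements in the direct sum of the GNS spaces of a family of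
states is positive semidefinite. -/
lemma posSemidef_gram {S J : Type*} (j : S → J) (φ : J → CStarState A) (a : S → A) :
    Matrix.PosSemidef (Matrix.of fun x y : S => open Classical in
      if j x = j y then (φ (j x)).toLin (star (a x) * a y) else 0) := by
  classical
  refine ⟨?_, fun v => ?_⟩
  · ext x y
    simp only [Matrix.conjTranspose_apply, Matrix.of_apply]
    by_cases h : j x = j y
    · have h' : j y = j x := h.symm
      simp [h, ← map_star]
    · have h' : ¬ j y = j x := fun e => h e.symm
      simp [h, h']
  · have key : (v.sum fun x c => v.sum fun y d => star c *
        (if j x = j y then (φ (j x)).toLin (star (a x) * a y) else 0) * d)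
        = ∑ i ∈ v.support.image j, (φ i).toLin
          (star (∑ x ∈ v.support with j x = i, v x • a x) *
            ∑ x ∈ v.support with j x = i, v x • a x) := by
      simp only [Finsupp.sum]
      rw [← Finset.sum_fiberwise_of_maps_to (t := v.support.image j) (g := j)
        (fun x hx => Finset.mem_image_of_mem j hx)]
      refine Finset.sum_congr rfl fun i _ => ?_
      rw [star_sum, Finset.sum_mul, _root_.map_sum]
      refine Finset.sum_congr rfl fun x hx => ?_
      obtain ⟨_, rfl⟩ := Finset.mem_filter.mp hx
      rw [Finset.mul_sum, _root_.map_sum, Finset.sum_filter]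
      refine Finset.sum_congr rfl fun y _ => ?_
      by_cases h : j x = j y
      · simp [h, mul_comm, mul_left_comm]
      · have h' : ¬ j y = j x := fun e => h e.symm
        simp [h, h']
    simp only [Matrix.of_apply]
    rw [key]
    exact Finset.sum_nonneg fun i _ => (φ i).nonneg _

end CStarState

/-- The C*-algebra generated by the ranges of a family of representations. -/
def generatedBy {B : Type*} [CStarAlgebra B] {ι : Type*} {A : ι → Type*} [∀ k, CStarAlgebra (A k)]
    (ρ : ∀ k, A k →⋆ₐ[ℂ] B) : StarSubalgebra ℂ B :=
  (⨆ k, (ρ k).range).topologicalClosure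

namespace generatedBy

variable {B : Type*} [CStarAlgebra B] {ι : Type*} {A : ι → Type*} [∀ k, CStarAlgebra (A k)]
  (ρ : ∀ k, A k →⋆ₐ[ℂ] B)

instance : IsClosed (generatedBy ρ : Set B) :=
  StarSubalgebra.isClosed_topologicalClosure _

lemma apply_mem (k : ι) (a : A k) : ρ k a ∈ generatedBy ρ :=
  StarSubalgebra.le_topologicalClosure _ (le_iSup (fun k => (ρ k).range) k ⟨a, rfl⟩)

lemma continuous_rep (k : ι) : Continuous (ρ k) :=
  AddMonoidHomClass.continuous_of_bound (ρ k) 1 fun a => by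
    rw [one_mul]; exact NonUnitalStarAlgHom.norm_apply_le (ρ k) a

lemma le_of_isClosed {N : StarSubalgebra ℂ B} (hN : IsClosed (N : Set B))
    (h : ∀ k a, ρ k a ∈ N) : generatedBy ρ ≤ N := by
  refine StarSubalgebra.topologicalClosure_minimal (iSup_le fun k => ?_) hN
  rintro _ ⟨a, rfl⟩
  exact h k a

lemma conj_mem (u : unitary B)
    (h : ∀ k a, (u : B) * ρ k a * star (u : B) ∈ generatedBy ρ) (T : B) (hT : T ∈ generatedBy ρ) :
    (u : B) * T * star (u : B) ∈ generatedBy ρ := by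
  have hle : generatedBy ρ ≤ (generatedBy ρ).comap
      (Unitary.conjStarAlgAut ℂ B u).toStarAlgHom := by
    refine le_of_isClosed ρ ?_ h
    refine IsClosed.preimage (f := fun T : B => (u : B) * T * star (u : B)) ?_
      (StarSubalgebra.isClosed_topologicalClosure _)
    fun_prop
  exact hle hT

/-- If conjugation by a family of unitaries is continuous in norm on the generators, then it is
continuous in norm on the generated C*-algebra. -/
lemma continuous_conj {X : Type*} [TopologicalSpace X] (u : X → unitary B)
    (h : ∀ k a, Continuous fun x => (u x : B) * ρ k a * star (u x : B)) (T : B)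
    (hT : T ∈ generatedBy ρ) : Continuous fun x => (u x : B) * T * star (u x : B) := by
  let N : StarSubalgebra ℂ B :=
    { carrier := {T | Continuous fun x => (u x : B) * T * star (u x : B)}
      mul_mem' := fun {S T} hS hT => by
        have : (fun x => (u x : B) * (S * T) * star (u x : B)) =
            fun x => ((u x : B) * S * star (u x : B)) * ((u x : B) * T * star (u x : B)) := by
          funext x
          have h1 : star (u x : B) * (u x : B) = 1 := Unitary.coe_star_mul_self (u x)
          calc (u x : B) * (S * T) * star (u x : B)
              = (u x : B) * S * 1 * T * star (u x : B) := by simp only [mul_assoc, one_mul]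
            _ = _ := by rw [← h1]; simp only [mul_assoc]
        change Continuous _
        rw [this]
        exact Continuous.mul hS hT
      add_mem' := fun {S T} hS hT => by
        change Continuous _
        simp only [mul_add, add_mul]
        exact Continuous.add hS hT
      algebraMap_mem' := fun r => by
        have : (fun x => (u x : B) * algebraMap ℂ B r * star (u x : B)) =
            fun _ => algebraMap ℂ B r := by
          funext x
          have h1 : (u x : B) * star (u x : B) = 1 := Unitary.coe_mul_star_self (u x)
          rw [← Algebra.commutes, mul_assoc, h1, mul_one]
        change Continuous _
        rw [this]
        exact continuous_const
      star_mem' := fun {T} hT => by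
        have : (fun x => (u x : B) * star T * star (u x : B)) =
            fun x => star ((u x : B) * T * star (u x : B)) := by
          funext x
          simp only [star_mul, star_star, mul_assoc]
        change Continuous _
        rw [this]
        exact Continuous.star hT }
  have hN : IsClosed (N : Set B) := by
    refine isClosed_of_closure_subset fun T hT => ?_
    refine continuous_of_uniform_approx_of_continuous fun V hV => ?_
    obtain ⟨ε, hε, hV⟩ := Metric.mem_uniformity_dist.mp hV
    obtain ⟨S, hS, hd⟩ := Metric.mem_closure_iff.mp hT ε hε
    refine ⟨_, hS, fun x => hV ?_⟩
    rw [dist_eq_norm, ← sub_mul, ← mul_sub]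
    have h1 : ‖(u x : B) * (T - S) * star (u x : B)‖ = ‖T - S‖ := by
      rw [← Unitary.coe_star, CStarRing.norm_mul_coe_unitary, CStarRing.norm_coe_unitary_mul]
    rw [h1, ← dist_eq_norm]
    exact hd
  exact le_of_isClosed ρ (N := N) hN h hT

end generatedBy

section TensorProduct

variable {ι : Type*} (A : ι → Type*) [∀ k, CStarAlgebra (A k)]

/-- The indices of the vectors `ξ_{φ, b}`: families `φ` of states of the factors together with
families `b` of elements of the factors, all but finitely many of which are `1`. -/
abbrev TensorIndex : Type _ :=
  (∀ k, CStarState (A k)) × {b : ∀ k, A k // {k | b k ≠ 1}.Finite}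

open Classical in
/-- The inner products of the vectors `ξ_{φ, b}`, where `ξ_{φ, b}` is the elementary tensor
`⊗ b_k` in the GNS space of the product state `⊗ φ_k`, and GNS spaces belonging to different
families of states are orthogonal. -/
def tensorKernel : Matrix (TensorIndex A) (TensorIndex A) ℂ := Matrix.of fun x y =>
  if x.1 = y.1 then ∏ᶠ k, (x.1 k).toLin (star (x.2.1 k) * y.2.1 k) else 0

variable {A} in
lemma hasFiniteMulSupport_tensorKernel (x y : TensorIndex A) :
    Function.HasFiniteMulSupport fun k => (x.1 k).toLin (star (x.2.1 k) * y.2.1 k) := by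
  refine (x.2.2.union y.2.2).subset fun k hk => ?_
  by_contra h
  simp only [Set.mem_union, Set.mem_ofPred_eq, not_or, not_not] at h
  simp [h.1, h.2, (x.1 k).map_one] at hk

lemma posSemidef_tensorKernel : (tensorKernel A).PosSemidef := by
  classical
  have hF : ∀ F : Finset ι, Matrix.PosSemidef (Matrix.of fun x y : TensorIndex A =>
      if x.1 = y.1 then ∏ k ∈ F, (x.1 k).toLin (star (x.2.1 k) * y.2.1 k) else 0) := by
    intro F
    induction F using Finset.induction_on with
    | empty =>
      have := CStarState.posSemidef_gram (A := ℂ) (fun x : TensorIndex A => x.1)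
        (fun _ => ⟨LinearMap.id, rfl, fun a => star_mul_self_nonneg a⟩) (fun _ => 1)
      simpa using this
    | insert k F hk ih =>
      have := CStarState.posSemidef_gram (fun x : TensorIndex A => x.1)
        (fun φ => φ k) (fun x => x.2.1 k)
      have h2 := this.hadamard ih
      refine (congrArg Matrix.PosSemidef ?_).mp h2
      ext x y
      by_cases h : x.1 = y.1 <;> simp [Matrix.hadamard, h, Finset.prod_insert hk]
  refine ⟨?_, fun v => ?_⟩
  · ext x y
    simp only [Matrix.conjTranspose_apply, tensorKernel, Matrix.of_apply]
    by_cases h : x.1 = y.1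
    · rw [if_pos h, if_pos h.symm, ← starRingEnd_apply]
      refine (MonoidHom.map_finprod ((starRingEnd ℂ : ℂ →+* ℂ) : ℂ →* ℂ)
        (hasFiniteMulSupport_tensorKernel y x)).trans (finprod_congr fun k => ?_)
      simp [← CStarState.map_star, h]
    · rw [if_neg h, if_neg (fun e => h e.symm)]; simp
  · let F : Finset ι := v.support.biUnion fun x => x.2.2.toFinset
    convert (hF F).2 v using 1
    refine Finset.sum_congr rfl fun x hx => Finset.sum_congr rfl fun y hy => ?_
    simp only [tensorKernel, Matrix.of_apply]
    congr 2
    by_cases h : x.1 = y.1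
    · rw [if_pos h, if_pos h]
      refine finprod_eq_prod_of_mulSupport_subset _ fun k hk => ?_
      by_contra hkF
      simp only [F, Finset.coe_biUnion, Set.mem_iUnion, not_exists] at hkF
      have h1 := hkF x hx
      have h2 := hkF y hy
      simp at h1 h2
      simp [h1, h2, (x.1 k).map_one] at hk
    · rw [if_neg h, if_neg h]
    

/-- The Hilbert space `⨁_φ ⊗_k H_{φ_k}`: the direct sum, over all families `φ` of states of the
factors, of the (infinite) tensor products of the GNS spaces along their cyclic vectors. -/
abbrev TensorHilbert : Type _ := KernelSpace (posSemidef_tensorKernel A)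

variable {A}

open Classical in
/-- Multiplication of the `k`-th tensor factor of `ξ_{φ, b}` by `a`. -/
def tensorAct (k : ι) (a : A k) (x : TensorIndex A) : TensorIndex A :=
  (x.1, ⟨Function.update x.2.1 k (a * x.2.1 k), (x.2.2.insert k).subset fun l hl => by
    by_cases h : l = k
    · exact Or.inl h
    · right; simpa [Function.update_of_ne h] using hl⟩)

lemma tensorAct_one (k : ι) (x : TensorIndex A) : tensorAct k 1 x = x := by
  ext l
  · rfl
  · simp [tensorAct]

lemma tensorAct_mul (k : ι) (a b : A k) (x : TensorIndex A) :
    tensorAct k (a * b) x = tensorAct k a (tensorAct k b x) := by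
  ext l
  · rfl
  · simp [tensorAct, mul_assoc]

open Classical in
/-- The factor of the inner product that does not involve the index `k`. -/
def tensorKernelRest (k : ι) (x y : TensorIndex A) : ℂ :=
  if x.1 = y.1 then ∏ᶠ (l : ι) (_ : l ≠ k), (x.1 l).toLin (star (x.2.1 l) * y.2.1 l) else 0

open Classical in
lemma tensorKernel_act (k : ι) (a b : A k) (x y : TensorIndex A) :
    tensorKernel A (tensorAct k a x) (tensorAct k b y) =
      (x.1 k).toLin (star (x.2.1 k) * (star a * b) * y.2.1 k) * tensorKernelRest k x y := by
  by_cases h : x.1 = y.1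
  · have h' : (tensorAct k a x).1 = (tensorAct k b y).1 := h
    rw [tensorKernel, Matrix.of_apply, if_pos h',
      ← mul_finprod_cond_ne k (hasFiniteMulSupport_tensorKernel _ _), tensorKernelRest, if_pos h]
    congr 1
    · simp [tensorAct, mul_assoc]
    · refine finprod_congr fun l => finprod_congr fun hl => ?_
      simp [tensorAct, Function.update_of_ne hl]
  · have h' : ¬ (tensorAct k a x).1 = (tensorAct k b y).1 := h
    rw [tensorKernel, Matrix.of_apply, if_neg h', tensorKernelRest, if_neg h, mul_zero]

lemma exists_star_mul_add_star_mul {B : Type*} [CStarAlgebra B] (a : B) :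
    ∃ c : B, star a * a + star c * c = ((‖a‖ : ℂ) ^ 2) • (1 : B) := by
  let _ := CStarAlgebra.spectralOrder B
  have _ := CStarAlgebra.spectralOrderedRing B
  have h := sub_nonneg.mpr (CStarAlgebra.star_mul_le_algebraMap_norm_sq (a := a))
  obtain ⟨c, hc⟩ := CStarAlgebra.nonneg_iff_eq_star_mul_self.mp h
  refine ⟨c, ?_⟩
  rw [← hc, add_sub_cancel, Algebra.algebraMap_eq_smul_one, ← Complex.ofReal_pow, Complex.coe_smul]

lemma tensorKernel_bound (k : ι) (a c : A k)
    (h : star a * a + star c * c = ((‖a‖ : ℂ) ^ 2) • (1 : A k)) (x y : TensorIndex A) :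
    tensorKernel A (tensorAct k a x) (tensorAct k a y)
      + tensorKernel A (tensorAct k c x) (tensorAct k c y)
      = ((‖a‖ : ℝ) : ℂ) ^ 2 * tensorKernel A x y := by
  rw [tensorKernel_act, tensorKernel_act, ← add_mul, ← map_add, ← add_mul, ← mul_add, h]
  conv_rhs => rw [← tensorAct_one k x, ← tensorAct_one k y, tensorKernel_act]
  simp [mul_assoc]

/-- The operator on `⨁_φ ⊗_k H_{φ_k}` which acts as `a` in the `k`-th tensor factor. -/
def tensorOp (k : ι) (a : A k) : TensorHilbert A →L[ℂ] TensorHilbert A :=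
  KernelSpace.op (posSemidef_tensorKernel A) (tensorAct k a)
    (tensorAct k (exists_star_mul_add_star_mul a).choose) ‖a‖ (norm_nonneg a)
    (tensorKernel_bound k a _ (exists_star_mul_add_star_mul a).choose_spec)

lemma tensorOp_delta (k : ι) (a : A k) (x : TensorIndex A) :
    tensorOp k a (KernelSpace.delta _ x) = KernelSpace.delta _ (tensorAct k a x) :=
  KernelSpace.op_delta ..

lemma inner_tensorOp (k : ι) (a : A k) (x y : TensorIndex A) :
    ⟪KernelSpace.delta (posSemidef_tensorKernel A) x, tensorOp k a (KernelSpace.delta _ y)⟫_ℂ =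
      (x.1 k).toLin (star (x.2.1 k) * a * y.2.1 k) * tensorKernelRest k x y := by
  rw [tensorOp_delta, KernelSpace.inner_delta]
  conv_lhs => rw [← tensorAct_one k x]
  rw [tensorKernel_act]
  simp

variable (A) in
/-- The representation of the `k`-th factor on `⨁_φ ⊗_k H_{φ_k}`. -/
def tensorRep (k : ι) : A k →⋆ₐ[ℂ] (TensorHilbert A →L[ℂ] TensorHilbert A) where
  toFun := tensorOp k
  map_one' := KernelSpace.op_ext fun x y => by
    rw [tensorOp_delta, tensorAct_one]; rfl
  map_mul' a b := KernelSpace.op_ext fun x y => by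
    rw [tensorOp_delta, tensorAct_mul]
    simp [tensorOp_delta]
  map_zero' := KernelSpace.op_ext fun x y => by
    rw [inner_tensorOp]; simp
  map_add' a b := KernelSpace.op_ext fun x y => by
    rw [add_apply, inner_add_right, inner_tensorOp, inner_tensorOp, inner_tensorOp]
    simp [mul_add, add_mul]
  commutes' r := KernelSpace.op_ext fun x y => by
    have : algebraMap ℂ (TensorHilbert A →L[ℂ] TensorHilbert A) r (KernelSpace.delta _ y)
        = r • KernelSpace.delta _ y := by
      simp [Algebra.algebraMap_eq_smul_one]
    rw [inner_tensorOp, this, inner_smul_right, KernelSpace.inner_delta]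
    conv_rhs => rw [← tensorAct_one k x, ← tensorAct_one k y, tensorKernel_act]
    simp [Algebra.algebraMap_eq_smul_one, mul_assoc]
  map_star' a := KernelSpace.op_ext fun x y => by
    rw [ContinuousLinearMap.star_eq_adjoint, ContinuousLinearMap.adjoint_inner_right,
      tensorOp_delta, tensorOp_delta, KernelSpace.inner_delta, KernelSpace.inner_delta]
    conv_lhs => rw [← tensorAct_one k x]
    conv_rhs => rw [← tensorAct_one k y]
    rw [tensorKernel_act, tensorKernel_act]
    simp

variable (A) in
/-- The minimal (spatial) tensor product of a finite or infinite family of unital C*-algebras,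
concretely represented: the C*-algebra of operators on `⨁_φ ⊗_k H_{φ_k}` generated by the operators
acting as an element of `A k` in the `k`-th tensor factor. -/
def MinTensor : Type _ :=
  ↥(generatedBy (tensorRep A))

instance : CStarAlgebra (MinTensor A) :=
  inferInstanceAs (CStarAlgebra ↥(generatedBy (tensorRep A)))

namespace MinTensor

variable (A) in
/-- The inclusion `a ↦ 1 ⊗ ⋯ ⊗ 1 ⊗ a ⊗ 1 ⊗ ⋯` of the `k`-th factor. -/
def incl (k : ι) : A k →⋆ₐ[ℂ] MinTensor A :=
  (tensorRep A k).codRestrict _ (generatedBy.apply_mem (tensorRep A) k)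

end MinTensor

end TensorProduct
end

noncomputable section

variable {ι : Type*} {A : ι → Type*} [∀ k, CStarAlgebra (A k)]

lemma inv_apply_self_aux {B : Type*} [CStarAlgebra B] (β : B ≃⋆ₐ[ℂ] B) (b : B) :
    β⁻¹ (β b) = b :=
  β.symm_apply_apply b

section Conjugation

variable {B Γ : Type*} [CStarAlgebra B] [Group Γ]

/-- If a group of unitaries normalizes a *-subalgebra, then it acts on this subalgebra by
conjugation. -/
def conjAut (M : StarSubalgebra ℂ B) (u : Γ →* unitary B)
    (h : ∀ g, ∀ T ∈ M, (u g : B) * T * star (u g : B) ∈ M) : Γ →* (M ≃⋆ₐ[ℂ] M) where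
  toFun g :=
    { toFun := fun T => ⟨(u g : B) * T.1 * star (u g : B), h g T.1 T.2⟩
      invFun := fun T => ⟨(u g⁻¹ : B) * T.1 * star (u g⁻¹ : B), h g⁻¹ T.1 T.2⟩
      left_inv := fun T => Subtype.ext <| by
        have h1 : (u g⁻¹ : B) * (u g : B) = 1 := by
          rw [← Submonoid.coe_mul, ← map_mul, inv_mul_cancel, map_one]; rfl
        have h2 : star (u g : B) * star (u g⁻¹ : B) = 1 := by rw [← star_mul, h1, star_one]
        calc (u g⁻¹ : B) * ((u g : B) * T.1 * star (u g : B)) * star (u g⁻¹ : B)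
            = ((u g⁻¹ : B) * (u g : B)) * T.1 * (star (u g : B) * star (u g⁻¹ : B)) := by
              simp only [mul_assoc]
          _ = T.1 := by rw [h1, h2, one_mul, mul_one]
      right_inv := fun T => Subtype.ext <| by
        have h1 : (u g : B) * (u g⁻¹ : B) = 1 := by
          rw [← Submonoid.coe_mul, ← map_mul, mul_inv_cancel, map_one]; rfl
        have h2 : star (u g⁻¹ : B) * star (u g : B) = 1 := by rw [← star_mul, h1, star_one]
        calc (u g : B) * ((u g⁻¹ : B) * T.1 * star (u g⁻¹ : B)) * star (u g : B)
            = ((u g : B) * (u g⁻¹ : B)) * T.1 * (star (u g⁻¹ : B) * star (u g : B)) := by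
              simp only [mul_assoc]
          _ = T.1 := by rw [h1, h2, one_mul, mul_one]
      map_mul' := fun S T => Subtype.ext <| by
        have h1 : star (u g : B) * (u g : B) = 1 := Unitary.coe_star_mul_self (u g)
        calc (u g : B) * (S.1 * T.1) * star (u g : B)
            = (u g : B) * S.1 * 1 * T.1 * star (u g : B) := by simp only [mul_assoc, one_mul]
          _ = (u g : B) * S.1 * star (u g : B) * ((u g : B) * T.1 * star (u g : B)) := by
              rw [← h1]; simp only [mul_assoc]
      map_add' := fun S T => Subtype.ext <| by
        change (u g : B) * (S.1 + T.1) * star (u g : B) = _ * _ * _ + _ * _ * _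
        rw [mul_add, add_mul]
      map_smul' := fun r T => Subtype.ext <| by
        change (u g : B) * (r • T.1) * star (u g : B) = r • (_ * _ * _)
        rw [mul_smul_comm, smul_mul_assoc]
      map_star' := fun T => Subtype.ext <| by
        change (u g : B) * star T.1 * star (u g : B) = star (_ * _ * _)
        simp only [star_mul, star_star, mul_assoc] }
  map_one' := by
    ext T
    change (u 1 : B) * T.1 * star (u 1 : B) = T.1
    simp
  map_mul' g g' := by
    ext T
    change (u (g * g') : B) * T.1 * star (u (g * g') : B)
      = (u g : B) * ((u g' : B) * T.1 * star (u g' : B)) * star (u g : B)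
    simp [mul_assoc]

end Conjugation

/-- The action of a family of automorphisms of the factors on the vectors `ξ_{φ, b}`. -/
def tensorTwist (β : ∀ k, A k ≃⋆ₐ[ℂ] A k) (x : TensorIndex A) : TensorIndex A :=
  (fun k => (x.1 k).comp (β⁻¹ k), ⟨fun k => β k (x.2.1 k), x.2.2.subset fun k hk h => hk <| by
    simp [h]⟩)

lemma tensorTwist_one (x : TensorIndex A) : tensorTwist 1 x = x := by
  ext k
  · simp [tensorTwist]
  · rfl

lemma tensorTwist_mul (β γ : ∀ k, A k ≃⋆ₐ[ℂ] A k) (x : TensorIndex A) :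
    tensorTwist (β * γ) x = tensorTwist β (tensorTwist γ x) := by
  ext k
  · simp [tensorTwist]
  · rfl

open Classical in
lemma tensorTwist_act (β : ∀ k, A k ≃⋆ₐ[ℂ] A k) (k : ι) (a : A k) (x : TensorIndex A) :
    tensorTwist β (tensorAct k a x) = tensorAct k (β k a) (tensorTwist β x) := by
  ext l
  · rfl
  · by_cases h : l = k
    · subst h; simp [tensorTwist, tensorAct]
    · simp only [tensorTwist, tensorAct, Function.update_of_ne h]

lemma tensorKernel_twist (β : ∀ k, A k ≃⋆ₐ[ℂ] A k) (x y : TensorIndex A) :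
    tensorKernel A (tensorTwist β x) (tensorTwist β y) = tensorKernel A x y := by
  have hinj : (tensorTwist β x).1 = (tensorTwist β y).1 ↔ x.1 = y.1 := by
    refine ⟨fun h => ?_, fun h => by simp [tensorTwist, h]⟩
    funext k
    have hk := congrFun h k
    ext a
    have := congrArg (fun φ : CStarState (A k) => φ.toLin (β k a)) hk
    simpa only [tensorTwist, CStarState.comp_toLin, Pi.inv_apply, inv_apply_self_aux] using this
  by_cases h : x.1 = y.1
  · rw [tensorKernel, Matrix.of_apply, Matrix.of_apply, if_pos h, if_pos (hinj.mpr h)]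
    refine finprod_congr fun k => ?_
    simp only [tensorTwist, CStarState.comp_toLin]
    rw [← StarHomClass.map_star (β k), ← map_mul, Pi.inv_apply, inv_apply_self_aux]
  · rw [tensorKernel, Matrix.of_apply, Matrix.of_apply, if_neg h, if_neg (mt hinj.mp h)]

/-- The unitary operator on `⨁_φ ⊗_k H_{φ_k}` which implements a family of automorphisms. -/
def tensorUnitaryOp (β : ∀ k, A k ≃⋆ₐ[ℂ] A k) : TensorHilbert A →L[ℂ] TensorHilbert A :=
  KernelSpace.op (posSemidef_tensorKernel A) (tensorTwist β) (tensorTwist β) (√2)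
    (Real.sqrt_nonneg 2) fun x y => by
      rw [tensorKernel_twist, ← Complex.ofReal_pow, Real.sq_sqrt (by norm_num)]
      push_cast; ring

lemma tensorUnitaryOp_delta (β : ∀ k, A k ≃⋆ₐ[ℂ] A k) (x : TensorIndex A) :
    tensorUnitaryOp β (KernelSpace.delta _ x) = KernelSpace.delta _ (tensorTwist β x) :=
  KernelSpace.op_delta ..

lemma tensorUnitaryOp_one : tensorUnitaryOp (1 : ∀ k, A k ≃⋆ₐ[ℂ] A k) = 1 :=
  KernelSpace.op_ext fun x y => by rw [tensorUnitaryOp_delta, tensorTwist_one]; rfl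

lemma tensorUnitaryOp_mul (β γ : ∀ k, A k ≃⋆ₐ[ℂ] A k) :
    tensorUnitaryOp (β * γ) = tensorUnitaryOp β * tensorUnitaryOp γ :=
  KernelSpace.op_ext fun x y => by
    rw [mul_apply_eq_comp, tensorUnitaryOp_delta, tensorUnitaryOp_delta,
      tensorUnitaryOp_delta, tensorTwist_mul]

lemma star_tensorUnitaryOp (β : ∀ k, A k ≃⋆ₐ[ℂ] A k) :
    star (tensorUnitaryOp β) = tensorUnitaryOp β⁻¹ :=
  KernelSpace.op_ext fun x y => by
    rw [ContinuousLinearMap.star_eq_adjoint, ContinuousLinearMap.adjoint_inner_right,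
      tensorUnitaryOp_delta, tensorUnitaryOp_delta, KernelSpace.inner_delta,
      KernelSpace.inner_delta, ← tensorKernel_twist β⁻¹, ← tensorTwist_mul, inv_mul_cancel,
      tensorTwist_one]

variable (A) in
/-- The unitary representation of the group of all families of automorphisms. -/
def tensorUnitary :
    (∀ k, A k ≃⋆ₐ[ℂ] A k) →* unitary (TensorHilbert A →L[ℂ] TensorHilbert A) where
  toFun β := ⟨tensorUnitaryOp β, by
    rw [Unitary.mem_iff, star_tensorUnitaryOp, ← tensorUnitaryOp_mul, ← tensorUnitaryOp_mul,
      inv_mul_cancel, mul_inv_cancel, tensorUnitaryOp_one]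
    exact ⟨rfl, rfl⟩⟩
  map_one' := Subtype.ext tensorUnitaryOp_one
  map_mul' β γ := Subtype.ext (tensorUnitaryOp_mul β γ)

lemma conj_tensorRep (β : ∀ k, A k ≃⋆ₐ[ℂ] A k) (k : ι) (a : A k) :
    (tensorUnitary A β : TensorHilbert A →L[ℂ] TensorHilbert A) * tensorRep A k a
      * star (tensorUnitary A β : TensorHilbert A →L[ℂ] TensorHilbert A)
      = tensorRep A k (β k a) := by
  refine KernelSpace.op_ext fun x y => ?_
  change ⟪_, (tensorUnitaryOp β * tensorOp k a * star (tensorUnitaryOp β)) _⟫_ℂ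
    = ⟪_, tensorOp k (β k a) _⟫_ℂ
  rw [star_tensorUnitaryOp, mul_apply_eq_comp, mul_apply_eq_comp,
    tensorUnitaryOp_delta, tensorOp_delta, tensorUnitaryOp_delta, tensorOp_delta, tensorTwist_act,
    ← tensorTwist_mul, mul_inv_cancel, tensorTwist_one]

namespace MinTensor

variable (A) in
/-- The automorphism `⊗ β_k` of the minimal tensor product, as a homomorphism on the group of
all families `β` of automorphisms of the factors. -/
def aut : (∀ k, A k ≃⋆ₐ[ℂ] A k) →* (MinTensor A ≃⋆ₐ[ℂ] MinTensor A) :=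
  conjAut (generatedBy (tensorRep A)) (tensorUnitary A) fun β =>
    generatedBy.conj_mem (tensorRep A) (tensorUnitary A β) fun k a => by
      rw [conj_tensorRep]
      exact generatedBy.apply_mem (tensorRep A) k (β k a)

lemma aut_incl (β : ∀ k, A k ≃⋆ₐ[ℂ] A k) (k : ι) (a : A k) :
    aut A β (incl A k a) = incl A k (β k a) :=
  Subtype.ext (conj_tensorRep β k a)

end MinTensor

/-- A continuous action of a topological group on a C*-algebra. -/
structure CStarAction (G : Type*) [Group G] [TopologicalSpace G] (A : Type*) [CStarAlgebra A] where
  /-- the underlying homomorphism to the group of *-automorphisms -/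
  toAut : G →* (A ≃⋆ₐ[ℂ] A)
  continuous_apply : ∀ a, Continuous fun g => toAut g a

/-- The (infinite) minimal tensor product action of `∏ G k` on `⊗ A k`. -/
def tensorAction {G : ι → Type*} [∀ k, Group (G k)] [∀ k, TopologicalSpace (G k)]
    (α : ∀ k, CStarAction (G k) (A k)) : CStarAction (∀ k, G k) (MinTensor A) where
  toAut := (MinTensor.aut A).comp (MonoidHom.pi fun k => (α k).toAut.comp (Pi.evalMonoidHom G k))
  continuous_apply := fun T => by
    refine Continuous.subtype_mk (generatedBy.continuous_conj (tensorRep A)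
      (fun g : ∀ k, G k => tensorUnitary A fun k => (α k).toAut (g k)) (fun k a => ?_) T.1 T.2) _
    have h : (fun g : ∀ k, G k => (tensorUnitary A (fun k => (α k).toAut (g k)) :
        TensorHilbert A →L[ℂ] TensorHilbert A) * tensorRep A k a * star (tensorUnitary A
          (fun k => (α k).toAut (g k)) : TensorHilbert A →L[ℂ] TensorHilbert A))
        = fun g => tensorRep A k ((α k).toAut (g k) a) :=
      funext fun g => conj_tensorRep _ k a
    rw [h]
    exact (generatedBy.continuous_rep (tensorRep A) k).comp
      (((α k).continuous_apply a).comp (continuous_apply k))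

lemma tensorAction_incl {G : ι → Type*} [∀ k, Group (G k)] [∀ k, TopologicalSpace (G k)]
    (α : ∀ k, CStarAction (G k) (A k)) (g : ∀ k, G k) (k : ι) (a : A k) :
    (tensorAction α).toAut g (MinTensor.incl A k a)
      = MinTensor.incl A k ((α k).toAut (g k) a) :=
  MinTensor.aut_incl _ k a
end

noncomputable section

/-- A unital C*-algebra is simple if it is nonzero and has no nontrivial closed two-sided ideals. -/
structure IsSimpleCStar (A : Type*) [CStarAlgebra A] : Prop where
  nontrivial : Nontrivial A
  eq_bot_or_eq_top : ∀ I : TwoSidedIdeal A, IsClosed (I : Set A) → I = ⊥ ∨ I = ⊤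

/-- Cuntz subequivalence relative to the C*-algebra `A`: there are `v_n ∈ A` such that
`v_n b v_n^*` converges to `a`. -/
def CuntzSubeq {A : Type*} [CStarAlgebra A] (a b : A) : Prop :=
  a ∈ closure (Set.range fun v : A => v * b * star v)

/-- Murray-von Neumann equivalence of projections. -/
def MurrayVonNeumannEquiv {A : Type*} [CStarAlgebra A] (p q : A) : Prop :=
  ∃ v : A, star v * v = p ∧ v * star v = q

/-- A quasitrace: a function on `A` which is positive and tracial, compatible with real and
imaginary parts, and linear on every commutative C*-subalgebra. -/
structure IsQuasitrace {A : Type*} [CStarAlgebra A] (τ : A → ℂ) : Prop where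
  nonneg : ∀ x, 0 ≤ τ (star x * x)
  trace : ∀ x, τ (star x * x) = τ (x * star x)
  map_add_I_smul : ∀ a b, IsSelfAdjoint a → IsSelfAdjoint b →
    τ (a + Complex.I • b) = τ a + Complex.I * τ b
  linear : ∀ C : NonUnitalStarSubalgebra ℂ A, IsClosed (C : Set A) →
    (∀ x ∈ C, ∀ y ∈ C, x * y = y * x) →
    ∀ x ∈ C, ∀ y ∈ C, ∀ c d : ℂ, τ (c • x + d • y) = c * τ x + d * τ y

/-- The root `a^{1/(k+1)}` of a positive element. -/
def positiveRoot {A : Type*} [CStarAlgebra A] (k : ℕ) (a : A) : A :=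
  cfc (fun t : ℝ => t ^ (1 / ((k : ℝ) + 1))) a

/-- The upper left corner embedding `a ↦ a ⊕ 0` of `M_n(A)` in `M_m(A)`, for `n ≤ m`. -/
def cornerEmbedding {A : Type*} [Zero A] {n : ℕ} (m : ℕ) (a : CStarMatrix (Fin n) (Fin n) A) :
    CStarMatrix (Fin m) (Fin m) A :=
  CStarMatrix.ofMatrix <| Matrix.of fun i j =>
    if h : i.1 < n ∧ j.1 < n then a ⟨i.1, h.1⟩ ⟨j.1, h.2⟩ else 0

section Order

/- Every C*-algebra carries its usual order, `a ≤ b` if and only if `b - a` is positive. -/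
attribute [local instance] CStarAlgebra.spectralOrder CStarAlgebra.spectralOrderedRing

/-- A unital C*-algebra is stably finite if all isometries in matrix algebras over it are
unitary. -/
def IsStablyFiniteCStar (A : Type*) [CStarAlgebra A] : Prop :=
  ∀ (n : ℕ) (v : CStarMatrix (Fin n) (Fin n) A), star v * v = 1 → v * star v = 1

/-- `QT(A)`: a normalized 2-quasitrace on `A`, together with its extension to all matrix algebras
over `A`. (A 2-quasitrace on `A` has exactly one such extension.) -/
structure NormalizedQuasitrace (A : Type*) [CStarAlgebra A] where
  /-- the function on `M_n(A)` -/
  toFun : ∀ n : ℕ, CStarMatrix (Fin n) (Fin n) A → ℂ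
  isQuasitrace : ∀ n, IsQuasitrace (toFun n)
  map_corner : ∀ n m, n ≤ m → ∀ a, toFun m (cornerEmbedding m a) = toFun n a
  normalized : toFun 1 1 = 1

/-- The dimension function `d_τ(a) = lim_k τ(a^{1/k})`, for `a ∈ M_n(A)` positive. -/
def dimensionFunction {A : Type*} [CStarAlgebra A] (τ : NormalizedQuasitrace A) {n : ℕ}
    (a : CStarMatrix (Fin n) (Fin n) A) : ℝ :=
  Filter.limUnder Filter.atTop fun k : ℕ => (τ.toFun n (positiveRoot k a)).re

/-- Strict comparison of positive elements: `d_τ(a) < d_τ(b)` for all `τ ∈ QT(A)` implies that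
`a` is Cuntz subequivalent to `b`, for positive `a` and `b` in matrix algebras over `A`. -/
def HasStrictComparison (A : Type*) [CStarAlgebra A] : Prop :=
  ∀ (n : ℕ) (a b : CStarMatrix (Fin n) (Fin n) A), 0 ≤ a → 0 ≤ b →
    (∀ τ : NormalizedQuasitrace A, dimensionFunction τ a < dimensionFunction τ b) →
    CuntzSubeq a b

/-- Complete positivity of a linear map between C*-algebras. -/
def IsCompletelyPositive {D A : Type*} [CStarAlgebra D] [CStarAlgebra A] (φ : D →ₗ[ℂ] A) : Prop :=
  ∃ Φ : CompletelyPositiveMap D A, Φ.toLinearMap = φ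

/-- The tracial Rokhlin property for an action of a finite group on an infinite dimensional simple
unital C*-algebra. -/
structure HasTracialRokhlinProperty {G A : Type*} [Group G] [Fintype G] [TopologicalSpace G]
    [CStarAlgebra A] (α : CStarAction G A) : Prop where
  simple : IsSimpleCStar A
  infiniteDimensional : ¬ FiniteDimensional ℂ A
  exists_projections : ∀ (F : Finset A) (ε : ℝ), 0 < ε → ∀ x : A, 0 ≤ x → ‖x‖ = 1 →
    ∃ e : G → A, (∀ g, IsStarProjection (e g)) ∧ (∀ g h, g ≠ h → e g * e h = 0) ∧
      (∀ g h, ‖α.toAut g (e h) - e (g * h)‖ < ε) ∧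
      (∀ g, ∀ a ∈ F, ‖e g * a - a * e g‖ < ε) ∧
      (∃ q, IsStarProjection q ∧ q ∈ closure (Set.range fun a => x * a * x) ∧
        MurrayVonNeumannEquiv (1 - ∑ g, e g) q) ∧
      1 - ε < ‖(∑ g, e g) * x * (∑ g, e g)‖

/-- The fixed point algebra `A^α`. -/
def fixedPointAlgebra {G A : Type*} [Group G] [TopologicalSpace G] [CStarAlgebra A]
    (α : CStarAction G A) : StarSubalgebra ℂ A where
  carrier := {a | ∀ g, α.toAut g a = a}
  mul_mem' ha hb g := by rw [map_mul, ha g, hb g]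
  add_mem' ha hb g := by rw [map_add, ha g, hb g]
  algebraMap_mem' r g := by
    rw [Algebra.algebraMap_eq_smul_one, map_smul, map_one]
  star_mem' ha g := by rw [StarHomClass.map_star, ha g]

instance {G A : Type*} [Group G] [TopologicalSpace G] [CStarAlgebra A] (α : CStarAction G A) :
    IsClosed (fixedPointAlgebra α : Set A) := by
  have h : (fixedPointAlgebra α : Set A) = ⋂ g, {a | α.toAut g a = a} := by
    ext a; simp [fixedPointAlgebra]
  rw [h]
  exact isClosed_iInter fun g =>
    isClosed_eq (StarAlgEquiv.isometry (α.toAut g)).continuous continuous_id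

/-- Left translation on `C(G)`: `(Lt_g f)(h) = f(g⁻¹ h)`. -/
def leftTranslate {G : Type*} [Group G] [TopologicalSpace G] [IsTopologicalGroup G] (g : G)
    (f : C(G, ℂ)) : C(G, ℂ) :=
  f.comp ⟨fun h => g⁻¹ * h, by fun_prop⟩

/-- Approximate multiplicativity, centrality and equivariance (with respect to left translation)
of a map from `C(G)`, on `S ⊆ C(G)` and `F ⊆ A`. The last condition says that the supremum over
`G` is less than `ε`. -/
structure IsApproxEquivariantCentralMultiplicative {G A : Type*} [Group G] [TopologicalSpace G]
    [IsTopologicalGroup G] [CompactSpace G] [CStarAlgebra A] (α : CStarAction G A)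
    (F : Finset A) (S : Finset C(G, ℂ)) (ε : ℝ) (φ : C(G, ℂ) →ₗ[ℂ] A) : Prop where
  mul : ∀ f₁ ∈ S, ∀ f₂ ∈ S, ‖φ (f₁ * f₂) - φ f₁ * φ f₂‖ < ε
  central : ∀ f ∈ S, ∀ a ∈ F, ‖φ f * a - a * φ f‖ < ε
  equivariant : ∀ f ∈ S, ∃ δ < ε, ∀ g, ‖φ (leftTranslate g f) - α.toAut g (φ f)‖ ≤ δ

/-- The restricted tracial Rokhlin property with comparison for an action of a second countable
compact group on an infinite dimensional simple unital C*-algebra. A unital completely positive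
map `C(G) → pAp` is a completely positive map `φ` to `A` with range in `pAp` and `φ 1 = p`. -/
structure HasRestrictedTracialRokhlinPropertyWithComparison {G A : Type*} [Group G]
    [TopologicalSpace G] [IsTopologicalGroup G] [CompactSpace G] [T2Space G]
    [SecondCountableTopology G] [CStarAlgebra A] (α : CStarAction G A) : Prop where
  simple : IsSimpleCStar A
  infiniteDimensional : ¬ FiniteDimensional ℂ A
  exists_projection : ∀ (F : Finset A) (S : Finset C(G, ℂ)) (ε : ℝ), 0 < ε →
    ∀ x : A, 0 ≤ x → x ≠ 0 → ∀ y : fixedPointAlgebra α, 0 ≤ (y : A) → y ≠ 0 →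
    ∃ (p : fixedPointAlgebra α) (φ : C(G, ℂ) →ₗ[ℂ] A), IsStarProjection p ∧
      IsCompletelyPositive φ ∧ φ 1 = p ∧ (∀ f, (p : A) * φ f * p = φ f) ∧
      IsApproxEquivariantCentralMultiplicative α F S ε φ ∧
      CuntzSubeq (1 - p : A) x ∧ CuntzSubeq (1 - p) y ∧ CuntzSubeq (1 - p) p

end Order

end

/-!
The proof works with finite stages of the tensor product, where it produces projections that are
permuted exactly by the group, and with order inequalities instead of Cuntz subequivalence: for a
projection `q`, an inequality `q ≤ t * b * star t` can be normalized to an equation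
`v * b * star v = q` (`projNormalizer`), and `v` is fixed by a group whenever `q`, `t` and `b` are.

*Tensor products.* Every nonzero positive element of a finite minimal tensor product dominates an
elementary tensor of positive elements of norm one (`MinTensor.exists_tprod_dominated`). Indeed some
product state does not vanish on a conjugate of it, and a product state can be excised one factor at
a time (`CStarState.exists_excising`, `MinTensor.exists_excising_family`). Simplicity is expressed
by fullness: `1` is a finite sum of conjugates of every nonzero positive element. Fullness passes to
elementary tensors, hence to finite tensor products, and then to the infinite one, in which the
finite stages (`MinTensor.stage`) are dense.

*Exact Rokhlin families.* The projections provided by the tracial Rokhlin property can be perturbed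
to orthogonal projections that are permuted exactly (`exists_isRokhlinFamily_near`), and tensor
products of such families are again of this kind. The defect of a tensor product is dominated by the
sum of the defects in the factors, and this sum is dominated by a prescribed nonzero positive element
if the defects are chosen small enough, because orthogonal copies of nonzero elements of the factors
fit under that element. The sum `P` of the family cannot make a given nonzero positive element `y`
small by compression, because `y` dominates an elementary tensor (`hasExactRokhlin_tensorAction`).

*Comparison in the fixed point algebra.* Let `f` be an exact Rokhlin family and let `D` be a fixed
element which commutes with it. The translates of `d = f 1 * D` are orthogonal, so if a fixed
projection `q` is dominated by `d * d * d`, then averaging the implementing element over the group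
shows that `q` is dominated by the sum of the translates of `d` within the fixed point algebra
(`dominatedIn_sum_of_le_cube`). For a fixed `y` one takes `D` to be a cut-down of the compression
`∑ k, f k * y * f k`; in this way domination in the whole algebra by a suitable element implies
domination by `y` in the fixed point algebra (`HasExactRokhlin.exists_test`). To dominate the defect
`1 - p` of a second family by `p` itself, one takes `D` to be a spectral projection `R` of
`∑ k, f k * p * f k`, which is nearly a projection. Then `f 1` is the sum of the projection
`f 1 * R` and a projection dominated by `1 - p`. Since `f 1` is full, its trace is bounded below
uniformly in all quasitraces, while `1 - p` has many orthogonal copies and therefore small trace. Hence `1 - p` has smaller trace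
than `f 1 * R`, and strict comparison applies (`HasStrictComparison.exists_eq`,
`HasExactRokhlin.exists_isRokhlinFamily`).

*The infinite tensor product.* Up to a small error, the given elements and the given continuous
functions on the product of the groups (`exists_forall_norm_sub_lt`) come from one finite stage, and
the test elements `x` and `y` dominate nonzero positive elements of that stage. With a Rokhlin family `e` of that stage, the map `φ f = ∑ h, f (x h) • e h`, where `x h`
extends `h` by units, is a *-homomorphism (`sampleHom`); in particular it is completely positive and
exactly multiplicative, and it is equivariant up to the oscillation of `f` over the remaining
coordinates.
-/

noncomputable section

attribute [local instance] CStarAlgebra.spectralOrder CStarAlgebra.spectralOrderedRing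

/-! ### Projections below positive elements -/

section Projections

variable {C : Type*} [CStarAlgebra C]

/-- The inverse square root of an invertible positive element. -/
def invSqrt (S : C) : C := cfc (fun t : ℝ => (√t)⁻¹) S

lemma isSelfAdjoint_invSqrt (S : C) : IsSelfAdjoint (invSqrt S) := cfc_predicate _ _

lemma Commute.invSqrt {S x : C} (h : Commute S x) : Commute (invSqrt S) x := h.cfc_real _

lemma pos_of_mem_spectrum_of_smul_one_le {S : C} {c : ℝ} (hc : 0 < c)
    (hS : c • (1 : C) ≤ S) (t : ℝ) (ht : t ∈ spectrum ℝ S) : 0 < t := by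
  have hS0 : 0 ≤ S := (smul_nonneg hc.le zero_le_one).trans hS
  rw [← Algebra.algebraMap_eq_smul_one, algebraMap_le_iff_le_spectrum (a := S)] at hS
  exact hc.trans_le (hS t ht)

lemma continuousOn_inv_sqrt {s : Set ℝ} (h : ∀ t ∈ s, 0 < t) :
    ContinuousOn (fun t : ℝ => (√t)⁻¹) s :=
  (Real.continuous_sqrt.continuousOn).inv₀ fun t ht => (Real.sqrt_pos.mpr (h t ht)).ne'

lemma invSqrt_mul_mul {S : C} {c : ℝ} (hc : 0 < c) (hS : c • (1 : C) ≤ S) :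
    invSqrt S * S * invSqrt S = 1 := by
  have hpos := pos_of_mem_spectrum_of_smul_one_le hc hS
  have hS0 : 0 ≤ S := (smul_nonneg hc.le zero_le_one).trans hS
  have hcont := continuousOn_inv_sqrt hpos
  have h1 : S = cfc (fun t : ℝ => t) S := (cfc_id' ℝ S (IsSelfAdjoint.of_nonneg hS0)).symm
  have h2 : invSqrt S * S * invSqrt S
      = cfc (fun t : ℝ => (√t)⁻¹) S * cfc (fun t : ℝ => t) S * cfc (fun t : ℝ => (√t)⁻¹) S := by
    rw [← h1]; rfl
  have hcont2 : ContinuousOn (fun t : ℝ => (√t)⁻¹ * t) (spectrum ℝ S) := hcont.mul continuousOn_id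
  rw [h2, ← cfc_mul _ (fun t : ℝ => t) S hcont continuousOn_id,
    ← cfc_mul _ _ S hcont2 hcont,
    ← cfc_one ℝ S (IsSelfAdjoint.of_nonneg hS0)]
  refine cfc_congr fun t ht => ?_
  have ht' := hpos t ht
  have h3 : √t ≠ 0 := (Real.sqrt_pos.mpr ht').ne'
  have h4 : √t * √t = t := Real.mul_self_sqrt ht'.le
  simp only [Pi.one_apply]
  field_simp
  nlinarith [h4]

lemma map_invSqrt {C' : Type*} [CStarAlgebra C'] (θ : C →⋆ₐ[ℂ] C') {S : C} {c : ℝ} (hc : 0 < c)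
    (hS : c • (1 : C) ≤ S) : θ (invSqrt S) = invSqrt (θ S) := by
  have hS0 : 0 ≤ S := (smul_nonneg hc.le zero_le_one).trans hS
  have h1 : IsSelfAdjoint S := IsSelfAdjoint.of_nonneg hS0
  exact StarAlgHom.map_cfc θ _ S
    (continuousOn_inv_sqrt (pos_of_mem_spectrum_of_smul_one_le hc hS))
    (AddMonoidHomClass.continuous_of_bound θ 1 fun a => by
      rw [one_mul]; exact NonUnitalStarAlgHom.norm_apply_le θ a) h1 (h1.map θ)

/-- A normalization `w` of the projection `q` with `w * D * star w = q`, for `D` bounded below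
on `q`. -/
def projNormalizer (q D : C) : C := invSqrt (q * D * q + (1 - q)) * q

variable {q D : C}

/-- The element whose inverse square root occurs in `projNormalizer` is bounded below: it is the
compression to the corner of `q`, completed by the unit of the complementary corner. -/
lemma smul_one_le_projNormalizer_aux (hq : IsStarProjection q) {c : ℝ}
    (h : c • q ≤ q * D * q) : (min c 1) • (1 : C) ≤ q * D * q + (1 - q) := by
  have h1 : (min c 1) • q ≤ c • q := smul_le_smul_of_nonneg_right (min_le_left _ _) hq.nonneg
  have h2 : (min c 1) • (1 - q) ≤ (1 : ℝ) • (1 - q) :=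
    smul_le_smul_of_nonneg_right (min_le_right _ _) hq.one_sub.nonneg
  calc (min c 1) • (1 : C) = (min c 1) • q + (min c 1) • (1 - q) := by
        rw [← smul_add, add_sub_cancel]
    _ ≤ _ := add_le_add (h1.trans h) (h2.trans (one_smul ℝ _).le)

lemma projNormalizer_mul_mul_star (hq : IsStarProjection q) {c : ℝ} (hc : 0 < c)
    (h : c • q ≤ q * D * q) : projNormalizer q D * D * star (projNormalizer q D) = q := by
  have hS := smul_one_le_projNormalizer_aux hq h
  have hc' : 0 < min c 1 := lt_min hc one_pos
  have hw := invSqrt_mul_mul hc' hS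
  have hqq : q * q = q := hq.isIdempotentElem
  have hq1 : q * (1 - q) = 0 := by rw [mul_sub, mul_one, hqq, sub_self]
  have hq2 : (1 - q) * q = 0 := by rw [sub_mul, one_mul, hqq, sub_self]
  have h11 : (1 - q) * (1 - q) = 1 - q := hq.one_sub.isIdempotentElem
  have hSq : (q * D * q + (1 - q)) * (1 - q) = 1 - q := by
    rw [add_mul, mul_assoc, hq1, mul_zero, zero_add, h11]
  have hqS : (1 - q) * (q * D * q + (1 - q)) = 1 - q := by
    rw [mul_add, ← mul_assoc, ← mul_assoc, hq2, zero_mul, zero_mul, zero_add, h11]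
  have hcomm : Commute (q * D * q + (1 - q)) (1 - q) := hSq.trans hqS.symm
  unfold projNormalizer
  set S := q * D * q + (1 - q) with hSdef
  have hcw := hcomm.invSqrt
  have hcw' : Commute (invSqrt S) S := (Commute.refl S).invSqrt
  have h3 : invSqrt S * (1 - q) * invSqrt S = 1 - q := by
    calc invSqrt S * (1 - q) * invSqrt S = invSqrt S * (S * (1 - q)) * invSqrt S := by rw [hSq]
      _ = (invSqrt S * S * invSqrt S) * (1 - q) := by
          rw [← mul_assoc, mul_assoc _ (1 - q), ← hcw.eq, ← mul_assoc]
      _ = 1 - q := by rw [hw, one_mul]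
  calc invSqrt S * q * D * star (invSqrt S * q)
      = invSqrt S * (q * D * q) * invSqrt S := by
        rw [star_mul, (isSelfAdjoint_invSqrt S).star_eq, hq.isSelfAdjoint.star_eq]
        simp only [mul_assoc]
    _ = invSqrt S * (S - (1 - q)) * invSqrt S := by rw [hSdef, add_sub_cancel_right]
    _ = q := by rw [mul_sub, sub_mul, hw, h3, sub_sub_cancel]

lemma map_projNormalizer {C' : Type*} [CStarAlgebra C'] (θ : C →⋆ₐ[ℂ] C')
    (hq : IsStarProjection q) {c : ℝ} (hc : 0 < c) (h : c • q ≤ q * D * q) :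
    θ (projNormalizer q D) = projNormalizer (θ q) (θ D) := by
  have hS := smul_one_le_projNormalizer_aux hq h
  have hc' : 0 < min c 1 := lt_min hc one_pos
  simp [projNormalizer, map_invSqrt θ hc' hS]

lemma smul_le_conj_of_le (hq : IsStarProjection q) (h : q ≤ D) : (1 : ℝ) • q ≤ q * D * q := by
  have := hq.isSelfAdjoint.conjugate_le_conjugate h
  rw [one_smul]
  rwa [hq.isIdempotentElem.eq, hq.isIdempotentElem.eq] at this

/-- For a projection, norm approximation by a positive element already gives an operator
inequality. -/
lemma smul_le_conj_of_norm_sub_lt (hq : IsStarProjection q) {D : C} (hD : IsSelfAdjoint D)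
    (h : ‖q - D‖ ≤ 1 / 2) : (1 / 2 : ℝ) • q ≤ q * D * q := by
  have h1 : q - D ≤ algebraMap ℝ C (1 / 2) := by
    have hsa : IsSelfAdjoint (q - D) := hq.isSelfAdjoint.sub hD
    refine hsa.le_algebraMap_norm_self.trans ?_
    exact algebraMap_mono C h
  have h2 := hq.isSelfAdjoint.conjugate_le_conjugate h1
  have h3 : q * (q - D) * q = q - q * D * q := by
    rw [mul_sub, sub_mul, hq.isIdempotentElem.eq, hq.isIdempotentElem.eq]
  have h4 : q * algebraMap ℝ C (1 / 2) * q = (1 / 2 : ℝ) • q := by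
    rw [Algebra.algebraMap_eq_smul_one, mul_smul_comm, smul_mul_assoc, mul_one,
      hq.isIdempotentElem.eq]
  rw [h3, h4, sub_le_iff_le_add] at h2
  have h5 : q - (1 / 2 : ℝ) • q = (1 / 2 : ℝ) • q := by
    nth_rw 1 [← one_smul ℝ q]
    rw [← sub_smul]; norm_num
  rw [← h5]
  exact sub_le_iff_le_add'.mpr h2

/-- For a projection `q`, Cuntz subequivalence is implemented exactly, since an approximation of `q`
within `1 / 2` can be normalized. -/
lemma CuntzSubeq.exists_eq_of_isStarProjection (hq : IsStarProjection q) {b : C}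
    (hb : IsSelfAdjoint b) (h : CuntzSubeq q b) : ∃ v, v * b * star v = q := by
  obtain ⟨_, ⟨v, rfl⟩, hv⟩ := Metric.mem_closure_iff.mp h (1 / 2) (by norm_num)
  rw [dist_eq_norm] at hv
  have h1 := smul_le_conj_of_norm_sub_lt hq (D := v * b * star v) (hb.conjugate v) hv.le
  have h2 := projNormalizer_mul_mul_star hq (by norm_num) h1
  refine ⟨projNormalizer q (v * b * star v) * v, ?_⟩
  rw [star_mul]
  simpa only [mul_assoc] using h2

lemma eq_zero_of_mul_star_le_zero {a : C} (h : a * star a ≤ 0) : a = 0 :=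
  CStarRing.mul_star_self_eq_zero_iff a |>.mp (le_antisymm h (mul_star_self_nonneg a))

lemma mul_self_le_norm_smul {a : C} (ha : 0 ≤ a) : a * a ≤ ‖a‖ • a := by
  have h := star_right_conjugate_le_conjugate
    (IsSelfAdjoint.of_nonneg ha).le_algebraMap_norm_self (CFC.sqrt a)
  have hs : star (CFC.sqrt a) = CFC.sqrt a :=
    (IsSelfAdjoint.of_nonneg (CFC.sqrt_nonneg a)).star_eq
  have hm := CFC.sqrt_mul_sqrt_self a ha
  rw [hs, Algebra.algebraMap_eq_smul_one, mul_smul_comm, smul_mul_assoc, mul_one, hm] at h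
  calc a * a = (CFC.sqrt a * CFC.sqrt a) * (CFC.sqrt a * CFC.sqrt a) := by rw [hm]
    _ = CFC.sqrt a * (CFC.sqrt a * CFC.sqrt a) * CFC.sqrt a := by simp only [mul_assoc]
    _ = CFC.sqrt a * a * CFC.sqrt a := by rw [hm]
    _ ≤ _ := h

end Projections

/-! ### Full elements and simplicity -/

section Full

variable {C : Type*} [CStarAlgebra C]

/-- A positive element `x` is full, in algebraic form: the unit is a finite sum of elements
`v * x * star v`. -/
def IsFullElement (x : C) : Prop :=
  ∃ (I : Type) (_ : Fintype I) (v : I → C), ∑ i, v i * x * star (v i) = 1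

lemma IsFullElement.of_smul_one_le {x : C} {I : Type} [Fintype I] (v : I → C) {c : ℝ} (hc : 0 < c)
    (h : c • (1 : C) ≤ ∑ i, v i * x * star (v i)) : IsFullElement x := by
  refine ⟨I, inferInstance, fun i => invSqrt (∑ i, v i * x * star (v i)) * v i, ?_⟩
  refine Eq.trans ?_ (invSqrt_mul_mul hc h)
  rw [Finset.mul_sum, Finset.sum_mul]
  refine Finset.sum_congr rfl fun i _ => ?_
  rw [star_mul, (isSelfAdjoint_invSqrt _).star_eq]
  simp only [mul_assoc]

lemma IsFullElement.of_le {a x w : C} (ha : IsFullElement a) (h : a ≤ w * x * star w) :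
    IsFullElement x := by
  obtain ⟨I, _, v, hv⟩ := ha
  refine IsFullElement.of_smul_one_le (fun i => v i * w) one_pos ?_
  rw [one_smul, ← hv]
  refine Finset.sum_le_sum fun i _ => ?_
  have := star_right_conjugate_le_conjugate h (v i)
  simpa only [star_mul, mul_assoc] using this

lemma IsFullElement.map {C' : Type*} [CStarAlgebra C'] (θ : C →⋆ₐ[ℂ] C') {x : C}
    (hx : IsFullElement x) : IsFullElement (θ x) := by
  obtain ⟨I, _, v, hv⟩ := hx
  refine ⟨I, inferInstance, fun i => θ (v i), ?_⟩
  simpa [map_star] using congrArg θ hv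

lemma IsFullElement.ne_zero [Nontrivial C] {x : C} (hx : IsFullElement x) : x ≠ 0 := by
  rintro rfl
  obtain ⟨I, _, v, hv⟩ := hx
  simp at hv

/-- The real part of an element of the ideal generated by a positive element `x` is bounded above
and below by sums of conjugates of `x`. For a generator `a * x * b` this is the positivity of `(a -
star b) * x * star (a - star b)`. -/
lemma exists_add_star_le_of_mem_closure {x z : C} (hx : 0 ≤ x)
    (hz : z ∈ AddSubgroup.closure {z : C | ∃ a b, z = a * x * b}) :
    (∃ (I : Type) (_ : Fintype I) (v : I → C), z + star z ≤ ∑ i, v i * x * star (v i)) ∧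
    (∃ (I : Type) (_ : Fintype I) (v : I → C), -(z + star z) ≤ ∑ i, v i * x * star (v i)) := by
  have hxs : star x = x := (IsSelfAdjoint.of_nonneg hx).star_eq
  induction hz using AddSubgroup.closure_induction with
  | mem z hz =>
    obtain ⟨a, b, rfl⟩ := hz
    have key : ∀ a b : C, a * x * b + star (a * x * b) ≤ a * x * star a + star b * x * b := by
      intro a b
      have h := star_right_conjugate_nonneg hx (a - star b)
      rw [← sub_nonneg]
      refine h.trans (le_of_eq ?_)
      simp only [star_sub, star_star, star_mul, hxs]
      noncomm_ring
    refine ⟨⟨Fin 2, inferInstance, ![a, star b], ?_⟩, ⟨Fin 2, inferInstance, ![-a, star b], ?_⟩⟩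
    · simpa using key a b
    · have := key (-a) b
      simpa [add_comm] using this
  | zero => exact ⟨⟨Empty, inferInstance, fun _ => 0, by simp⟩,
      ⟨Empty, inferInstance, fun _ => 0, by simp⟩⟩
  | add y z _ _ hy hz =>
    obtain ⟨⟨I, _, v, hv⟩, ⟨I', _, v', hv'⟩⟩ := hy
    obtain ⟨⟨J, _, w, hw⟩, ⟨J', _, w', hw'⟩⟩ := hz
    refine ⟨⟨I ⊕ J, inferInstance, Sum.elim v w, ?_⟩, ⟨I' ⊕ J', inferInstance, Sum.elim v' w', ?_⟩⟩
    · simp only [Fintype.sum_sum_type, Sum.elim_inl, Sum.elim_inr]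
      refine le_trans (le_of_eq ?_) (add_le_add hv hw)
      rw [star_add]; abel
    · simp only [Fintype.sum_sum_type, Sum.elim_inl, Sum.elim_inr]
      refine le_trans (le_of_eq ?_) (add_le_add hv' hw')
      rw [star_add]; abel
  | neg z _ hz =>
    refine ⟨?_, ?_⟩
    · have h : -z + star (-z) = -(z + star z) := by rw [star_neg]; abel
      rw [h]; exact hz.2
    · have h : -(-z + star (-z)) = z + star z := by rw [star_neg]; abel
      rw [h]; exact hz.1

/-- The closed two-sided ideal generated by an element. -/
def closedIdeal (x : C) : TwoSidedIdeal C :=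
  TwoSidedIdeal.mk' (closure (AddSubgroup.closure {z : C | ∃ a b, z = a * x * b} : Set C))
    (subset_closure (zero_mem (AddSubgroup.closure {z : C | ∃ a b, z = a * x * b})))
    (fun h h' => map_mem_closure₂ continuous_add h h' fun _ ha _ hb => add_mem (S := AddSubgroup C) ha hb)
    (fun h => map_mem_closure continuous_neg h fun _ ha => neg_mem (S := AddSubgroup C) ha)
    (by
      intro c z h
      refine map_mem_closure (f := fun z => c * z) (by fun_prop) h fun z hz => ?_
      induction hz using AddSubgroup.closure_induction with
      | mem z hz =>
        obtain ⟨a, b, rfl⟩ := hz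
        exact AddSubgroup.subset_closure ⟨c * a, b, by simp only [mul_assoc]⟩
      | zero => simp [zero_mem]
      | add y z _ _ hy hz => beta_reduce; rw [SetLike.mem_coe, mul_add]; exact add_mem hy hz
      | neg z _ hz => beta_reduce; rw [SetLike.mem_coe, mul_neg]; exact neg_mem hz)
    (by
      intro z c h
      refine map_mem_closure (f := fun z => z * c) (by fun_prop) h fun z hz => ?_
      induction hz using AddSubgroup.closure_induction with
      | mem z hz =>
        obtain ⟨a, b, rfl⟩ := hz
        exact AddSubgroup.subset_closure ⟨a, b * c, by simp only [mul_assoc]⟩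
      | zero => simp [zero_mem]
      | add y z _ _ hy hz => beta_reduce; rw [SetLike.mem_coe, add_mul]; exact add_mem hy hz
      | neg z _ hz => beta_reduce; rw [SetLike.mem_coe, neg_mul]; exact neg_mem hz)

lemma coe_closedIdeal (x : C) : (closedIdeal x : Set C)
    = closure (AddSubgroup.closure {z : C | ∃ a b, z = a * x * b} : Set C) := by
  ext z
  change z ∈ closedIdeal x ↔ _
  rw [closedIdeal, TwoSidedIdeal.mem_mk']

/-- In a simple unital C*-algebra all nonzero positive elements are full. -/
lemma IsSimpleCStar.isFullElement (hC : IsSimpleCStar C) {x : C} (hx : 0 ≤ x) (hx0 : x ≠ 0) :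
    IsFullElement x := by
  have hcl : IsClosed (closedIdeal x : Set C) := by rw [coe_closedIdeal]; exact isClosed_closure
  have hx1 : x ∈ (closedIdeal x : Set C) := by
    rw [coe_closedIdeal]
    exact subset_closure (AddSubgroup.subset_closure ⟨1, 1, by simp⟩)
  have htop : closedIdeal x = ⊤ := by
    refine (hC.eq_bot_or_eq_top _ hcl).resolve_left fun h => hx0 ?_
    rw [h] at hx1
    simpa using hx1
  have h1 : (1 : C) ∈ (closedIdeal x : Set C) := by rw [htop]; trivial
  rw [coe_closedIdeal] at h1
  -- the ideal generated by `x` contains some `z` within `1 / 2` of `1`, and then `1 ≤ z + star z`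
  obtain ⟨z, hz, hd⟩ := Metric.mem_closure_iff.mp h1 (1 / 2) (by norm_num)
  obtain ⟨⟨I, _, v, hv⟩, -⟩ := exists_add_star_le_of_mem_closure hx hz
  refine IsFullElement.of_smul_one_le v one_pos (le_trans ?_ hv)
  have h2 : ‖(1 - z) + star (1 - z)‖ ≤ 1 := by
    refine (norm_add_le _ _).trans ?_
    rw [norm_star]
    rw [dist_eq_norm] at hd
    linarith
  have h3 := (IsSelfAdjoint.add_star_self (1 - z)).le_algebraMap_norm_self.trans
    (algebraMap_mono C h2)
  rw [map_one] at h3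
  have h4 : (1 - z) + star (1 - z) = 1 + (1 - (z + star z)) := by
    rw [star_sub, star_one]; abel
  rw [h4] at h3
  rw [one_smul]
  have h5 : 1 - (z + star z) ≤ 0 := by simpa using h3
  exact sub_nonpos.mp h5

lemma isSimpleCStar_of_isFullElement [Nontrivial C]
    (hfull : ∀ x : C, 0 ≤ x → x ≠ 0 → IsFullElement x) : IsSimpleCStar C where
  nontrivial := inferInstance
  eq_bot_or_eq_top I _ := by
    by_cases h : ∃ x ∈ I, x ≠ 0
    · right
      obtain ⟨x, hxI, hx⟩ := h
      obtain ⟨J, _, v, hv⟩ := hfull (star x * x) (star_mul_self_nonneg x)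
        (by simpa [CStarRing.star_mul_self_eq_zero_iff] using hx)
      have h1 : (1 : C) ∈ I := by
        rw [← hv]
        refine sum_mem fun i _ => ?_
        exact I.mul_mem_right _ _ (I.mul_mem_left _ _ (I.mul_mem_left _ _ hxI))
      exact eq_top_iff.mpr fun x _ => by simpa using I.mul_mem_left x 1 h1
    · left
      push Not at h
      exact le_antisymm (fun x hx => by simpa using h x hx) bot_le

lemma IsFullElement.exists_mul_mul_ne_zero {z y : C} (hz : z ≠ 0) (hy : IsFullElement y) :
    ∃ b, z * b * y ≠ 0 := by
  obtain ⟨I, _, v, hv⟩ := hy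
  by_contra! h
  refine hz ?_
  calc z = z * ∑ i, v i * y * star (v i) := by rw [hv, mul_one]
    _ = ∑ i, (z * v i * y) * star (v i) := by
        rw [Finset.mul_sum]; simp only [mul_assoc]
    _ = 0 := by simp [h]

end Full

/-! ### Orthogonal elements in hereditary subalgebras -/

section Orthogonal

variable {C : Type*} [CStarAlgebra C]

/-- A bump function of radius `r` around `s`, in a form that exhibits its vanishing near `0`. -/
def bump (s r t : ℝ) : ℝ := max 0 (r - |t - s|)

lemma continuous_bump (s r : ℝ) : Continuous (bump s r) := by unfold bump; fun_prop

lemma bump_eq (s r : ℝ) (hr : 0 < r) (hs : 2 * r ≤ |s|) (t : ℝ) :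
    bump s r t = t * (bump s r t / (max |t| r) ^ 2) * t := by
  by_cases h : r ≤ |t - s|
  · have : bump s r t = 0 := max_eq_left (by linarith)
    rw [this]; simp
  · push Not at h
    have h1 : r ≤ |t| := by
      have := abs_sub_abs_le_abs_sub s t
      rw [abs_sub_comm] at this
      linarith
    rw [max_eq_left h1, sq_abs]
    have h2 : t ≠ 0 := by rintro rfl; simp at h1; linarith
    field_simp

lemma bump_mul_bump (s t r u : ℝ) (h : 2 * r ≤ |s - t|) : bump s r u * bump t r u = 0 := by
  by_cases h1 : r ≤ |u - s|
  · have : bump s r u = 0 := max_eq_left (by linarith)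
    rw [this, zero_mul]
  · have : bump t r u = 0 := by
      refine max_eq_left ?_
      have := abs_sub_le s u t
      rw [abs_sub_comm s u] at this
      push Not at h1
      linarith
    rw [this, mul_zero]

/-- If the hereditary subalgebra generated by `x` contains no two orthogonal nonzero elements of the
form `x * m * x`, then its self-adjoint elements are multiples of projections. -/
lemma mul_self_eq_smul_of_forall_orthogonal {x : C} (hx : IsSelfAdjoint x)
    (h : ∀ m n : C, 0 ≤ x * m * x → 0 ≤ x * n * x → (x * m * x) * (x * n * x) = 0 →
      x * m * x = 0 ∨ x * n * x = 0) {m : C} (hm : IsSelfAdjoint m) :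
    ∃ s : ℝ, (x * m * x) * (x * m * x) = s • (x * m * x) := by
  set b := x * m * x with hb
  have hbsa : IsSelfAdjoint b := by
    have := hm.conjugate x
    rwa [hx.star_eq] at this
  -- `b` has at most one nonzero spectral value: bump functions of `b` around two of them would be
  -- nonzero, orthogonal and of the form `x * n * x`
  have hsingle : ∃ s : ℝ, ∀ t ∈ spectrum ℝ b, t * t = s * t := by
    by_contra! hcon
    obtain ⟨s, hs, hs0⟩ := hcon 0
    obtain ⟨t, ht, hts⟩ := hcon s
    have hs0' : s ≠ 0 := by rintro rfl; simp at hs0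
    have ht0 : t ≠ 0 := by rintro rfl; simp at hts
    have hts' : s ≠ t := by rintro rfl; simp at hts
    set r := min (min |s| |t|) |s - t| / 2 with hr
    have hrpos : 0 < r := by
      have := abs_pos.mpr hs0'; have := abs_pos.mpr ht0; have := abs_pos.mpr (sub_ne_zero.mpr hts')
      positivity
    have h1 : 2 * r ≤ |s| := by
      rw [hr]; have := min_le_left (min |s| |t|) |s - t|; have := min_le_left |s| |t|; linarith
    have h2 : 2 * r ≤ |t| := by
      rw [hr]; have := min_le_left (min |s| |t|) |s - t|; have := min_le_right |s| |t|; linarith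
    have h3 : 2 * r ≤ |s - t| := by
      rw [hr]; have := min_le_right (min |s| |t|) |s - t|; linarith
    have hform : ∀ u : ℝ, 2 * r ≤ |u| → ∃ n, cfc (bump u r) b = x * n * x := by
      intro u hu
      have hc1 : Continuous (fun t : ℝ => bump u r t / (max |t| r) ^ 2) := by
        refine (continuous_bump u r).div (by fun_prop) fun t => ?_
        have : 0 < max |t| r := lt_max_of_lt_right hrpos
        positivity
      have h4 : cfc (bump u r) b = b * cfc (fun t : ℝ => bump u r t / (max |t| r) ^ 2) b * b := by
        have hc2 : Continuous (fun t : ℝ => t * (bump u r t / (max |t| r) ^ 2)) :=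
          continuous_id.mul hc1
        nth_rw 2 [← cfc_id' ℝ b hbsa]
        nth_rw 4 [← cfc_id' ℝ b hbsa]
        rw [← cfc_mul (fun t : ℝ => t) _ b continuousOn_id hc1.continuousOn,
          ← cfc_mul _ (fun t : ℝ => t) b hc2.continuousOn continuousOn_id]
        exact cfc_congr fun t _ => bump_eq u r hrpos hu t
      refine ⟨m * x * cfc (fun t : ℝ => bump u r t / (max |t| r) ^ 2) b * x * m, ?_⟩
      rw [h4, hb]
      simp only [mul_assoc]
    have hne : ∀ u ∈ spectrum ℝ b, cfc (bump u r) b ≠ 0 := by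
      intro u hu h0
      have := norm_apply_le_norm_cfc (bump u r) b hu (continuous_bump u r).continuousOn hbsa
      rw [h0, norm_zero] at this
      have h5 : bump u r u = r := by simp [bump, hrpos.le]
      rw [h5, Real.norm_eq_abs, abs_of_pos hrpos] at this
      linarith
    have hnn : ∀ u, 0 ≤ cfc (bump u r) b := fun u => cfc_nonneg fun t _ => le_max_left _ _
    obtain ⟨n1, hn1⟩ := hform s h1
    obtain ⟨n2, hn2⟩ := hform t h2
    have h6 := h n1 n2 (hn1 ▸ hnn s) (hn2 ▸ hnn t) (by
      rw [← hn1, ← hn2, ← cfc_mul _ _ b (continuous_bump s r).continuousOn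
        (continuous_bump t r).continuousOn]
      refine Eq.trans (cfc_congr fun u _ => bump_mul_bump s t r u h3) ?_
      exact cfc_const_zero ℝ b)
    rw [← hn1, ← hn2] at h6
    exact h6.elim (hne s hs) (hne t ht)
  obtain ⟨s, hs⟩ := hsingle
  refine ⟨s, ?_⟩
  nth_rw 1 [← cfc_id' ℝ b hbsa]
  nth_rw 2 [← cfc_id' ℝ b hbsa]
  nth_rw 3 [← cfc_id' ℝ b hbsa]
  rw [← cfc_mul (fun t : ℝ => t) (fun t : ℝ => t) b continuousOn_id continuousOn_id,
    ← cfc_const_mul s (fun t : ℝ => t) b continuousOn_id]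
  exact cfc_congr hs

/-- In an infinite dimensional algebra in which all nonzero positive elements are full, every
nonzero hereditary subalgebra contains two nonzero orthogonal positive elements. -/
lemma exists_orthogonal_pair (hfull : ∀ x : C, 0 ≤ x → x ≠ 0 → IsFullElement x)
    (hinf : ¬ FiniteDimensional ℂ C) {x : C} (hx : 0 ≤ x) (hx0 : x ≠ 0) :
    ∃ m n : C, 0 ≤ x * m * x ∧ 0 ≤ x * n * x ∧ (x * m * x) * (x * n * x) = 0 ∧
      x * m * x ≠ 0 ∧ x * n * x ≠ 0 := by
  by_contra! hcon
  have hsa : IsSelfAdjoint x := IsSelfAdjoint.of_nonneg hx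
  have key := fun {m : C} (hm : IsSelfAdjoint m) => mul_self_eq_smul_of_forall_orthogonal hsa
    (fun m n h1 h2 h3 => by
      by_contra! h
      exact h.2 (hcon m n h1 h2 h3 h.1)) hm
  have hxx0 : x * x ≠ 0 := by
    have := (CStarRing.mul_star_self_eq_zero_iff x).not.mpr hx0
    rwa [hsa.star_eq] at this
  obtain ⟨s, hs⟩ := key (IsSelfAdjoint.one C)
  rw [mul_one] at hs
  have hs0 : s ≠ 0 := by
    rintro rfl
    rw [zero_smul] at hs
    have h1 : star (x * x) * (x * x) = 0 := by rw [star_mul, hsa.star_eq, hs]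
    exact hxx0 ((CStarRing.star_mul_self_eq_zero_iff _).mp h1)
  -- a multiple of `x * x` is a projection `e`, which acts as a unit on `x`
  obtain ⟨e, he⟩ : ∃ e, e = s⁻¹ • (x * x) := ⟨_, rfl⟩
  have hee : e * e = e := by
    rw [he, smul_mul_smul_comm, hs, smul_smul]
    congr 1
    field_simp
  have hesa : IsSelfAdjoint e := by
    have : IsSelfAdjoint (x * x) := by rw [IsSelfAdjoint, star_mul, hsa.star_eq]
    rw [he]
    exact (IsSelfAdjoint.all (s⁻¹)).smul this
  have he0 : e ≠ 0 := he ▸ smul_ne_zero (inv_ne_zero hs0) hxx0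
  have hex : e * x = x := by
    have h1 : (x - e * x) * star (x - e * x) = 0 := by
      have h2 : x * x = s • e := by rw [he, smul_smul, mul_inv_cancel₀ hs0, one_smul]
      have h3 : (x - e * x) * star (x - e * x)
          = x * x - e * (x * x) - (x * x) * e + e * (x * x) * e := by
        rw [star_sub, star_mul, hsa.star_eq, hesa.star_eq]
        noncomm_ring
      rw [h3, h2, mul_smul_comm, smul_mul_assoc, smul_mul_assoc, hee, hee]
      abel
    exact (sub_eq_zero.mp ((CStarRing.mul_star_self_eq_zero_iff _).mp h1)).symm
  have hxe : x * e = x := by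
    have := congrArg star hex
    rwa [star_mul, hsa.star_eq, hesa.star_eq] at this
  have key' : ∀ y : C, IsSelfAdjoint y → ∃ t : ℝ, (e * y * e) * (e * y * e) = t • (e * y * e) := by
    intro y hy
    have h1 : e * y * e = x * ((s⁻¹ * s⁻¹) • (x * y * x)) * x := by
      rw [he]
      simp only [smul_mul_assoc, mul_smul_comm, smul_smul, mul_assoc]
    rw [h1]
    refine key ?_
    have := hy.conjugate x
    rw [hsa.star_eq] at this
    exact (IsSelfAdjoint.all (s⁻¹ * s⁻¹)).smul this
  -- the self-adjoint elements `b` of the corner of `e` are scalar: all of `b`, `b + e`, `b + 2 • e`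
  -- have squares proportional to themselves
  have hscalar : ∀ y : C, IsSelfAdjoint y → ∃ t : ℝ, e * y * e = t • e := by
    intro y hy
    obtain ⟨t, ht⟩ := key' y hy
    obtain ⟨t1, ht1⟩ := key' (y + 1) (hy.add (IsSelfAdjoint.one C))
    obtain ⟨t2, ht2⟩ := key' (y + (1 + 1)) (hy.add ((IsSelfAdjoint.one C).add (IsSelfAdjoint.one C)))
    set b := e * y * e with hb
    have hbe : b * e = b := by rw [hb, mul_assoc, hee]
    have heb : e * b = b := by rw [hb, ← mul_assoc, ← mul_assoc, hee]
    have e1 : e * (y + 1) * e = b + e := by rw [mul_add, add_mul, mul_one, hee]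
    have e2 : e * (y + (1 + 1)) * e = b + (2 : ℝ) • e := by
      rw [mul_add, add_mul, mul_add, mul_one, add_mul, hee, two_smul ℝ]
    rw [e1] at ht1
    rw [e2] at ht2
    have f1 : (t + 2 - t1) • b = (t1 - 1) • e := by
      have : (b + e) * (b + e) = t • b + (2 : ℝ) • b + e := by
        rw [mul_add, add_mul, add_mul, ht, hbe, heb, hee, two_smul]; abel
      rw [this] at ht1
      rw [sub_smul, add_smul, sub_smul, one_smul]
      rw [smul_add] at ht1
      rw [sub_eq_sub_iff_add_eq_add, ht1]; abel
    have f2 : (t + 4 - t2) • b = (2 * t2 - 4) • e := by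
      have : (b + (2 : ℝ) • e) * (b + (2 : ℝ) • e) = t • b + (4 : ℝ) • b + (4 : ℝ) • e := by
        rw [mul_add, add_mul, add_mul, ht, mul_smul_comm, smul_mul_assoc, smul_mul_assoc,
          mul_smul_comm, smul_smul, hbe, heb, hee, show (4 : ℝ) = 2 + 2 by norm_num, add_smul]
        norm_num
        abel
      rw [this, smul_add, smul_smul] at ht2
      rw [sub_smul, add_smul, sub_smul, sub_eq_sub_iff_add_eq_add, ht2, mul_comm 2 t2]; abel
    by_cases h1 : t + 2 - t1 = 0
    · rw [h1, zero_smul] at f1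
      have h2 : t1 - 1 = 0 := (smul_eq_zero.mp f1.symm).resolve_right he0
      by_cases h3 : t + 4 - t2 = 0
      · rw [h3, zero_smul] at f2
        have h4 := (smul_eq_zero.mp f2.symm).resolve_right he0
        exfalso; linarith
      · refine ⟨(t + 4 - t2)⁻¹ * (2 * t2 - 4), ?_⟩
        rw [mul_smul, ← f2, smul_smul, inv_mul_cancel₀ h3, one_smul]
    · refine ⟨(t + 2 - t1)⁻¹ * (t1 - 1), ?_⟩
      rw [mul_smul, ← f1, smul_smul, inv_mul_cancel₀ h1, one_smul]
  have hscalar' : ∀ y : C, ∃ t : ℂ, x * y * x = t • e := by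
    intro y
    have h1 : x * y * x = e * (x * y * x) * e := by
      calc x * y * x = (e * x) * y * (x * e) := by rw [hex, hxe]
        _ = _ := by simp only [mul_assoc]
    obtain ⟨t1, ht1⟩ := hscalar _ (realPart (x * y * x)).2
    obtain ⟨t2, ht2⟩ := hscalar _ (imaginaryPart (x * y * x)).2
    refine ⟨(t1 : ℂ) + Complex.I * (t2 : ℂ), ?_⟩
    rw [h1]
    conv_lhs => rw [← realPart_add_I_smul_imaginaryPart (x * y * x)]
    rw [mul_add, add_mul, mul_smul_comm, smul_mul_assoc, ht1, ht2, add_smul, mul_smul,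
      Complex.coe_smul, Complex.coe_smul]
  -- the corner of `e` is one-dimensional and `x` is full, so that the algebra is spanned by the
  -- finitely many elements `v i * e * star (v j)`
  refine hinf ?_
  obtain ⟨I, _, v, hv⟩ := hfull x hx hx0
  refine Module.finite_def.mpr (Submodule.fg_def.mpr
    ⟨Set.range fun ij : I × I => v ij.1 * e * star (v ij.2), Set.finite_range _, ?_⟩)
  refine eq_top_iff.mpr fun c _ => ?_
  have h1 : c = ∑ i, ∑ j, v i * (x * (star (v i) * c * v j) * x) * star (v j) := by
    calc c = (∑ i, v i * x * star (v i)) * c * ∑ j, v j * x * star (v j) := by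
          rw [hv, one_mul, mul_one]
      _ = _ := by
          rw [Finset.sum_mul, Finset.sum_mul_sum]
          simp only [mul_assoc]
  rw [h1]
  refine Submodule.sum_mem _ fun i _ => Submodule.sum_mem _ fun j _ => ?_
  obtain ⟨t, ht⟩ := hscalar' (star (v i) * c * v j)
  rw [ht, mul_smul_comm, smul_mul_assoc]
  exact Submodule.smul_mem _ _ (Submodule.subset_span ⟨(i, j), rfl⟩)

/-- The hereditary subalgebra generated by `x` contains arbitrarily many orthogonal nonzero positive
elements, by repeated splitting. -/
lemma exists_orthogonal_fin (hfull : ∀ x : C, 0 ≤ x → x ≠ 0 → IsFullElement x)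
    (hinf : ¬ FiniteDimensional ℂ C) (n : ℕ) {x : C} (hx : 0 ≤ x) (hx0 : x ≠ 0) :
    ∃ m : Fin n → C, (∀ i, 0 ≤ x * m i * x) ∧ (∀ i, x * m i * x ≠ 0) ∧
      ∀ i j, i ≠ j → (x * m i * x) * (x * m j * x) = 0 := by
  induction n generalizing x with
  | zero => exact ⟨Fin.elim0, fun i => i.elim0, fun i => i.elim0, fun i => i.elim0⟩
  | succ n ih =>
    obtain ⟨a, b, ha, hb, hab, ha0, hb0⟩ := exists_orthogonal_pair hfull hinf hx hx0
    obtain ⟨m, hm, hm0, hmm⟩ := ih hb hb0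
    have hba : (x * b * x) * (x * a * x) = 0 := by
      have := congrArg star hab
      rwa [star_mul, (IsSelfAdjoint.of_nonneg ha).star_eq, (IsSelfAdjoint.of_nonneg hb).star_eq,
        star_zero] at this
    have hform : ∀ i, x * (b * x * m i * x * b) * x = (x * b * x) * m i * (x * b * x) := by
      intro i; simp only [mul_assoc]
    refine ⟨Fin.cons a fun i => b * x * m i * x * b, ?_, ?_, ?_⟩
    · intro i
      refine Fin.cases ?_ (fun i => ?_) i
      · simpa using ha
      · simpa only [Fin.cons_succ, hform] using hm i
    · intro i
      refine Fin.cases ?_ (fun i => ?_) i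
      · simpa using ha0
      · simpa only [Fin.cons_succ, hform] using hm0 i
    · intro i j
      refine Fin.cases ?_ (fun i => ?_) i <;> refine Fin.cases ?_ (fun j => ?_) j
      · simp
      · intro _
        simp only [Fin.cons_succ, Fin.cons_zero, hform]
        rw [mul_assoc (x * b * x), ← mul_assoc, hab, zero_mul]
      · intro _
        simp only [Fin.cons_succ, Fin.cons_zero, hform]
        rw [mul_assoc, hba, mul_zero]
      · intro hij
        simp only [Fin.cons_succ, hform]
        exact hmm i j fun h => hij (by rw [h])

/-- In an infinite dimensional algebra in which all nonzero positive elements are full, every nonzero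
positive element `x` dominates arbitrarily many orthogonal copies of some nonzero positive `Z`. -/
lemma exists_orthogonal_copies (hfull : ∀ x : C, 0 ≤ x → x ≠ 0 → IsFullElement x)
    (hinf : ¬ FiniteDimensional ℂ C) (I : Type) [Fintype I] {x : C} (hx : 0 ≤ x) (hx0 : x ≠ 0) :
    ∃ (z : I → C) (Z : C), 0 ≤ Z ∧ Z ≠ 0 ∧ (∀ i j, i ≠ j → z i * x * star (z j) = 0) ∧
      ∀ i, Z ≤ z i * x * star (z i) := by
  classical
  have hss := CFC.sqrt_mul_sqrt_self x hx
  have hsqrt : 0 ≤ CFC.sqrt x := CFC.sqrt_nonneg x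
  have hs0 : CFC.sqrt x ≠ 0 := fun h => hx0 (by rw [← hss, h, zero_mul])
  have hssa : IsSelfAdjoint (CFC.sqrt x) := IsSelfAdjoint.of_nonneg hsqrt
  obtain ⟨m', hm', hm0', hmm'⟩ :=
    exists_orthogonal_fin hfull hinf (Fintype.card I) hsqrt hs0
  set eI := Fintype.equivFin I
  set y : I → C := fun i => CFC.sqrt x * m' (eI i) * CFC.sqrt x with hy
  -- a common `Z` is shrunk successively below conjugates of the squares of the orthogonal `y i`
  have key : ∀ t : Finset I, ∃ (a : I → C) (Z : C), 0 ≤ Z ∧ Z ≠ 0 ∧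
      ∀ i ∈ t, Z ≤ a i * y i * star (a i * y i) := by
    intro t
    induction t using Finset.induction_on with
    | empty =>
      have : Nontrivial C := ⟨x, 0, hx0⟩
      exact ⟨fun _ => 0, 1, zero_le_one, one_ne_zero, by simp⟩
    | insert i t hi ih =>
      obtain ⟨a, Z, hZ, hZ0, ha⟩ := ih
      have hZs : CFC.sqrt Z ≠ 0 := fun h =>
        hZ0 (by rw [← CFC.sqrt_mul_sqrt_self Z hZ, h, zero_mul])
      obtain ⟨b, hb⟩ := (hfull _ (hm' (eI i)) (hm0' (eI i))).exists_mul_mul_ne_zero hZs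
      change CFC.sqrt Z * b * y i ≠ 0 at hb
      set κ : ℝ := (1 + ‖b * y i‖)⁻¹ with hκ
      have hκ0 : 0 < κ := by positivity
      set a' := κ • (CFC.sqrt Z * b) with ha'
      have hne : a' * y i ≠ 0 := by
        rw [ha', smul_mul_assoc]
        exact smul_ne_zero hκ0.ne' hb
      have hle : a' * y i * star (a' * y i) ≤ Z := by
        have h1 : κ • (b * y i) * star (κ • (b * y i)) ≤ 1 := by
          refine CStarAlgebra.mul_star_le_algebraMap_norm_sq.trans ?_
          have h2 : ‖κ • (b * y i)‖ ≤ 1 := by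
            rw [norm_smul, Real.norm_eq_abs, abs_of_pos hκ0, hκ]
            rw [inv_mul_le_iff₀ (by positivity)]
            linarith
          have := algebraMap_mono C (pow_le_one₀ (n := 2) (norm_nonneg (κ • (b * y i))) h2)
          rwa [map_one] at this
        have h3 := star_right_conjugate_le_conjugate h1 (CFC.sqrt Z)
        have h4 : star (CFC.sqrt Z) = CFC.sqrt Z :=
          (IsSelfAdjoint.of_nonneg (CFC.sqrt_nonneg Z)).star_eq
        rw [h4, mul_one, CFC.sqrt_mul_sqrt_self Z hZ] at h3
        refine le_trans (le_of_eq ?_) h3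
        have h5 : a' * y i = CFC.sqrt Z * (κ • (b * y i)) := by
          rw [ha', smul_mul_assoc, mul_smul_comm, mul_assoc]
        rw [h5, star_mul, h4]
        simp only [mul_assoc]
      refine ⟨Function.update a i a', a' * y i * star (a' * y i), mul_star_self_nonneg _,
        fun h => hne ((CStarRing.mul_star_self_eq_zero_iff _).mp h), fun j hj => ?_⟩
      by_cases hji : j = i
      · subst hji; simp
      · rw [Function.update_of_ne hji]
        exact hle.trans (ha j ((Finset.mem_insert.mp hj).resolve_left hji))
  obtain ⟨a, Z, hZ, hZ0, ha⟩ := key Finset.univ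
  have hform : ∀ i j, (a i * CFC.sqrt x * m' (eI i)) * x * star (a j * CFC.sqrt x * m' (eI j))
      = a i * (y i * star (y j)) * star (a j) := by
    intro i j
    simp only [hy, star_mul, hssa.star_eq]
    nth_rw 2 [← hss]
    simp only [mul_assoc]
  have hysa : ∀ i, star (y i) = y i := fun i => (IsSelfAdjoint.of_nonneg (hm' (eI i))).star_eq
  refine ⟨fun i => a i * CFC.sqrt x * m' (eI i), Z, hZ, hZ0, fun i j hij => ?_, fun i => ?_⟩
  · rw [hform, hysa, hmm' _ _ fun h => hij (eI.injective h)]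
    simp
  · rw [hform]
    have := ha i (Finset.mem_univ i)
    rw [star_mul] at this
    simpa only [mul_assoc] using this

end Orthogonal

/-! ### Excision of states -/

section Excision

variable {C : Type*} [CStarAlgebra C]

lemma norm_le_of_nonneg_of_le_smul_one {a : C} {r : ℝ} (ha : 0 ≤ a) (h : a ≤ r • (1 : C))
    (hr : 0 ≤ r) : ‖a‖ ≤ r := by
  rw [← Algebra.algebraMap_eq_smul_one] at h
  exact (CStarAlgebra.norm_le_iff_le_algebraMap a hr ha).mpr h

lemma norm_le_of_neg_smul_le_of_le {a h : C} {η : ℝ} (hη : 0 ≤ η) (hh : h ≤ 1)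
    (h1 : -(η • h) ≤ a) (h2 : a ≤ 0) : ‖a‖ ≤ η := by
  rw [← norm_neg]
  refine norm_le_of_nonneg_of_le_smul_one (neg_nonneg.mpr h2) ?_ hη
  refine (neg_le.mp h1).trans (smul_le_smul_of_nonneg_left hh hη)

lemma mul_self_le_one_of_norm_le_one {h : C} (hh : IsSelfAdjoint h) (h1 : ‖h‖ ≤ 1) :
    h * h ≤ 1 := by
  have := CStarAlgebra.mul_star_le_algebraMap_norm_sq (a := h)
  rw [hh.star_eq] at this
  refine this.trans ?_
  have := algebraMap_mono C (pow_le_one₀ (n := 2) (norm_nonneg h) h1)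
  rwa [map_one] at this

lemma le_one_of_norm_le_one {h : C} (hh : IsSelfAdjoint h) (h1 : ‖h‖ ≤ 1) : h ≤ 1 := by
  have := hh.le_algebraMap_norm_self.trans (algebraMap_mono C h1)
  rwa [map_one] at this

/-- A positive element of norm one which is concentrated near the top of the spectrum of `c`. -/
lemma exists_concentrated [Nontrivial C] {c : C} (hc : 0 ≤ c) {η : ℝ} (hη : 0 < η) :
    ∃ h : C, 0 ≤ h ∧ ‖h‖ = 1 ∧ (‖c‖ - η) • (h * h) ≤ h * c * h ∧ h * c * h ≤ ‖c‖ • (h * h) ∧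
      Commute c h := by
  have hsa : IsSelfAdjoint c := IsSelfAdjoint.of_nonneg hc
  -- `f` is supported on the values within `η` of the norm of `c`, and is `1` at the norm
  set f : ℝ → ℝ := fun t => max 0 (1 - (‖c‖ - t) / η) with hf
  have hcont : Continuous f := by rw [hf]; fun_prop
  have hle : ∀ t ∈ spectrum ℝ c, t ≤ ‖c‖ := fun t ht =>
    (le_abs_self t).trans (spectrum.norm_le_norm_of_mem ht)
  have hmem : ‖c‖ ∈ spectrum ℝ c := CStarAlgebra.norm_mem_spectrum_of_nonneg hc
  have h0 : 0 ≤ cfc f c := cfc_nonneg fun t _ => le_max_left _ _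
  have hcc : cfc f c * c * cfc f c = cfc (fun t => f t * t * f t) c := by
    have h2 : Continuous fun t => f t * t := hcont.mul continuous_id
    rw [cfc_mul (fun t => f t * t) f c h2.continuousOn hcont.continuousOn,
      cfc_mul f (fun t => t) c hcont.continuousOn continuousOn_id, cfc_id' ℝ c hsa]
  have hff : cfc f c * cfc f c = cfc (fun t => f t * f t) c :=
    (cfc_mul f f c hcont.continuousOn hcont.continuousOn).symm
  have hcff : ∀ r : ℝ, r • (cfc f c * cfc f c) = cfc (fun t => r * (f t * f t)) c := fun r => by
    rw [hff, ← cfc_const_mul r (fun t => f t * f t) c (hcont.mul hcont).continuousOn]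
  refine ⟨cfc f c, h0, le_antisymm ?_ ?_, ?_, ?_, ?_⟩
  · refine norm_cfc_le zero_le_one fun t ht => ?_
    have h1 : f t ≤ 1 := by
      refine max_le zero_le_one ?_
      have : 0 ≤ (‖c‖ - t) / η := div_nonneg (by linarith [hle t ht]) hη.le
      linarith
    rw [Real.norm_eq_abs, abs_of_nonneg (le_max_left _ _)]
    exact h1
  · have := norm_apply_le_norm_cfc f c hmem hcont.continuousOn hsa
    simpa [hf] using this
  · rw [hcc, hcff]
    refine cfc_mono (fun t ht => ?_) (by fun_prop) (by fun_prop)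
    by_cases h1 : f t = 0
    · simp [h1]
    · have h2 : 0 < 1 - (‖c‖ - t) / η := by
        by_contra h3
        exact h1 (max_eq_left (not_lt.mp h3))
      have h3 : (‖c‖ - t) / η < 1 := by linarith
      rw [div_lt_one hη] at h3
      nlinarith [mul_self_nonneg (f t)]
  · rw [hcc, hcff]
    refine cfc_mono (fun t ht => ?_) (by fun_prop) (by fun_prop)
    nlinarith [mul_self_nonneg (f t), hle t ht]
  · exact ((Commute.refl c).cfc_real f).symm

lemma norm_conj_sub_smul_le {h b : C} (hh : 0 ≤ h) (hn : ‖h‖ = 1) {s η : ℝ} (hη : 0 ≤ η)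
    (h1 : (s - η) • (h * h) ≤ h * b * h) (h2 : h * b * h ≤ s • (h * h)) :
    ‖h * b * h - s • (h * h)‖ ≤ η := by
  refine norm_le_of_neg_smul_le_of_le hη
    (mul_self_le_one_of_norm_le_one (IsSelfAdjoint.of_nonneg hh) hn.le) ?_ (sub_nonpos.mpr h2)
  rw [sub_smul] at h1
  have := sub_le_sub_right h1 (s • (h * h))
  rwa [sub_sub_cancel_left] at this

lemma conj_add_smul_one (h b : C) (s M : ℝ) :
    h * (b + M • 1) * h - s • (h * h) = h * b * h - (s - M) • (h * h) := by
  rw [mul_add, add_mul, mul_smul_comm, smul_mul_assoc, mul_one, sub_smul]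
  abel

/-- Excision at the top of the spectrum of a self-adjoint element, whose maximum is `s`. -/
lemma exists_excising_top [Nontrivial C] {b : C} (hb : IsSelfAdjoint b) {ε : ℝ} (hε : 0 < ε) :
    ∃ (h : C) (s : ℝ), 0 ≤ h ∧ ‖h‖ = 1 ∧ ‖h * b * h - s • (h * h)‖ ≤ ε ∧ b ≤ s • (1 : C) := by
  have hc : 0 ≤ b + ‖b‖ • (1 : C) := by
    have := hb.neg_algebraMap_norm_le_self
    rw [Algebra.algebraMap_eq_smul_one] at this
    exact neg_le_iff_add_nonneg.mp this
  obtain ⟨h, hh, hn, h1, h2, -⟩ := exists_concentrated hc hε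
  refine ⟨h, ‖b + ‖b‖ • (1 : C)‖ - ‖b‖, hh, hn, ?_, ?_⟩
  · rw [← conj_add_smul_one]
    exact norm_conj_sub_smul_le hh hn hε.le h1 h2
  · have := (IsSelfAdjoint.of_nonneg hc).le_algebraMap_norm_self
    rw [Algebra.algebraMap_eq_smul_one] at this
    rw [sub_smul]
    exact le_sub_iff_add_le.mpr this

/-- Given a positive element `k` of norm one and a self-adjoint element `b`, there is a positive
element `h` of norm one under `k` which compresses `b` to a scalar. The idea is to replace `b` by
`b + M`, to choose a power `u` of `k` for which `‖u b u‖` hardly decreases when `u` is replaced by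
`u * u`, and to take a function of `u * u * b * u * u` concentrated near the top of the spectrum. -/
lemma exists_excising_step [Nontrivial C] {k b : C} (hk : 0 ≤ k) (hk1 : ‖k‖ = 1)
    (hb : IsSelfAdjoint b) {ε : ℝ} (hε : 0 < ε) :
    ∃ (h : C) (s : ℝ), 0 ≤ h ∧ ‖h‖ = 1 ∧ ‖h * k - h‖ ≤ ε ∧ ‖h * b * h - s • (h * h)‖ ≤ ε := by
  set M : ℝ := ‖b‖ + 1 with hM
  set b' : C := b + M • 1 with hb'
  have hb1 : 1 ≤ b' := by
    have := hb.neg_algebraMap_norm_le_self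
    rw [Algebra.algebraMap_eq_smul_one] at this
    have := neg_le_iff_add_nonneg.mp this
    rw [hb', hM, add_smul, one_smul, ← add_assoc]
    exact le_add_of_nonneg_left this
  have hb0 : 0 ≤ b' := zero_le_one.trans hb1
  have hb'sa : IsSelfAdjoint b' := IsSelfAdjoint.of_nonneg hb0
  have hksa : IsSelfAdjoint k := IsSelfAdjoint.of_nonneg hk
  have hkle : k ≤ 1 := le_one_of_norm_le_one hksa hk1.le
  set r : ℝ := min 1 (ε / (1 + 2 * ‖b'‖)) with hr
  have hr0 : 0 < r := by positivity
  have hr1 : r ≤ 1 := min_le_left _ _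
  have hrε : r * (1 + 2 * ‖b'‖) ≤ ε := by
    have := min_le_right 1 (ε / (1 + 2 * ‖b'‖))
    rwa [← hr, le_div_iff₀ (by positivity)] at this
  set η : ℝ := r ^ 2 / 2 with hη
  have hη0 : 0 < η := by positivity
  set u : ℕ → C := fun m => k ^ (2 ^ m) with hu
  have husa : ∀ m, IsSelfAdjoint (u m) := fun m => hksa.pow _
  have hu0 : ∀ m, 0 ≤ u m := fun m => CStarAlgebra.pow_nonneg hk _
  have hu1 : ∀ m, u m ≤ 1 := fun m => by
    have := CStarAlgebra.pow_antitone hk hkle (Nat.zero_le (2 ^ m))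
    simpa using this
  have huu : ∀ m, u (m + 1) = u m * u m := fun m => by
    simp only [hu]; rw [← pow_add]; congr 1; ring
  have hun : ∀ m, ‖u m‖ = 1 := fun m => by
    have : ‖k ^ (2 ^ m)‖₊ = ‖k‖₊ ^ (2 ^ m) := hksa.nnnorm_pow_two_pow m
    have h2 := congrArg NNReal.toReal this
    simpa [hk1] using h2
  set s : ℕ → ℝ := fun m => ‖u m * b' * u m‖ with hs
  have hpos : ∀ m, 0 ≤ u m * b' * u m := fun m => (husa m).conjugate_nonneg hb0
  have hs1 : ∀ m, 1 ≤ s m := fun m => by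
    have h1 := (husa m).conjugate_le_conjugate hb1
    rw [mul_one, ← huu] at h1
    have := CStarAlgebra.norm_le_norm_of_nonneg_of_le (hu0 _) h1
    rwa [hun] at this
  -- the numbers `s m` are bounded below by `1`, so they cannot drop by more than `η` in every step
  obtain ⟨m, hm⟩ : ∃ m, s m ≤ s (m + 1) + η := by
    by_contra! hcon
    have h1 : ∀ m : ℕ, s m ≤ s 0 - m * η := by
      intro m
      induction m with
      | zero => simp
      | succ m ih => have := hcon m; push_cast; linarith
    obtain ⟨m, hm⟩ := exists_nat_gt (s 0 / η)
    rw [div_lt_iff₀ hη0] at hm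
    linarith [h1 m, hs1 m]
  have hcu : u (m + 1) * b' * u (m + 1) = u m * (u m * b' * u m) * u m := by
    rw [huu]; simp only [mul_assoc]
  obtain ⟨h, hh, hn, h1, h2, -⟩ := exists_concentrated (hpos (m + 1)) hη0
  have hhsa : IsSelfAdjoint h := IsSelfAdjoint.of_nonneg hh
  have hhh1 := mul_self_le_one_of_norm_le_one hhsa hn.le
  have hhh0 : 0 ≤ h * h := by have := mul_star_self_nonneg h; rwa [hhsa.star_eq] at this
  change (s (m + 1) - η) • (h * h) ≤ _ at h1
  change _ ≤ s (m + 1) • (h * h) at h2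
  -- `h` is almost dominated by `u (m + 1)`
  have h3 : h * (u (m + 1) * b' * u (m + 1)) * h ≤ (s (m + 1) + η) • (h * u (m + 1) * h) := by
    have e1 : u m * b' * u m ≤ (s (m + 1) + η) • (1 : C) := by
      have := (IsSelfAdjoint.of_nonneg (hpos m)).le_algebraMap_norm_self.trans
        (algebraMap_mono C hm)
      rwa [Algebra.algebraMap_eq_smul_one] at this
    have e2 := hhsa.conjugate_le_conjugate ((husa m).conjugate_le_conjugate e1)
    rw [← hcu, mul_smul_comm, mul_one, smul_mul_assoc, ← huu, mul_smul_comm, smul_mul_assoc] at e2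
    exact e2
  have h4 : h * (1 - u (m + 1)) * h ≤ (2 * η) • (1 : C) := by
    have e1 : (s (m + 1) + η) • (h * (1 - u (m + 1)) * h) ≤ (2 * η) • (h * h) := by
      have e3 := h1.trans h3
      have e2 : h * (1 - u (m + 1)) * h = h * h - h * u (m + 1) * h := by
        rw [mul_sub, sub_mul, mul_one]
      rw [e2, smul_sub]
      rw [sub_le_iff_le_add]
      calc (s (m + 1) + η) • (h * h) = (2 * η) • (h * h) + (s (m + 1) - η) • (h * h) := by
            rw [← add_smul]; congr 1; ring
        _ ≤ _ := by gcongr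
    have e0 : 0 ≤ h * (1 - u (m + 1)) * h := hhsa.conjugate_nonneg (sub_nonneg.mpr (hu1 _))
    have e4 : (1 : ℝ) • (h * (1 - u (m + 1)) * h) ≤ (s (m + 1) + η) • (h * (1 - u (m + 1)) * h) :=
      smul_le_smul_of_nonneg_right (by linarith [hs1 (m + 1)]) e0
    rw [one_smul] at e4
    exact e4.trans (e1.trans (smul_le_smul_of_nonneg_left hhh1 (by positivity)))
  have hη2 : 2 * η = r ^ 2 := by rw [hη]; ring
  -- `h` is nearly absorbed by every self-adjoint `y` with `(1 - y) * (1 - y) ≤ 1 - u (m + 1)`, such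
  -- as `k` and `u (m + 1)`
  have hkey : ∀ y : C, IsSelfAdjoint y → (1 - y) * (1 - y) ≤ 1 - u (m + 1) → ‖h * y - h‖ ≤ r := by
    intro y hy hle
    have e1 := hhsa.conjugate_le_conjugate hle
    have e2 : h * ((1 - y) * (1 - y)) * h = (h * y - h) * star (h * y - h) := by
      rw [star_sub, star_mul, hy.star_eq, hhsa.star_eq]; noncomm_ring
    rw [e2] at e1
    have e3 := norm_le_of_nonneg_of_le_smul_one (mul_star_self_nonneg _) (e1.trans h4)
      (by positivity)
    rw [CStarRing.norm_self_mul_star, hη2, ← sq] at e3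
    exact (sq_le_sq₀ (norm_nonneg _) hr0.le).mp e3
  have hk2 : ‖h * k - h‖ ≤ r := by
    refine hkey k hksa ?_
    have e1 : k ^ 2 ≤ k ^ 1 := CStarAlgebra.pow_antitone hk hkle (by norm_num)
    have e2 : u (m + 1) ≤ k ^ 2 := CStarAlgebra.pow_antitone hk hkle
      (by rw [pow_succ]; have := Nat.one_le_two_pow (n := m); omega)
    rw [pow_one] at e1
    have e3 : (1 - k) * (1 - k) = 1 - k - (k - k ^ 2) := by rw [sq]; noncomm_ring
    rw [e3]
    calc 1 - k - (k - k ^ 2) ≤ 1 - k := sub_le_self _ (sub_nonneg.mpr e1)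
      _ ≤ 1 - k ^ 2 := sub_le_sub_left e1 _
      _ ≤ _ := sub_le_sub_left e2 _
  have hy2 : ‖h * u (m + 1) - h‖ ≤ r := by
    refine hkey _ (husa _) ?_
    have e0 : 0 ≤ 1 - u (m + 1) := sub_nonneg.mpr (hu1 _)
    have e1 := CStarAlgebra.pow_antitone e0 (sub_le_self _ (hu0 (m + 1))) (by norm_num : 1 ≤ 2)
    simp only [pow_one, sq] at e1
    exact e1
  have hy3 : ‖u (m + 1) * h - h‖ ≤ r := by
    rw [← norm_star, star_sub, star_mul, (husa _).star_eq, hhsa.star_eq]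
    exact hy2
  refine ⟨h, s (m + 1) - M, hh, hn, hk2.trans (le_trans ?_ hrε), ?_⟩
  · exact le_mul_of_one_le_right hr0.le (by linarith [norm_nonneg b'])
  · rw [← conj_add_smul_one]
    have e1 := norm_conj_sub_smul_le hh hn hη0.le h1 h2
    have e2 : h * b' * h - s (m + 1) • (h * h)
        = (h * (u (m + 1) * b' * u (m + 1)) * h - s (m + 1) • (h * h))
          - (h * u (m + 1) - h) * b' * (u (m + 1) * h) - h * b' * (u (m + 1) * h - h) := by
      noncomm_ring
    rw [e2]
    have e3 : ‖(h * u (m + 1) - h) * b' * (u (m + 1) * h)‖ ≤ r * ‖b'‖ * (1 * 1) := by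
      refine (norm_mul_le _ _).trans ?_
      gcongr
      · exact (norm_mul_le _ _).trans (by gcongr)
      · exact (norm_mul_le _ _).trans (by rw [hun, hn])
    have e4 : ‖h * b' * (u (m + 1) * h - h)‖ ≤ 1 * ‖b'‖ * r := by
      refine (norm_mul_le _ _).trans ?_
      gcongr
      exact (norm_mul_le _ _).trans (by rw [hn])
    have e5 : η ≤ r := by rw [hη]; nlinarith
    calc _ ≤ η + r * ‖b'‖ * (1 * 1) + 1 * ‖b'‖ * r :=
          (norm_sub_le _ _).trans (add_le_add ((norm_sub_le _ _).trans (add_le_add e1 e3)) e4)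
      _ ≤ ε := by nlinarith

/-- If `k` compresses `b` to a scalar, then so does every `h` with `h * k` close to `h`. -/
lemma excising_transfer {k h b : C} (hk : 0 ≤ k) (hk1 : ‖k‖ = 1) (hh : 0 ≤ h) (hh1 : ‖h‖ = 1)
    {e δ s : ℝ} (h1 : ‖k * b * k - s • (k * k)‖ ≤ e) (h2 : ‖h * k - h‖ ≤ δ) :
    ‖h * b * h - s • (h * h)‖ ≤ e + 2 * δ * (‖b‖ + |s|) := by
  have hksa : IsSelfAdjoint k := IsSelfAdjoint.of_nonneg hk
  have hhsa : IsSelfAdjoint h := IsSelfAdjoint.of_nonneg hh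
  have h3 : ‖k * h - h‖ ≤ δ := by
    rw [← norm_star, star_sub, star_mul, hksa.star_eq, hhsa.star_eq]
    exact h2
  have hδ : 0 ≤ δ := (norm_nonneg _).trans h2
  have key : ∀ c : C, ‖h * c * h - h * (k * c * k) * h‖ ≤ 2 * δ * ‖c‖ := by
    intro c
    have e1 : h * c * h - h * (k * c * k) * h = -((h * k - h) * c * (k * h)) - h * c * (k * h - h) := by
      noncomm_ring
    have e2 : ‖(h * k - h) * c * (k * h)‖ ≤ δ * ‖c‖ * (1 * 1) := by
      refine (norm_mul_le _ _).trans ?_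
      gcongr
      · exact (norm_mul_le _ _).trans (by gcongr)
      · exact (norm_mul_le _ _).trans (by rw [hk1, hh1])
    have e3 : ‖h * c * (k * h - h)‖ ≤ 1 * ‖c‖ * δ := by
      refine (norm_mul_le _ _).trans ?_
      gcongr
      exact (norm_mul_le _ _).trans (by rw [hh1])
    rw [e1]
    refine (norm_sub_le _ _).trans ?_
    rw [norm_neg]
    linarith
  have e1 : h * b * h - s • (h * h) = (h * b * h - h * (k * b * k) * h)
      + h * (k * b * k - s • (k * k)) * h - s • (h * 1 * h - h * (k * 1 * k) * h) := by
    simp only [mul_sub, sub_mul, smul_sub, mul_smul_comm, smul_mul_assoc, mul_one]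
    abel
  rw [e1]
  have e2 : ‖h * (k * b * k - s • (k * k)) * h‖ ≤ 1 * e * 1 := by
    refine (norm_mul_le _ _).trans ?_
    rw [hh1]
    gcongr
    exact (norm_mul_le _ _).trans (by rw [hh1]; gcongr)
  have e3 : ‖s • (h * 1 * h - h * (k * 1 * k) * h)‖ ≤ |s| * (2 * δ * 1) := by
    rw [norm_smul, Real.norm_eq_abs]
    gcongr
    refine (key 1).trans ?_
    gcongr
    by_cases hC : Subsingleton C
    · rw [Subsingleton.elim (1 : C) 0, norm_zero]; exact zero_le_one
    · have := not_subsingleton_iff_nontrivial.mp hC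
      rw [CStarRing.norm_one]
  calc _ ≤ 2 * δ * ‖b‖ + 1 * e * 1 + |s| * (2 * δ * 1) :=
        (norm_sub_le _ _).trans (add_le_add ((norm_add_le _ _).trans (add_le_add (key b) e2)) e3)
    _ = _ := by ring

/-- Under every positive element `k` of norm one there is another one that compresses finitely many
self-adjoint elements to scalars. The elements are treated one after the other, each time passing to
an element under the previous one. -/
lemma exists_excising_finset [Nontrivial C] {I : Type*} (t : Finset I) (b : I → C)
    (hb : ∀ i, IsSelfAdjoint (b i)) {k : C} (hk : 0 ≤ k) (hk1 : ‖k‖ = 1) {ε : ℝ} (hε : 0 < ε) :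
    ∃ (h : C) (s : I → ℝ), 0 ≤ h ∧ ‖h‖ = 1 ∧ ‖h * k - h‖ ≤ ε ∧
      ∀ i ∈ t, ‖h * b i * h - s i • (h * h)‖ ≤ ε := by
  classical
  induction t using Finset.induction_on generalizing ε with
  | empty =>
    -- a single step applied to `b = 0`
    obtain ⟨h, s, hh, hn, hhk, -⟩ := exists_excising_step hk hk1 (IsSelfAdjoint.zero C) hε
    exact ⟨h, fun _ => 0, hh, hn, hhk, by simp⟩
  | insert j t hj ih =>
    obtain ⟨h, s, hh, hn, hhk, hs⟩ := ih (half_pos hε)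
    set B : ℝ := ∑ i ∈ t, (‖b i‖ + |s i|) with hB
    have hB0 : 0 ≤ B := Finset.sum_nonneg fun i _ => by positivity
    have hδ : 0 < ε / (4 * (B + 1)) := by positivity
    have hδ1 : ε / (4 * (B + 1)) * (B + 1) = ε / 4 := by field_simp
    obtain ⟨h', s', hh', hn', hhk', hs'⟩ := exists_excising_step hh hn (hb j) hδ
    set δ := ε / (4 * (B + 1)) with hδdef
    have hδ4 : δ ≤ ε / 4 := by nlinarith
    refine ⟨h', Function.update s j s', hh', hn', ?_, fun i hi => ?_⟩
    · have e1 : h' * k - h' = -((h' * h - h') * k) + h' * (h * k - h) + (h' * h - h') := by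
        noncomm_ring
      rw [e1]
      have e2 : ‖(h' * h - h') * k‖ ≤ δ * 1 :=
        (norm_mul_le _ _).trans (by rw [hk1]; gcongr)
      have e3 : ‖h' * (h * k - h)‖ ≤ 1 * (ε / 2) :=
        (norm_mul_le _ _).trans (by rw [hn']; gcongr)
      have := (norm_add_le (-((h' * h - h') * k) + h' * (h * k - h)) (h' * h - h')).trans
        (add_le_add ((norm_add_le _ _).trans (add_le_add ((norm_neg _).trans_le e2) e3)) hhk')
      linarith
    · by_cases hij : i = j
      · subst hij
        rw [Function.update_self]
        linarith
      · have hit := (Finset.mem_insert.mp hi).resolve_left hij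
        rw [Function.update_of_ne hij]
        refine (excising_transfer hh hn hh' hn' (hs i hit) hhk').trans ?_
        have e1 : ‖b i‖ + |s i| ≤ B :=
          Finset.single_le_sum (f := fun i => ‖b i‖ + |s i|) (fun i _ => by positivity) hit
        nlinarith

/-- Excision: finitely many elements are simultaneously compressed to scalars by a positive element
of norm one, and on one given linear combination these scalars are at least as large as the value of
a given state. -/
lemma CStarState.exists_excising (φ : CStarState C) {I : Type*} [Fintype I] (a : I → C)
    (c : I → ℂ) {ε : ℝ} (hε : 0 < ε) :
    ∃ (h : C) (s : I → ℂ), 0 ≤ h ∧ ‖h‖ = 1 ∧ (∀ i, ‖h * a i * h - s i • (h * h)‖ ≤ ε) ∧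
      (φ.toLin (∑ i, c i • a i)).re - ε ≤ (∑ i, c i * s i).re := by
  have : Nontrivial C := ⟨1, 0, fun h => by
    have := φ.map_one; rw [h, map_zero] at this; exact zero_ne_one this⟩
  set A : C := ∑ i, c i • a i with hA
  -- `k` excises the maximum of the spectrum of the real part of the linear combination `A`, which
  -- is an upper bound for the value of the state; `h` is then found under `k`
  obtain ⟨k, s₀, hk, hk1, hks, hle⟩ := exists_excising_top (realPart A).2 (half_pos hε)
  set B : ℝ := ‖(realPart A : C)‖ + |s₀| + ∑ i, ‖c i‖ with hB
  have hc0 : 0 ≤ ∑ i, ‖c i‖ := Finset.sum_nonneg fun i _ => norm_nonneg _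
  have hB0 : 0 ≤ B := by positivity
  set δ : ℝ := ε / (4 * (B + 1)) with hδ
  have hδ0 : 0 < δ := by positivity
  have hδ1 : δ * (B + 1) = ε / 4 := by rw [hδ]; field_simp
  obtain ⟨h, s, hh, hn, hhk, hs⟩ := exists_excising_finset Finset.univ
    (Sum.elim (fun i => (realPart (a i) : C)) fun i => (imaginaryPart (a i) : C))
    (by rintro (i | i); exacts [(realPart (a i)).2, (imaginaryPart (a i)).2]) hk hk1 hδ0
  have hhsa : IsSelfAdjoint h := IsSelfAdjoint.of_nonneg hh
  have hhhsa : IsSelfAdjoint (h * h) := by rw [IsSelfAdjoint, star_mul, hhsa.star_eq]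
  have hhh : ‖h * h‖ = 1 := by
    have := CStarRing.norm_self_mul_star (x := h)
    rw [hhsa.star_eq, hn] at this
    simpa using this
  have hbound : ∀ i, ‖h * a i * h - ((s (Sum.inl i) : ℂ) + Complex.I * (s (Sum.inr i) : ℂ)) • (h * h)‖
      ≤ 2 * δ := by
    intro i
    have e1 : h * a i * h - ((s (Sum.inl i) : ℂ) + Complex.I * (s (Sum.inr i) : ℂ)) • (h * h)
        = (h * realPart (a i) * h - s (Sum.inl i) • (h * h))
          + Complex.I • (h * imaginaryPart (a i) * h - s (Sum.inr i) • (h * h)) := by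
      conv_lhs => rw [← realPart_add_I_smul_imaginaryPart (a i)]
      rw [mul_add, add_mul, mul_smul_comm, smul_mul_assoc, add_smul, mul_smul, smul_sub,
        Complex.coe_smul, Complex.coe_smul]
      abel
    rw [e1]
    refine (norm_add_le _ _).trans ?_
    rw [norm_smul, Complex.norm_I, one_mul]
    have e2 := hs (Sum.inl i) (Finset.mem_univ _)
    have e3 := hs (Sum.inr i) (Finset.mem_univ _)
    simp only [Sum.elim_inl, Sum.elim_inr] at e2 e3
    linarith
  refine ⟨h, fun i => (s (Sum.inl i) : ℂ) + Complex.I * (s (Sum.inr i) : ℂ), hh, hn,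
    fun i => (hbound i).trans ?_, ?_⟩
  · nlinarith
  · set S : ℂ := ∑ i, c i * ((s (Sum.inl i) : ℂ) + Complex.I * (s (Sum.inr i) : ℂ)) with hS
    have e1 : ‖h * A * h - S • (h * h)‖ ≤ 2 * δ * ∑ i, ‖c i‖ := by
      have : h * A * h - S • (h * h) = ∑ i, c i • (h * a i * h
          - ((s (Sum.inl i) : ℂ) + Complex.I * (s (Sum.inr i) : ℂ)) • (h * h)) := by
        rw [hA, hS, Finset.mul_sum, Finset.sum_mul, Finset.sum_smul, ← Finset.sum_sub_distrib]
        refine Finset.sum_congr rfl fun i _ => ?_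
        rw [smul_sub, smul_smul, mul_smul_comm, smul_mul_assoc]
      rw [this, Finset.mul_sum]
      refine (norm_sum_le _ _).trans (Finset.sum_le_sum fun i _ => ?_)
      rw [norm_smul, mul_comm]
      gcongr
      exact hbound i
    have e2 : ‖h * realPart A * h - S.re • (h * h)‖ ≤ 2 * δ * ∑ i, ‖c i‖ := by
      refine le_trans (le_of_eq ?_) ((realPart.norm_le (h * A * h - S • (h * h))).trans e1)
      change _ = ‖((realPart (h * A * h - S • (h * h)) : selfAdjoint C) : C)‖
      congr 1
      have e3 : h * A * h - S • (h * h) = (h * realPart A * h - S.re • (h * h))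
          + Complex.I • (h * imaginaryPart A * h - S.im • (h * h)) := by
        conv_lhs => rw [← realPart_add_I_smul_imaginaryPart A, ← Complex.re_add_im S]
        rw [mul_add, add_mul, mul_smul_comm, smul_mul_assoc, add_smul, mul_comm _ Complex.I,
          mul_smul, smul_sub, Complex.coe_smul, Complex.coe_smul]
        abel
      have e4 : ∀ (y : selfAdjoint C) (r : ℝ), IsSelfAdjoint (h * y * h - r • (h * h)) := by
        intro y r
        refine IsSelfAdjoint.sub ?_ ((IsSelfAdjoint.all r).smul hhhsa)
        have := y.2.conjugate h
        rwa [hhsa.star_eq] at this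
      rw [e3, map_add, realPart_I_smul, (e4 _ _).imaginaryPart]
      simp only [neg_zero, add_zero]
      rw [(e4 _ _).coe_realPart]
    have e3 := excising_transfer hk hk1 hh hn hks hhk
    have e4 : |s₀ - S.re| ≤ 2 * δ * ∑ i, ‖c i‖ + (ε / 2 + 2 * δ * (‖(realPart A : C)‖ + |s₀|)) := by
      have : ‖(s₀ - S.re) • (h * h)‖ = |s₀ - S.re| := by
        rw [norm_smul, hhh, mul_one, Real.norm_eq_abs]
      rw [← this]
      have : (s₀ - S.re) • (h * h) = (h * realPart A * h - S.re • (h * h))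
          - (h * realPart A * h - s₀ • (h * h)) := by
        rw [sub_smul]; abel
      rw [this]
      exact (norm_sub_le _ _).trans (add_le_add e2 e3)
    have e5 : (φ.toLin A).re ≤ s₀ := by
      have f1 : ∀ y : C, IsSelfAdjoint y → (φ.toLin y).im = 0 := by
        intro y hy
        have := φ.map_star y
        rw [hy.star_eq] at this
        exact Complex.conj_eq_iff_im.mp this.symm
      have f2 : (φ.toLin A).re = (φ.toLin (realPart A : C)).re := by
        conv_lhs => rw [← realPart_add_I_smul_imaginaryPart A]
        rw [map_add, map_smul]
        simp [f1 _ (imaginaryPart A).2]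
      rw [f2]
      obtain ⟨y, hy⟩ := CStarAlgebra.nonneg_iff_eq_star_mul_self.mp (sub_nonneg.mpr hle)
      have f3 := φ.nonneg y
      rw [← hy, map_sub, ← Complex.coe_smul, map_smul, φ.map_one] at f3
      have f4 := (Complex.nonneg_iff.mp f3).1
      simp at f4
      exact f4
    have e6 := (abs_le.mp e4).2
    have e7 : 2 * δ * B ≤ ε / 2 := by nlinarith
    rw [hB] at e7
    linarith

end Excision

/-! ### Cutting down self-adjoint elements -/

section Cut

variable {C : Type*} [CStarAlgebra C]

lemma StarAlgEquiv.map_cfc_of_continuous (θ : C ≃⋆ₐ[ℂ] C) {f : ℝ → ℝ} (hf : Continuous f) {a : C}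
    (ha : IsSelfAdjoint a) : θ (cfc f a) = cfc f (θ a) :=
  StarAlgHom.map_cfc (θ : C →⋆ₐ[ℂ] C) f a hf.continuousOn (StarAlgEquiv.isometry θ).continuous ha
    (ha.map θ)

/-- The element `(b - δ)⁺`. -/
def cutDown (δ : ℝ) (b : C) : C := cfc (fun t : ℝ => max 0 (t - δ)) b

variable {δ : ℝ} {b : C}

lemma cutDown_nonneg : 0 ≤ cutDown δ b := cfc_nonneg fun _ _ => le_max_left _ _

lemma isSelfAdjoint_cutDown : IsSelfAdjoint (cutDown δ b) := IsSelfAdjoint.of_nonneg cutDown_nonneg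

lemma Commute.cutDown {x : C} (h : Commute b x) : Commute (cutDown δ b) x := h.cfc_real _

lemma map_cutDown (θ : C ≃⋆ₐ[ℂ] C) (hb : IsSelfAdjoint b) :
    θ (cutDown δ b) = cutDown δ (θ b) :=
  StarAlgEquiv.map_cfc_of_continuous θ (by fun_prop) hb

lemma cutDown_mul_sub_mul_cutDown (hb : IsSelfAdjoint b) :
    cutDown δ b * (b - δ • (1 : C)) * cutDown δ b
      = cutDown δ b * cutDown δ b * cutDown δ b := by
  have h1 : b - δ • (1 : C) = cfc (fun t : ℝ => t - δ) b := by
    rw [cfc_sub (fun t : ℝ => t) (fun _ => δ) b, cfc_id' ℝ b, cfc_const δ b,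
      Algebra.algebraMap_eq_smul_one]
  rw [h1, cutDown, ← cfc_mul _ _ b, ← cfc_mul _ _ b, ← cfc_mul _ _ b, ← cfc_mul _ _ b]
  refine cfc_congr fun t _ => ?_
  rcases le_total (t - δ) 0 with h | h
  · simp [max_eq_left h]
  · simp [max_eq_right h]

lemma le_smul_one_of_cutDown_eq_zero (hb : IsSelfAdjoint b) (h : cutDown δ b = 0) :
    b ≤ δ • (1 : C) := by
  have h1 : b - δ • (1 : C) = cfc (fun t : ℝ => t - δ) b := by
    rw [cfc_sub (fun t : ℝ => t) (fun _ => δ) b, cfc_id' ℝ b, cfc_const δ b,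
      Algebra.algebraMap_eq_smul_one]
  rw [← sub_nonpos, h1, ← h]
  exact cfc_mono fun t _ => le_max_right _ _

lemma cube_eq_zero_of_nonneg {g : C} (hg : 0 ≤ g) (h : g * g * g = 0) : g = 0 := by
  have hsa := IsSelfAdjoint.of_nonneg hg
  have h1 : star (g * g) * (g * g) = 0 := by
    rw [star_mul, hsa.star_eq, ← mul_assoc, h, zero_mul]
  have h2 : star g * g = 0 := by
    rw [hsa.star_eq]; exact (CStarRing.star_mul_self_eq_zero_iff _).mp h1
  exact (CStarRing.star_mul_self_eq_zero_iff _).mp h2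

lemma cube_nonneg {g : C} (hg : 0 ≤ g) : 0 ≤ g * g * g :=
  (IsSelfAdjoint.of_nonneg hg).conjugate_nonneg hg

/-- If `y` is within `δ` of `b`, then the cube of `(b - δ)⁺` is dominated by a compression of
`y`. -/
lemma cutDown_cube_le {y : C} (hb : IsSelfAdjoint b) (hy : IsSelfAdjoint y) (h : ‖b - y‖ ≤ δ) :
    cutDown δ b * cutDown δ b * cutDown δ b ≤ cutDown δ b * y * cutDown δ b := by
  rw [← cutDown_mul_sub_mul_cutDown hb]
  refine isSelfAdjoint_cutDown.conjugate_le_conjugate ?_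
  have h1 := (hb.sub hy).le_algebraMap_norm_self.trans (algebraMap_mono C h)
  rw [Algebra.algebraMap_eq_smul_one] at h1
  rwa [sub_le_comm]

lemma cutDown_ne_zero_of_norm_lt {y : C} (hb : IsSelfAdjoint b) (hy : 0 ≤ y) (h : ‖b - y‖ ≤ δ)
    (hδ : 2 * δ < ‖y‖) : cutDown δ b ≠ 0 := by
  intro h0
  have h1 := le_smul_one_of_cutDown_eq_zero hb h0
  have h2 := ((IsSelfAdjoint.of_nonneg hy).sub hb).le_algebraMap_norm_self
  rw [norm_sub_rev, Algebra.algebraMap_eq_smul_one] at h2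
  have hn : 0 ≤ δ := (norm_nonneg _).trans h
  have h3 : y ≤ (2 * δ) • (1 : C) := by
    have h4 : ‖b - y‖ • (1 : C) ≤ δ • (1 : C) := smul_le_smul_of_nonneg_right h zero_le_one
    have h5 := add_le_add (h2.trans h4) h1
    rw [sub_add_cancel] at h5
    rwa [two_mul, add_smul]
  have h6 := norm_le_of_nonneg_of_le_smul_one hy h3 (mul_nonneg zero_le_two hn)
  linarith

/-- A self-adjoint element that is nearly idempotent has a spectral projection. -/
def gapProj (a : C) : C := cfc (fun t : ℝ => max 0 (min 1 (2 * t - 1 / 2))) a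

variable {a : C}

lemma gap_aux {t : ℝ} (ht : |t * t - t| < 3 / 16) : t < 1 / 4 ∨ 3 / 4 < t := by
  by_contra! h
  have := abs_lt.mp ht
  nlinarith [mul_nonneg (sub_nonneg.mpr h.1) (sub_nonneg.mpr h.2)]

lemma gap_of_mem_spectrum (ha : IsSelfAdjoint a) (h : ‖a * a - a‖ < 3 / 16) {t : ℝ}
    (ht : t ∈ spectrum ℝ a) : t < 1 / 4 ∨ 3 / 4 < t := by
  refine gap_aux ?_
  have h1 : a * a - a = cfc (fun t : ℝ => t * t - t) a := by
    rw [cfc_sub (fun t : ℝ => t * t) (fun t => t) a, cfc_mul (fun t : ℝ => t) (fun t => t) a,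
      cfc_id' ℝ a]
  have h2 := norm_apply_le_norm_cfc (fun t : ℝ => t * t - t) a ht (by fun_prop) ha
  rw [← h1] at h2
  exact h2.trans_lt h

lemma isSelfAdjoint_gapProj : IsSelfAdjoint (gapProj a) := cfc_predicate _ _

lemma gapProj_aux_left {t : ℝ} (h : t < 1 / 4) : max 0 (min 1 (2 * t - 1 / 2)) = 0 := by
  rw [min_eq_right (by linarith), max_eq_left (by linarith)]

lemma gapProj_aux_right {t : ℝ} (h : 3 / 4 < t) : max 0 (min 1 (2 * t - 1 / 2)) = 1 := by
  rw [min_eq_left (by linarith), max_eq_right (by linarith)]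

lemma isStarProjection_gapProj (ha : IsSelfAdjoint a) (h : ‖a * a - a‖ < 3 / 16) :
    IsStarProjection (gapProj a) := by
  refine ⟨?_, isSelfAdjoint_gapProj⟩
  change gapProj a * gapProj a = gapProj a
  rw [gapProj, ← cfc_mul _ _ a]
  refine cfc_congr fun t ht => ?_
  rcases gap_of_mem_spectrum ha h ht with h1 | h1
  · simp only [gapProj_aux_left h1, mul_zero]
  · simp only [gapProj_aux_right h1, mul_one]

lemma Commute.gapProj {x : C} (h : Commute a x) : Commute (gapProj a) x := h.cfc_real _

lemma map_gapProj (θ : C ≃⋆ₐ[ℂ] C) (ha : IsSelfAdjoint a) : θ (gapProj a) = gapProj (θ a) :=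
  StarAlgEquiv.map_cfc_of_continuous θ (by fun_prop) ha

lemma half_smul_gapProj_le (ha : IsSelfAdjoint a) (h : ‖a * a - a‖ < 3 / 16) :
    (1 / 2 : ℝ) • gapProj a ≤ gapProj a * a * gapProj a := by
  have h1 : gapProj a * a * gapProj a = cfc (fun t : ℝ => max 0 (min 1 (2 * t - 1 / 2)) * t
      * max 0 (min 1 (2 * t - 1 / 2))) a := by
    rw [cfc_mul _ _ a, cfc_mul _ (fun t => t) a, cfc_id' ℝ a, gapProj]
  rw [h1, gapProj, ← cfc_const_mul (1 / 2 : ℝ) (fun t => max 0 (min 1 (2 * t - 1 / 2))) a]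
  refine cfc_mono fun t ht => ?_
  rcases gap_of_mem_spectrum ha h ht with h1 | h1
  · simp only [gapProj_aux_left h1, mul_zero, le_refl]
  · simp only [gapProj_aux_right h1, mul_one, one_mul]; linarith

lemma conj_one_sub_gapProj_le (ha : IsSelfAdjoint a) (h : ‖a * a - a‖ < 3 / 16) :
    (1 - gapProj a) * a * (1 - gapProj a) ≤ (1 / 2 : ℝ) • (1 - gapProj a) := by
  have h0 : 1 - gapProj a = cfc (fun t : ℝ => 1 - max 0 (min 1 (2 * t - 1 / 2))) a := by
    rw [cfc_sub (fun _ : ℝ => 1) _ a, cfc_const_one ℝ a, gapProj]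
  have h1 : (1 - gapProj a) * a * (1 - gapProj a) =
      cfc (fun t : ℝ => (1 - max 0 (min 1 (2 * t - 1 / 2))) * t
        * (1 - max 0 (min 1 (2 * t - 1 / 2)))) a := by
    rw [cfc_mul _ _ a, cfc_mul _ (fun t => t) a, cfc_id' ℝ a, h0]
  rw [h1, h0, ← cfc_const_mul (1 / 2 : ℝ) (fun t => 1 - max 0 (min 1 (2 * t - 1 / 2))) a]
  refine cfc_mono fun t ht => ?_
  rcases gap_of_mem_spectrum ha h ht with h1 | h1
  · simp only [gapProj_aux_left h1, sub_zero, one_mul, mul_one]; linarith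
  · simp only [gapProj_aux_right h1, sub_self, mul_zero, zero_mul, le_refl]

end Cut

/-! ### Domination by compressions -/

section Dominated

variable {C : Type*} [CStarAlgebra C]

/-- `a` is dominated by a conjugate of `b`. For a projection `a` this is Cuntz subequivalence, in
the strong form that `a = w * b * star w` for some `w`. -/
def Dominated (a b : C) : Prop := ∃ t, a ≤ t * b * star t

variable {a b c : C}

lemma Dominated.of_le (h : a ≤ b) : Dominated a b := ⟨1, by simpa using h⟩

lemma Dominated.trans (h : Dominated a b) (h' : Dominated b c) : Dominated a c := by
  obtain ⟨t, ht⟩ := h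
  obtain ⟨s, hs⟩ := h'
  refine ⟨t * s, ht.trans ((star_right_conjugate_le_conjugate hs t).trans_eq ?_)⟩
  simp only [star_mul, mul_assoc]

lemma dominated_conj (t b : C) : Dominated (t * b * star t) b := ⟨t, le_rfl⟩

lemma dominated_smul {r : ℝ} (hr : 0 ≤ r) (b : C) : Dominated (r • b) b := by
  refine ⟨(√r) • 1, le_of_eq ?_⟩
  rw [star_smul, star_one, star_trivial, smul_mul_assoc, smul_mul_assoc, mul_smul_comm, one_mul,
    mul_one, smul_smul, Real.mul_self_sqrt hr]

lemma Dominated.of_smul {r : ℝ} (hr : 0 < r) (h : Dominated (r • a) b) : Dominated a b := by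
  refine Dominated.trans (b := r • a) ?_ h
  have := dominated_smul (inv_nonneg.mpr hr.le) (r • a)
  rwa [smul_smul, inv_mul_cancel₀ hr.ne', one_smul] at this

lemma Dominated.map {C' : Type*} [CStarAlgebra C'] (θ : C →⋆ₐ[ℂ] C') (h : Dominated a b) :
    Dominated (θ a) (θ b) := by
  obtain ⟨t, ht⟩ := h
  refine ⟨θ t, ?_⟩
  rw [← map_star θ, ← map_mul, ← map_mul]
  exact OrderHomClass.mono θ ht

lemma dominated_mul_mul_of_le {x c : C} (hx : IsSelfAdjoint x) (hc : 0 ≤ c) (hx0 : 0 ≤ x) :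
    Dominated (x * c * x) x := by
  have h1 := hx.conjugate_le_conjugate (IsSelfAdjoint.of_nonneg hc).le_algebraMap_norm_self
  rw [Algebra.algebraMap_eq_smul_one, mul_smul_comm, smul_mul_assoc, mul_one] at h1
  refine (Dominated.of_le h1).trans ((dominated_smul (norm_nonneg _) _).trans ?_)
  exact (Dominated.of_le (mul_self_le_norm_smul hx0)).trans (dominated_smul (norm_nonneg _) _)

end Dominated

/-! ### Exact Rokhlin families -/

section Rokhlin

variable {C H : Type*} [CStarAlgebra C] [Group H] [Fintype H] (β : H →* (C ≃⋆ₐ[ℂ] C))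

/-- Mutually orthogonal projections, indexed by a finite group, which are permuted by the action
exactly as the group permutes itself. -/
structure IsRokhlinFamily (f : H → C) : Prop where
  proj : ∀ h, IsStarProjection (f h)
  orth : ∀ g h, g ≠ h → f g * f h = 0
  equivariant : ∀ g h, β g (f h) = f (g * h)

namespace IsRokhlinFamily

variable {β} {f : H → C} (hf : IsRokhlinFamily β f)
include hf

lemma mul_sum (g : H) : f g * ∑ h, f h = f g := by
  classical
  rw [Finset.mul_sum, Finset.sum_eq_single g (fun h _ hh => hf.orth g h hh.symm)
    (fun h => absurd (Finset.mem_univ g) h)]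
  exact (hf.proj g).isIdempotentElem

lemma sum_mul (g : H) : (∑ h, f h) * f g = f g := by
  have := congrArg star (hf.mul_sum g)
  simpa only [star_mul, star_sum, (hf.proj _).isSelfAdjoint.star_eq] using this

lemma isStarProjection_sum : IsStarProjection (∑ h, f h) := by
  refine ⟨?_, ?_⟩
  · change (∑ h, f h) * (∑ h, f h) = ∑ h, f h
    rw [Finset.sum_mul]
    exact Finset.sum_congr rfl fun h _ => hf.mul_sum h
  · exact isSelfAdjoint_sum _ fun h _ => (hf.proj h).isSelfAdjoint

lemma map_sum (g : H) : β g (∑ h, f h) = ∑ h, f h := by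
  rw [_root_.map_sum]
  simp only [hf.equivariant]
  exact Fintype.sum_equiv (Equiv.mulLeft g) _ _ fun h => rfl

end IsRokhlinFamily

/-- The anticommutator of nearly orthogonal projections is nearly positive, by the positivity of
`star (κ • p + p * q) * (κ • p + p * q)`. -/
lemma mul_add_mul_add_smul_nonneg {p q : C} (hp : IsStarProjection p) (hq : IsStarProjection q)
    {κ : ℝ} (hκ : 0 < κ) (h : ‖p * q‖ ≤ κ) : 0 ≤ p * q + q * p + κ • (p + q) := by
  have hpp : p * p = p := hp.isIdempotentElem
  have hqq : q * q = q := hq.isIdempotentElem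
  have h1 : q * (p * q) ≤ (κ * κ) • q := by
    have h2 : star (p * q) * (p * q) ≤ algebraMap ℝ C (κ * κ) := by
      refine (IsSelfAdjoint.star_mul_self (p * q)).le_algebraMap_norm_self.trans
        (algebraMap_mono C ?_)
      rw [CStarRing.norm_star_mul_self]
      exact mul_self_le_mul_self (norm_nonneg _) h
    have h3 := hq.isSelfAdjoint.conjugate_le_conjugate h2
    rw [star_mul, hp.isSelfAdjoint.star_eq, hq.isSelfAdjoint.star_eq,
      Algebra.algebraMap_eq_smul_one, mul_smul_comm, smul_mul_assoc, mul_one, hqq] at h3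
    calc q * (p * q) = q * (q * p * (p * q)) * q := by
          rw [show q * (q * p * (p * q)) * q = (q * q) * (p * p) * (q * q) by
            simp only [mul_assoc], hpp, hqq, mul_assoc]
      _ ≤ _ := h3
  have h4 : 0 ≤ star (κ • p + p * q) * (κ • p + p * q) := star_mul_self_nonneg _
  have h5 : star (κ • p + p * q) * (κ • p + p * q)
      = (κ * κ) • p + κ • (p * q) + κ • (q * p) + q * (p * q) := by
    rw [star_add, star_smul, star_mul, hp.isSelfAdjoint.star_eq, hq.isSelfAdjoint.star_eq,
      star_trivial, add_mul, mul_add, mul_add, smul_mul_assoc, smul_mul_assoc, mul_smul_comm,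
      mul_smul_comm, smul_smul, hpp, ← mul_assoc p p, hpp, mul_assoc q p p, hpp, mul_assoc q p,
      ← mul_assoc p p, hpp]
    abel
  have h6 : 0 ≤ κ • (p * q + q * p + κ • (p + q)) := by
    calc 0 ≤ _ := h4
      _ = (κ * κ) • p + κ • (p * q) + κ • (q * p) + q * (p * q) := h5
      _ ≤ (κ * κ) • p + κ • (p * q) + κ • (q * p) + (κ * κ) • q := by gcongr
      _ = _ := by simp only [smul_add, smul_smul]; abel
  have h7 := smul_nonneg (inv_nonneg.mpr hκ.le) h6
  rwa [smul_smul, inv_mul_cancel₀ hκ.ne', one_smul] at h7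

/-- A function that is the inverse square root near `1` and takes the value `1` at `0`. -/
def gapInvSqrt (t : ℝ) : ℝ := 1 + min 1 (max 0 (2 * t)) * ((√(max t (1 / 2)))⁻¹ - 1)

lemma continuous_gapInvSqrt : Continuous gapInvSqrt := by
  unfold gapInvSqrt
  have : Continuous fun t : ℝ => (√(max t (1 / 2)))⁻¹ := by
    refine Continuous.inv₀ (by fun_prop) fun t => ?_
    have : 0 < max t (1 / 2) := lt_max_of_lt_right (by norm_num)
    exact (Real.sqrt_pos.mpr this).ne'
  fun_prop

lemma gapInvSqrt_zero : gapInvSqrt 0 = 1 := by simp [gapInvSqrt]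

lemma gapInvSqrt_of_le {t : ℝ} (ht : 1 / 2 ≤ t) : gapInvSqrt t = (√t)⁻¹ := by
  rw [gapInvSqrt, max_eq_left ht, max_eq_right (by linarith), min_eq_left (by linarith)]; ring

lemma abs_gapInvSqrt_sub_one_le {t s : ℝ} (ht : 1 / 2 ≤ t) (hs : |t - 1| ≤ s) :
    |gapInvSqrt t - 1| ≤ 2 * s := by
  have h0 : 0 < √t := Real.sqrt_pos.mpr (by linarith)
  have h1 : √t * √t = t := Real.mul_self_sqrt (by linarith)
  have h2 : 1 / 2 ≤ √t := by nlinarith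
  rw [gapInvSqrt_of_le ht, show (√t)⁻¹ - 1 = -(t - 1) * ((√t)⁻¹ * (1 + √t)⁻¹) by
    field_simp; nlinarith, abs_mul, abs_neg]
  have h3 : (√t)⁻¹ ≤ 2 := by rw [inv_le_comm₀ h0 two_pos]; linarith
  have h4 : (1 + √t)⁻¹ ≤ 1 := inv_le_one_of_one_le₀ (by linarith)
  have h5 : 0 ≤ (√t)⁻¹ := by positivity
  have h6 : 0 ≤ (1 + √t)⁻¹ := by positivity
  have h7 : (√t)⁻¹ * (1 + √t)⁻¹ ≤ 2 := by nlinarith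
  rw [abs_of_nonneg (mul_nonneg h5 h6), mul_comm 2 s]
  exact mul_le_mul hs h7 (mul_nonneg h5 h6) ((abs_nonneg _).trans hs)

/-- A nearly orthogonal family of projections that is permuted by a finite group can be made
orthogonal, without losing the equivariance. With `E` the sum of the projections `x g`, the
projections are `E^{-1/2} * x g * E^{-1/2}`. -/
lemma exists_isRokhlinFamily_near {x : H → C} (hx : ∀ g, IsStarProjection (x g))
    (heq : ∀ g h, β g (x h) = x (g * h)) {κ : ℝ} (hκ : 0 < κ)
    (hsmall : (Fintype.card H : ℝ) * Fintype.card H * κ ≤ 1 / 16)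
    (hxx : ∀ g h, g ≠ h → ‖x g * x h‖ ≤ κ) :
    ∃ f, IsRokhlinFamily β f ∧
      ∀ g, ‖f g - x g‖ ≤ 12 * ((Fintype.card H : ℝ) * Fintype.card H * κ) := by
  classical
  obtain ⟨N, hN⟩ : ∃ N : ℝ, N = Fintype.card H := ⟨_, rfl⟩
  rw [← hN] at hsmall ⊢
  have hN1 : 1 ≤ N := by rw [hN]; exact_mod_cast Fintype.card_pos
  obtain ⟨E, hE⟩ : ∃ E, E = ∑ g, x g := ⟨_, rfl⟩
  have hE0 : 0 ≤ E := by rw [hE]; exact Finset.sum_nonneg fun g _ => (hx g).nonneg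
  have hEsa := IsSelfAdjoint.of_nonneg hE0
  have hxidem : ∀ g, x g * x g = x g := fun g => (hx g).isIdempotentElem
  have hxn : ∀ g, ‖x g‖ ≤ 1 := fun g => (hx g).norm_le
  -- the spectrum of `E` is contained in `{0} ∪ [1/2, ∞)`
  have hlow : 0 ≤ E * E - (1 - N * κ) • E := by
    have h1 : ∀ g h, 0 ≤ x g * x h + x h * x g + κ • (x g + x h)
        - (if g = h then (2 : ℝ) • x g else 0) := by
      intro g h
      by_cases hgh : g = h
      · subst hgh
        rw [if_pos rfl, hxidem, two_smul]
        have := smul_nonneg hκ.le (add_nonneg (hx g).nonneg (hx g).nonneg)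
        simpa using this
      · rw [if_neg hgh, sub_zero]
        exact mul_add_mul_add_smul_nonneg (hx g) (hx h) hκ (hxx g h hgh)
    have h2 := Finset.sum_nonneg fun g (_ : g ∈ Finset.univ) =>
      Finset.sum_nonneg fun h (_ : h ∈ Finset.univ) => h1 g h
    have h3 : ∑ g, ∑ h, (x g * x h + x h * x g + κ • (x g + x h)
        - (if g = h then (2 : ℝ) • x g else 0)) = (2 : ℝ) • (E * E - (1 - N * κ) • E) := by
      have e1 : ∑ g, ∑ h, x g * x h = E * E := by rw [hE, Finset.sum_mul_sum]
      have e2 : ∑ g, ∑ h, x h * x g = E * E := by rw [Finset.sum_comm, e1]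
      have e3 : ∑ _g : H, ∑ h, κ • x h = (N * κ) • E := by
        rw [Finset.sum_const, ← Finset.smul_sum, ← hE, Finset.card_univ, ← Nat.cast_smul_eq_nsmul ℝ,
          smul_smul, hN]
      have e4 : ∑ g, ∑ _h : H, κ • x g = (N * κ) • E := by rw [Finset.sum_comm, e3]
      have e5 : ∑ g, ∑ h, (if g = h then (2 : ℝ) • x g else 0) = (2 : ℝ) • E := by
        simp only [Finset.sum_ite_eq, Finset.mem_univ, if_true]
        rw [← Finset.smul_sum, hE]
      simp only [Finset.sum_sub_distrib, Finset.sum_add_distrib, smul_add, e1, e2, e3, e4, e5]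
      module
    rw [h3] at h2
    have h4 := smul_nonneg (by norm_num : (0 : ℝ) ≤ 1 / 2) h2
    rwa [smul_smul, show (1 / 2 : ℝ) * 2 = 1 by norm_num, one_smul] at h4
  have hnorm : ‖E * E - E‖ ≤ N * N * κ := by
    have h1 : E * E - E = ∑ g, ∑ h, if g = h then 0 else x g * x h := by
      have e1 : ∑ g, ∑ h, x g * x h = E * E := by rw [hE, Finset.sum_mul_sum]
      have e5 : ∑ g, ∑ h, (if g = h then x g else 0) = E := by
        simp only [Finset.sum_ite_eq, Finset.mem_univ, if_true]
        rw [hE]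
      rw [← e1, ← e5, ← Finset.sum_sub_distrib]
      refine Finset.sum_congr rfl fun g _ => ?_
      rw [← Finset.sum_sub_distrib]
      refine Finset.sum_congr rfl fun h _ => ?_
      by_cases hgh : g = h
      · subst hgh; simp [hxidem]
      · simp [hgh]
    rw [h1]
    calc _ ≤ ∑ g : H, ∑ h : H, κ := norm_sum_le_of_le _ fun g _ => norm_sum_le_of_le _ fun h _ => by
          by_cases hgh : g = h
          · simp [hgh, hκ.le]
          · simpa [hgh] using hxx g h hgh
      _ = N * N * κ := by simp [hN, mul_assoc]
  -- `hlow` excludes the values between `0` and `1 / 2`, and `hnorm` locates the remaining ones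
  have hspec : ∀ t ∈ spectrum ℝ E, t = 0 ∨ (1 / 2 ≤ t ∧ |t - 1| ≤ 2 * (N * N * κ)) := by
    intro t ht
    have ht0 : 0 ≤ t := spectrum_nonneg_of_nonneg hE0 ht
    rcases ht0.eq_or_lt with h | h
    · exact Or.inl h.symm
    right
    have h1 : E * E - (1 - N * κ) • E = cfc (fun t : ℝ => t * t - (1 - N * κ) * t) E := by
      rw [cfc_sub (fun t : ℝ => t * t) _ E, cfc_mul (fun t : ℝ => t) (fun t => t) E,
        cfc_const_mul (1 - N * κ) (fun t : ℝ => t) E, cfc_id' ℝ E]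
    rw [h1, cfc_nonneg_iff _ E] at hlow
    have h2 := hlow t ht
    have h3 : E * E - E = cfc (fun t : ℝ => t * t - t) E := by
      rw [cfc_sub (fun t : ℝ => t * t) (fun t => t) E, cfc_mul (fun t : ℝ => t) (fun t => t) E,
        cfc_id' ℝ E]
    have h4 := norm_apply_le_norm_cfc (fun t : ℝ => t * t - t) E ht (by fun_prop) hEsa
    rw [← h3] at h4
    have h5 : |t * t - t| ≤ N * N * κ := h4.trans hnorm
    have h6 : N * κ ≤ 1 / 16 := by nlinarith [mul_pos (by linarith : 0 < N) hκ]
    have h7 : 1 / 2 ≤ t := by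
      have : 0 ≤ t - (1 - N * κ) := by
        by_contra! h8
        nlinarith
      linarith
    refine ⟨h7, ?_⟩
    rw [show t * t - t = t * (t - 1) by ring, abs_mul, abs_of_pos h] at h5
    nlinarith [abs_nonneg (t - 1)]
  obtain ⟨s, hs⟩ : ∃ s, s = N * N * κ := ⟨_, rfl⟩
  rw [← hs] at hsmall hspec ⊢
  have hs0 : 0 ≤ s := by rw [hs]; positivity
  -- `z` is the inverse square root of `E` on the range of `E`, and is close to `1`
  obtain ⟨z, hz⟩ : ∃ z, z = cfc gapInvSqrt E := ⟨_, rfl⟩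
  have hzsa : IsSelfAdjoint z := by rw [hz]; exact cfc_predicate _ _
  have hzE : E * (z * z) * E = E := by
    have h1 : E * (z * z) * E = cfc (fun t : ℝ => t * (gapInvSqrt t * gapInvSqrt t) * t) E := by
      have hc := continuous_gapInvSqrt
      rw [cfc_mul _ (fun t => t) E, cfc_mul (fun t => t) _ E, cfc_mul _ _ E,
        cfc_id' ℝ E, hz]
    rw [h1]
    conv_rhs => rw [← cfc_id' ℝ E]
    refine cfc_congr fun t ht => ?_
    rcases hspec t ht with h | ⟨h, _⟩
    · simp [h]
    · have h0 : 0 < √t := Real.sqrt_pos.mpr (by linarith)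
      have h1 : √t * √t = t := Real.mul_self_sqrt (by linarith)
      simp only [gapInvSqrt_of_le h]
      rw [← mul_inv, h1]
      field_simp
  have hz1 : ‖z - 1‖ ≤ 4 * s := by
    have h1 : z - 1 = cfc (fun t : ℝ => gapInvSqrt t - 1) E := by
      have hc := continuous_gapInvSqrt
      rw [cfc_sub _ (fun _ => 1) E, cfc_const_one ℝ E, hz]
    rw [h1]
    refine norm_cfc_le (by positivity) fun t ht => ?_
    rcases hspec t ht with h | ⟨h, h'⟩
    · rw [h, gapInvSqrt_zero]; simp [hs0]
    · exact (abs_gapInvSqrt_sub_one_le h h').trans_eq (by ring)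
  -- the defect `x g * z ^ 2 * x h - δ_{gh} x g` vanishes since it is a contraction of itself
  obtain ⟨D, hD⟩ : ∃ D : H → H → C, D = fun g h => x g * (z * z) * x h
      - (if g = h then x g else 0) := ⟨_, rfl⟩
  have hDsum : ∀ g h, ∑ k, ∑ l, x g * x k * D k l * (x l * x h) = 0 := by
    intro g h
    have e1 : ∀ k l, x g * x k * D k l * (x l * x h)
        = x g * x k * (z * z) * (x l * x h) - (if k = l then x g * x k * x h else 0) := by
      intro k l
      rw [hD]
      simp only [mul_sub, sub_mul]
      congr 1
      · rw [show x g * x k * (x k * (z * z) * x l) * (x l * x h)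
          = x g * (x k * x k) * (z * z) * ((x l * x l) * x h) by simp only [mul_assoc],
          hxidem, hxidem]
      · by_cases hkl : k = l
        · subst hkl
          rw [if_pos rfl, if_pos rfl, show x g * x k * x k * (x k * x h)
            = x g * ((x k * x k) * (x k * x h)) by simp only [mul_assoc], hxidem,
            ← mul_assoc (x k), hxidem, mul_assoc]
        · simp [hkl]
    have e2 : ∑ k, ∑ l, x g * x k * (z * z) * (x l * x h) = x g * E * x h := by
      conv_rhs => rw [← hzE]
      rw [hE]
      simp only [Finset.mul_sum, Finset.sum_mul, mul_assoc]
      rw [Finset.sum_comm]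
    have e3 : ∑ k, ∑ l, (if k = l then x g * x k * x h else 0) = x g * E * x h := by
      simp only [Finset.sum_ite_eq, Finset.mem_univ, if_true]
      rw [hE, Finset.mul_sum, Finset.sum_mul]
    simp only [e1, Finset.sum_sub_distrib, e2, e3, sub_self]
  have hDcut : ∀ g h, x g * x g * D g h * (x h * x h) = D g h := by
    intro g h
    rw [hD, hxidem, hxidem]
    simp only [mul_sub, sub_mul]
    congr 1
    · rw [show x g * (x g * (z * z) * x h) * x h = (x g * x g) * (z * z) * (x h * x h) by
        simp only [mul_assoc], hxidem, hxidem]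
    · by_cases hgh : g = h
      · subst hgh; simp [hxidem]
      · simp [hgh]
  -- in `hDsum` all terms except `D g h` itself contain a small factor `x g * x k` or `x l * x h`
  have hDle : ∀ g h, ‖D g h‖ ≤ κ * ∑ kl : H × H, ‖D kl.1 kl.2‖ := by
    intro g h
    have h1 := hDsum g h
    rw [← Fintype.sum_prod_type' (f := fun k l => x g * x k * D k l * (x l * x h)),
      ← Finset.add_sum_erase _ _ (Finset.mem_univ (g, h)), hDcut] at h1
    rw [eq_neg_of_add_eq_zero_left h1, norm_neg, Finset.mul_sum]
    refine (norm_sum_le _ _).trans ((Finset.sum_le_sum fun kl hkl => ?_).trans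
      (Finset.sum_le_sum_of_subset_of_nonneg (Finset.subset_univ _) fun _ _ _ => by positivity))
    have hne : (kl.1, kl.2) ≠ (g, h) := by simpa using hkl
    have hle : ∀ a b : H, ‖x a * x b‖ ≤ 1 := fun a b => (norm_mul_le _ _).trans <|
      mul_le_one₀ (hxn a) (norm_nonneg _) (hxn b)
    have h2 : ‖x g * x kl.1 * D kl.1 kl.2 * (x kl.2 * x h)‖
        ≤ ‖x g * x kl.1‖ * ‖D kl.1 kl.2‖ * ‖x kl.2 * x h‖ :=
      (norm_mul_le _ _).trans (mul_le_mul_of_nonneg_right (norm_mul_le _ _) (norm_nonneg _))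
    refine h2.trans ?_
    by_cases hk : kl.1 = g
    · have hl : kl.2 ≠ h := fun hl => hne (by rw [hk, hl])
      calc _ ≤ 1 * ‖D kl.1 kl.2‖ * κ := by
            have := hle g kl.1
            have := hxx _ _ hl
            gcongr
        _ = _ := by ring
    · calc _ ≤ κ * ‖D kl.1 kl.2‖ * 1 := by
            have := hxx _ _ (Ne.symm hk)
            have := hle kl.2 h
            gcongr
        _ = _ := by ring
  have hDzero : ∀ g h, D g h = 0 := by
    have h1 : ∑ gh : H × H, ‖D gh.1 gh.2‖ ≤ s * ∑ kl : H × H, ‖D kl.1 kl.2‖ := by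
      refine (Finset.sum_le_sum fun gh _ => hDle gh.1 gh.2).trans_eq ?_
      rw [Finset.sum_const, nsmul_eq_mul, Finset.card_univ, Fintype.card_prod, hs, hN]
      push_cast; ring
    have h2 : 0 ≤ ∑ gh : H × H, ‖D gh.1 gh.2‖ := Finset.sum_nonneg fun _ _ => norm_nonneg _
    have h3 : ∑ gh : H × H, ‖D gh.1 gh.2‖ = 0 := by nlinarith
    intro g h
    rw [Finset.sum_eq_zero_iff_of_nonneg fun _ _ => norm_nonneg _] at h3
    exact norm_eq_zero.mp (h3 (g, h) (Finset.mem_univ _))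
  have hzfix : ∀ g, β g z = z := by
    intro g
    rw [hz, StarAlgEquiv.map_cfc_of_continuous (β g) continuous_gapInvSqrt hEsa]
    congr 1
    rw [hE, _root_.map_sum]
    simp only [heq]
    exact Fintype.sum_equiv (Equiv.mulLeft g) _ _ fun h => rfl
  refine ⟨fun g => z * x g * z, ⟨fun g => ⟨?_, ?_⟩, fun g h hgh => ?_, fun g h => ?_⟩, fun g => ?_⟩
  · have h1 := hDzero g g
    rw [hD] at h1
    simp only [if_true] at h1
    change z * x g * z * (z * x g * z) = z * x g * z
    rw [show z * x g * z * (z * x g * z) = z * (x g * (z * z) * x g) * z by simp only [mul_assoc],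
      sub_eq_zero.mp h1]
  · have := (hx g).isSelfAdjoint.conjugate z
    rwa [hzsa.star_eq] at this
  · have h1 := hDzero g h
    rw [hD] at h1
    simp only [if_neg hgh, sub_zero] at h1
    change z * x g * z * (z * x h * z) = 0
    rw [show z * x g * z * (z * x h * z) = z * (x g * (z * z) * x h) * z by simp only [mul_assoc],
      h1, mul_zero, zero_mul]
  · simp only [map_mul, hzfix, heq]
  · have h1 : z * x g * z - x g = (z - 1) * x g * z + x g * (z - 1) := by
      simp only [sub_mul, mul_sub, one_mul, mul_one]; abel
    have hzn : ‖z‖ ≤ 2 := by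
      have : ‖z‖ ≤ ‖z - 1‖ + ‖(1 : C)‖ := by
        simpa using norm_add_le (z - 1) 1
      have h1 : ‖(1 : C)‖ ≤ 1 := by
        have := (IsStarProjection.one C).norm_le
        exact this
      linarith
    have hxg := hxn g
    change ‖z * x g * z - x g‖ ≤ _
    rw [h1]
    calc _ ≤ ‖z - 1‖ * ‖x g‖ * ‖z‖ + ‖x g‖ * ‖z - 1‖ := by
          refine (norm_add_le _ _).trans (add_le_add ?_ (norm_mul_le _ _))
          exact (norm_mul_le _ _).trans
            (mul_le_mul_of_nonneg_right (norm_mul_le _ _) (norm_nonneg _))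
      _ ≤ 4 * s * 1 * 2 + 1 * (4 * s) := by gcongr
      _ = 12 * s := by ring

end Rokhlin

/-! ### Exact Rokhlin families from the tracial Rokhlin property -/

section TracialRokhlin

variable {C H : Type*} [CStarAlgebra C] [Group H] [Fintype H]

/-- If `e` is equivalent to a projection in the hereditary subalgebra generated by `x`, then the
projections close to `e` are dominated by `x`. -/
lemma dominated_of_murrayVonNeumannEquiv {x r e q : C} (hx : 0 ≤ x) (hr : IsStarProjection r)
    (he : IsStarProjection e) (hq : IsStarProjection q)
    (hqx : q ∈ closure (Set.range fun a => x * a * x)) (h : MurrayVonNeumannEquiv e q)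
    (hre : ‖r - e‖ ≤ 1 / 4) : Dominated r x := by
  obtain ⟨v, hv, hv'⟩ := h
  have hxsa := IsSelfAdjoint.of_nonneg hx
  have he' : e = star v * (q * star q) * v := by
    rw [hq.isSelfAdjoint.star_eq, ← hv', ← hv,
      show star v * (v * star v * (v * star v)) * v
        = (star v * v) * (star v * v) * (star v * v) by simp only [mul_assoc], hv,
      he.isIdempotentElem.eq, he.isIdempotentElem.eq]
  have hmem : e ∈ closure ((fun a => star v * (a * star a) * v) ''
      Set.range fun a => x * a * x) := by
    rw [he']
    exact image_closure_subset_closure_image (by fun_prop) ⟨q, hqx, rfl⟩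
  obtain ⟨_, ⟨_, ⟨a, rfl⟩, rfl⟩, hd⟩ := Metric.mem_closure_iff.mp hmem (1 / 4) (by norm_num)
  rw [dist_eq_norm] at hd
  have h1 : star v * (x * a * x * star (x * a * x)) * v
      = star v * (x * (a * (x * x) * star a) * x) * star (star v) := by
    rw [star_star, star_mul, star_mul, hxsa.star_eq]
    simp only [mul_assoc]
  have hxx : 0 ≤ a * (x * x) * star a := by
    have := mul_star_self_nonneg (a * x)
    rwa [star_mul, hxsa.star_eq, ← mul_assoc, mul_assoc a x x] at this
  simp only [h1] at hd
  have hsa : IsSelfAdjoint (star v * (x * (a * (x * x) * star a) * x) * star (star v)) :=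
    ((hxsa.conjugate_nonneg hxx).isSelfAdjoint).conjugate _
  have h2 : ‖r - star v * (x * (a * (x * x) * star a) * x) * star (star v)‖ ≤ 1 / 2 := by
    have := norm_sub_le_norm_sub_add_norm_sub r e
      (star v * (x * (a * (x * x) * star a) * x) * star (star v))
    linarith
  have h3 := smul_le_conj_of_norm_sub_lt hr hsa h2
  have h4 : Dominated r (star v * (x * (a * (x * x) * star a) * x) * star (star v)) :=
    Dominated.of_smul (one_half_pos (α := ℝ)) ⟨r, by rw [hr.isSelfAdjoint.star_eq]; exact h3⟩
  exact h4.trans ((dominated_conj _ _).trans (dominated_mul_mul_of_le hxsa hxx hx))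

variable [TopologicalSpace H]

/-- In the tracial Rokhlin property the projections can be chosen to be permuted exactly, by a
perturbation. -/
lemma HasTracialRokhlinProperty.exists_isRokhlinFamily {α : CStarAction H C}
    (hα : HasTracialRokhlinProperty α) (F : Finset C) {ε : ℝ} (hε : 0 < ε) {x : C} (hx : 0 ≤ x)
    (hx1 : ‖x‖ = 1) :
    ∃ f, IsRokhlinFamily α.toAut f ∧ (∀ g, ∀ a ∈ F, ‖f g * a - a * f g‖ < ε) ∧
      Dominated (1 - ∑ g, f g) x ∧ 1 - ε < ‖(∑ g, f g) * x * (∑ g, f g)‖ := by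
  obtain ⟨N, hN⟩ : ∃ N : ℝ, N = Fintype.card H := ⟨_, rfl⟩
  have hN1 : 1 ≤ N := by rw [hN]; exact_mod_cast Fintype.card_pos
  obtain ⟨M, hM0, hM⟩ : ∃ M : ℝ, 0 ≤ M ∧ ∀ a ∈ F, ‖a‖ ≤ M := by
    refine ⟨∑ a ∈ F, ‖a‖, Finset.sum_nonneg fun _ _ => norm_nonneg _, fun a ha => ?_⟩
    exact Finset.single_le_sum (f := fun a => ‖a‖) (fun _ _ => norm_nonneg _) ha
  obtain ⟨η, hη, h1, h2, h3⟩ : ∃ η : ℝ, 0 < η ∧ N * η ≤ 1 / 4 ∧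
      η + 2 * (M * η) ≤ ε ∧ η + 2 * (N * η) ≤ ε := by
    refine ⟨min (1 / (4 * N)) (min (ε / (1 + 2 * M)) (ε / (1 + 2 * N))),
      by positivity, ?_, ?_, ?_⟩
    · calc _ ≤ N * (1 / (4 * N)) := by gcongr; exact min_le_left _ _
        _ = 1 / 4 := by field_simp
    · have : min (1 / (4 * N)) (min (ε / (1 + 2 * M)) (ε / (1 + 2 * N))) ≤ ε / (1 + 2 * M) :=
        (min_le_right _ _).trans (min_le_left _ _)
      rw [le_div_iff₀ (by positivity)] at this
      linarith
    · have : min (1 / (4 * N)) (min (ε / (1 + 2 * M)) (ε / (1 + 2 * N))) ≤ ε / (1 + 2 * N) :=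
        (min_le_right _ _).trans (min_le_right _ _)
      rw [le_div_iff₀ (by positivity)] at this
      linarith
  -- `κ` is the precision of the given projections, `η` that of the exact ones
  obtain ⟨κ, hκ, hκ1, hκ2, hκη⟩ : ∃ κ : ℝ, 0 < κ ∧ N * N * (2 * κ) ≤ 1 / 16 ∧
      12 * (N * N * (2 * κ)) + κ ≤ η ∧ κ ≤ η := by
    refine ⟨min (1 / (32 * (N * N))) (η / (25 * (N * N))), by positivity, ?_, ?_, ?_⟩
    · have : min (1 / (32 * (N * N))) (η / (25 * (N * N))) ≤ 1 / (32 * (N * N)) := min_le_left _ _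
      rw [le_div_iff₀ (by positivity)] at this
      linarith
    · have : min (1 / (32 * (N * N))) (η / (25 * (N * N))) ≤ η / (25 * (N * N)) := min_le_right _ _
      have h0 : 0 < min (1 / (32 * (N * N))) (η / (25 * (N * N))) := by positivity
      rw [le_div_iff₀ (by positivity)] at this
      nlinarith [mul_le_mul hN1 hN1 zero_le_one (by linarith)]
    · refine (min_le_right _ _).trans (div_le_self hη.le ?_)
      nlinarith
  obtain ⟨e, hep, heo, hee, hec, ⟨q, hq, hqx, hqe⟩, hn⟩ := hα.exists_projections F κ hκ x hx hx1
  -- the translates of `e 1` are permuted exactly, and are close to the orthogonal `e g`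
  obtain ⟨y, hy⟩ : ∃ y : H → C, y = fun g => α.toAut g (e 1) := ⟨_, rfl⟩
  have hyp : ∀ g, IsStarProjection (y g) := fun g => by rw [hy]; exact (hep 1).map (α.toAut g)
  have hye : ∀ g, ‖y g - e g‖ ≤ κ := fun g => by
    rw [hy]
    have := (hee g 1).le
    rwa [mul_one] at this
  have hyy : ∀ g h, g ≠ h → ‖y g * y h‖ ≤ 2 * κ := fun g h hgh => by
    have e1 : y g * y h = (y g - e g) * y h + e g * (y h - e h) := by
      rw [sub_mul, mul_sub, heo g h hgh]; abel
    rw [e1]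
    calc _ ≤ ‖y g - e g‖ * ‖y h‖ + ‖e g‖ * ‖y h - e h‖ :=
          (norm_add_le _ _).trans (add_le_add (norm_mul_le _ _) (norm_mul_le _ _))
      _ ≤ κ * 1 + 1 * κ := by
          have := hye g
          have := hye h
          have := (hyp h).norm_le
          have := (hep g).norm_le
          gcongr
      _ = 2 * κ := by ring
  obtain ⟨f, hf, hfy⟩ := exists_isRokhlinFamily_near α.toAut hyp
    (fun g h => by rw [hy]; simp only [map_mul]; rfl) (κ := 2 * κ) (by positivity)
    (by rw [← hN]; exact hκ1) hyy
  rw [← hN] at hfy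
  have hfe : ∀ g, ‖f g - e g‖ ≤ η := fun g => by
    have := norm_sub_le_norm_sub_add_norm_sub (f g) (y g) (e g)
    linarith [hfy g, hye g]
  have hsum : ‖∑ g, f g - ∑ g, e g‖ ≤ N * η := by
    rw [← Finset.sum_sub_distrib]
    refine (norm_sum_le_of_le _ fun g _ => hfe g).trans_eq ?_
    rw [Finset.sum_const, nsmul_eq_mul, Finset.card_univ, hN]
  have hesum : IsStarProjection (∑ g, e g) := by
    classical
    refine ⟨?_, isSelfAdjoint_sum _ fun h _ => (hep h).isSelfAdjoint⟩
    change (∑ g, e g) * (∑ g, e g) = ∑ g, e g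
    rw [Finset.sum_mul]
    refine Finset.sum_congr rfl fun g _ => ?_
    rw [Finset.mul_sum, Finset.sum_eq_single g (fun h _ hh => heo g h hh.symm)
      (fun h => absurd (Finset.mem_univ g) h)]
    exact (hep g).isIdempotentElem
  have hfsum := hf.isStarProjection_sum
  refine ⟨f, hf, fun g a ha => ?_, ?_, ?_⟩
  · have e1 : f g * a - a * f g
        = (e g * a - a * e g) + ((f g - e g) * a - a * (f g - e g)) := by noncomm_ring
    rw [e1]
    have e2 : ‖(f g - e g) * a - a * (f g - e g)‖ ≤ 2 * (M * η) := by
      have ha' := hM a ha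
      have := hfe g
      calc _ ≤ ‖f g - e g‖ * ‖a‖ + ‖a‖ * ‖f g - e g‖ :=
            (norm_sub_le _ _).trans (add_le_add (norm_mul_le _ _) (norm_mul_le _ _))
        _ ≤ η * M + M * η := by gcongr
        _ = _ := by ring
    have := norm_add_le (e g * a - a * e g) ((f g - e g) * a - a * (f g - e g))
    linarith [hec g a ha]
  · refine dominated_of_murrayVonNeumannEquiv hx hfsum.one_sub hesum.one_sub hq hqx hqe ?_
    rw [sub_sub_sub_cancel_left, norm_sub_rev]
    exact hsum.trans h1
  · obtain ⟨P, hP⟩ : ∃ P, P = ∑ g, f g := ⟨_, rfl⟩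
    obtain ⟨Q, hQ⟩ : ∃ Q, Q = ∑ g, e g := ⟨_, rfl⟩
    rw [← hP] at hfsum hsum ⊢
    rw [← hQ] at hesum hsum hn
    have e1 : Q * x * Q = P * x * P - ((P - Q) * x * P + Q * x * (P - Q)) := by noncomm_ring
    have e2 : ‖(P - Q) * x * P + Q * x * (P - Q)‖ ≤ 2 * (N * η) := by
      have := hfsum.norm_le
      have := hesum.norm_le
      calc _ ≤ ‖P - Q‖ * ‖x‖ * ‖P‖ + ‖Q‖ * ‖x‖ * ‖P - Q‖ := by
            refine (norm_add_le _ _).trans (add_le_add ?_ ?_) <;>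
            exact (norm_mul_le _ _).trans
              (mul_le_mul_of_nonneg_right (norm_mul_le _ _) (norm_nonneg _))
        _ ≤ (N * η) * 1 * 1 + 1 * 1 * (N * η) := by rw [hx1]; gcongr
        _ = _ := by ring
    rw [e1] at hn
    have := norm_sub_le (P * x * P) ((P - Q) * x * P + Q * x * (P - Q))
    linarith

/-- Two positive elements, one acting as a unit on the other, below a given positive element. -/
lemma exists_local_unit [Nontrivial C] {x : C} (hx : 0 ≤ x) (hx1 : ‖x‖ = 1) :
    ∃ h u : C, 0 ≤ h ∧ ‖h‖ = 1 ∧ IsSelfAdjoint u ∧ u * h = h ∧ u * u ≤ (2 : ℝ) • x := by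
  have hsa := IsSelfAdjoint.of_nonneg hx
  have hmem : (1 : ℝ) ∈ spectrum ℝ x := by
    rw [← hx1]; exact CStarAlgebra.norm_mem_spectrum_of_nonneg hx
  have hle : ∀ t ∈ spectrum ℝ x, 0 ≤ t ∧ t ≤ 1 := fun t ht =>
    ⟨spectrum_nonneg_of_nonneg hx ht, by
      rw [← hx1]; exact (le_abs_self t).trans (spectrum.norm_le_norm_of_mem ht)⟩
  refine ⟨cfc (fun t : ℝ => max 0 (2 * t - 1)) x, cfc (fun t : ℝ => min 1 (2 * t)) x,
    cfc_nonneg fun t _ => le_max_left _ _, le_antisymm ?_ ?_, cfc_predicate _ _, ?_, ?_⟩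
  · refine norm_cfc_le zero_le_one fun t ht => ?_
    rw [Real.norm_eq_abs, abs_of_nonneg (le_max_left _ _)]
    exact max_le zero_le_one (by linarith [(hle t ht).2])
  · have := norm_apply_le_norm_cfc (fun t : ℝ => max 0 (2 * t - 1)) x hmem (by fun_prop) hsa
    norm_num at this
    exact this
  · rw [← cfc_mul _ _ x]
    refine cfc_congr fun t ht => ?_
    rcases le_total (2 * t) 1 with h | h
    · simp [max_eq_left (sub_nonpos.mpr h)]
    · simp [min_eq_left h]
  · rw [← cfc_mul _ _ x]
    conv_rhs => rw [← cfc_id' ℝ x, ← cfc_const_mul (2 : ℝ) (fun t => t) x]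
    refine cfc_mono fun t ht => ?_
    have := hle t ht
    rcases le_total (2 * t) 1 with h | h
    · rw [min_eq_right h]; nlinarith
    · rw [min_eq_left h]; linarith

/-- In a simple algebra with the tracial Rokhlin property, the element whose compression has to be
large and the element that dominates the defect may be different. -/
lemma HasTracialRokhlinProperty.exists_isRokhlinFamily_of_pair {α : CStarAction H C}
    (hα : HasTracialRokhlinProperty α) (F : Finset C) {ε : ℝ} (hε : 0 < ε) {x : C} (hx : 0 ≤ x)
    (hx1 : ‖x‖ = 1) {z : C} (hz : 0 ≤ z) (hz0 : z ≠ 0) :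
    ∃ f, IsRokhlinFamily α.toAut f ∧ (∀ g, ∀ a ∈ F, ‖f g * a - a * f g‖ < ε) ∧
      Dominated (1 - ∑ g, f g) z ∧ 1 / 4 ≤ ‖(∑ g, f g) * x * (∑ g, f g)‖ := by
  have : Nontrivial C := hα.simple.nontrivial
  obtain ⟨h, u, hh, hh1, hu, huh, hux⟩ := exists_local_unit hx hx1
  have hhsa := IsSelfAdjoint.of_nonneg hh
  have hh0 : h ≠ 0 := fun h0 => by rw [h0, norm_zero] at hh1; exact zero_ne_one hh1
  obtain ⟨b, hb⟩ := (hα.simple.isFullElement hz hz0).exists_mul_mul_ne_zero hh0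
  -- the property is applied to the normalization `X` of `w`, which is dominated by `z` and lies
  -- under `2 • x`, since `u` acts as a unit on `h`
  obtain ⟨w, hw⟩ : ∃ w, w = h * b * z * star b * h := ⟨_, rfl⟩
  have hw' : w = (h * b) * z * star (h * b) := by
    rw [hw, star_mul, hhsa.star_eq]; simp only [mul_assoc]
  have hw0 : 0 ≤ w := by rw [hw']; exact star_right_conjugate_nonneg hz _
  have hwne : w ≠ 0 := by
    intro h0
    have h1 : h * b * CFC.sqrt z = 0 := by
      refine (CStarRing.mul_star_self_eq_zero_iff _).mp ?_
      rw [star_mul, (IsSelfAdjoint.of_nonneg (CFC.sqrt_nonneg z)).star_eq,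
        show h * b * CFC.sqrt z * (CFC.sqrt z * star (h * b))
          = (h * b) * (CFC.sqrt z * CFC.sqrt z) * star (h * b) by simp only [mul_assoc],
        CFC.sqrt_mul_sqrt_self z hz, ← hw', h0]
    refine hb ?_
    rw [← CFC.sqrt_mul_sqrt_self z hz, ← mul_assoc, h1, zero_mul]
  have hwpos : 0 < ‖w‖ := norm_pos_iff.mpr hwne
  obtain ⟨X, hX⟩ : ∃ X, X = ‖w‖⁻¹ • w := ⟨_, rfl⟩
  have hX0 : 0 ≤ X := by rw [hX]; exact smul_nonneg (by positivity) hw0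
  have hX1 : ‖X‖ = 1 := by
    rw [hX, norm_smul, norm_inv, norm_norm, inv_mul_cancel₀ hwpos.ne']
  have hhu : h * u = h := by
    have := congrArg star huh
    rwa [star_mul, hhsa.star_eq, hu.star_eq] at this
  have huX : u * X * u = X := by
    rw [hX, mul_smul_comm, smul_mul_assoc, hw, show u * (h * b * z * star b * h) * u
      = (u * h) * b * z * star b * (h * u) by simp only [mul_assoc], huh, hhu]
  have hXx : X ≤ (2 : ℝ) • x := by
    have h1 : X ≤ algebraMap ℝ C 1 := by
      have := (IsSelfAdjoint.of_nonneg hX0).le_algebraMap_norm_self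
      rwa [hX1] at this
    have h2 := hu.conjugate_le_conjugate h1
    rw [map_one, mul_one, huX] at h2
    exact h2.trans hux
  obtain ⟨f, hf, hc, hd, hn⟩ := hα.exists_isRokhlinFamily F (lt_min hε one_half_pos) hX0 hX1
  refine ⟨f, hf, fun g a ha => (hc g a ha).trans_le (min_le_left _ _), hd.trans ?_, ?_⟩
  · rw [hX]
    refine (dominated_smul (by positivity) w).trans ?_
    rw [hw']
    exact dominated_conj _ _
  · have hP := hf.isStarProjection_sum
    have h1 := CStarAlgebra.norm_le_norm_of_nonneg_of_le
      (hP.isSelfAdjoint.conjugate_nonneg hX0) (hP.isSelfAdjoint.conjugate_le_conjugate hXx)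
    rw [mul_smul_comm, smul_mul_assoc, norm_smul] at h1
    have h2 : min ε (1 / 2) ≤ 1 / 2 := min_le_right _ _
    norm_num at h1
    linarith

end TracialRokhlin

/-! ### Quasitraces and dimension functions on projections -/

section Quasitrace

variable {C : Type*} [CStarAlgebra C]

lemma isStarProjection_star_mul_self {s q : C} (hq : IsStarProjection q) (h : s * star s = q) :
    IsStarProjection (star s * s) := by
  have h1 : q * s = s := by
    have h2 : (s - q * s) * star (s - q * s) = 0 := by
      rw [star_sub, star_mul, hq.isSelfAdjoint.star_eq, sub_mul, mul_sub, mul_sub, h,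
        ← mul_assoc s, h, mul_assoc q s, h, mul_assoc q s, ← mul_assoc s, h,
        hq.isIdempotentElem.eq, hq.isIdempotentElem.eq]
      abel
    exact (sub_eq_zero.mp ((CStarRing.mul_star_self_eq_zero_iff _).mp h2)).symm
  refine ⟨?_, IsSelfAdjoint.star_mul_self s⟩
  change star s * s * (star s * s) = star s * s
  rw [mul_assoc, ← mul_assoc s, h, h1]

namespace IsQuasitrace

variable {τ : C → ℂ} (hτ : IsQuasitrace τ)
include hτ

/-- A quasitrace is additive on commuting self-adjoint elements, since these lie in a commutative
C*-subalgebra, the double commutant. -/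
lemma map_add_of_commute {x y : C} (hx : IsSelfAdjoint x) (hy : IsSelfAdjoint y)
    (h : Commute x y) : τ (x + y) = τ x + τ y := by
  obtain ⟨S, hS⟩ : ∃ S : Set C, S = {x, y} := ⟨_, rfl⟩
  have hstar : star S = S := by
    rw [hS]
    ext a
    simp only [Set.mem_star, Set.mem_insert_iff, Set.mem_singleton_iff]
    have h1 : ∀ z : C, IsSelfAdjoint z → (star a = z ↔ a = z) := fun z hz => by
      rw [star_eq_iff_star_eq, hz.star_eq, eq_comm]
    rw [h1 x hx, h1 y hy]
  have hsub : S ⊆ Set.centralizer S := by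
    rw [hS]
    rintro a (rfl | rfl) b (rfl | rfl)
    exacts [rfl, h.eq.symm, h.eq, rfl]
  have hmem : ∀ a, a ∈ Set.centralizer (Set.centralizer S) →
      ∀ b, b ∈ Set.centralizer (Set.centralizer S) → a * b = b * a := fun a ha b hb =>
    hb a (Set.centralizer_subset hsub ha)
  have hS2 : S ⊆ Set.centralizer (Set.centralizer S) := Set.subset_centralizer_centralizer
  let D : NonUnitalStarSubalgebra ℂ C :=
    { carrier := Set.centralizer (Set.centralizer S)
      add_mem' := fun ha hb => Set.add_mem_centralizer ha hb
      zero_mem' := Set.zero_mem_centralizer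
      mul_mem' := fun ha hb => Set.mul_mem_centralizer ha hb
      smul_mem' := fun c a ha b hb => by rw [mul_smul_comm, smul_mul_assoc, ha b hb]
      star_mem' := fun {a} ha => Set.star_mem_centralizer' (fun b hb => by
        refine Set.star_mem_centralizer' (fun c hc => ?_) hb
        rw [← hstar]; exact Set.star_mem_star.mpr hc) ha }
  have := hτ.linear D (Set.isClosed_centralizer _) hmem x (hS2 (by rw [hS]; simp)) y
    (hS2 (by rw [hS]; simp)) 1 1
  simpa using this

lemma map_zero : τ 0 = 0 := by
  have := hτ.map_add_of_commute (IsSelfAdjoint.zero C) (IsSelfAdjoint.zero C) (Commute.refl 0)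
  rw [add_zero] at this
  exact left_eq_add.mp this

lemma re_nonneg_of_isStarProjection {p : C} (hp : IsStarProjection p) : 0 ≤ (τ p).re := by
  have := hτ.nonneg p
  rw [hp.isSelfAdjoint.star_eq, hp.isIdempotentElem.eq] at this
  exact (Complex.nonneg_iff.mp this).1

/-- A quasitrace is monotone on projections. -/
lemma re_le_of_mul_eq {p q : C} (hp : IsStarProjection p) (hq : IsStarProjection q)
    (h : q * p = p) : (τ p).re ≤ (τ q).re := by
  have h' : p * q = p := by
    have := congrArg star h
    rwa [star_mul, hp.isSelfAdjoint.star_eq, hq.isSelfAdjoint.star_eq] at this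
  have hqp : IsStarProjection (q - p) := by
    refine ⟨?_, hq.isSelfAdjoint.sub hp.isSelfAdjoint⟩
    change (q - p) * (q - p) = q - p
    rw [sub_mul, mul_sub, mul_sub, hq.isIdempotentElem.eq, hp.isIdempotentElem.eq, h, h']
    abel
  have h1 := hτ.map_add_of_commute hp.isSelfAdjoint hqp.isSelfAdjoint (by
    change p * (q - p) = (q - p) * p
    rw [mul_sub, sub_mul, h, h'])
  rw [add_sub_cancel] at h1
  rw [h1, Complex.add_re]
  linarith [hτ.re_nonneg_of_isStarProjection hqp]

lemma map_sum_of_orthogonal {I : Type*} (t : Finset I) {r : I → C}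
    (hr : ∀ i, IsStarProjection (r i)) (horth : ∀ i j, i ≠ j → r i * r j = 0) :
    τ (∑ i ∈ t, r i) = ∑ i ∈ t, τ (r i) ∧ IsStarProjection (∑ i ∈ t, r i) := by
  classical
  induction t using Finset.induction_on with
  | empty => simp [hτ.map_zero]
  | insert i t hi ih =>
    have h1 : r i * ∑ j ∈ t, r j = 0 := by
      rw [Finset.mul_sum]
      exact Finset.sum_eq_zero fun j hj => horth i j fun h => hi (h ▸ hj)
    have h2 : (∑ j ∈ t, r j) * r i = 0 := by
      rw [Finset.sum_mul]
      exact Finset.sum_eq_zero fun j hj => horth j i fun h => hi (h ▸ hj)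
    rw [Finset.sum_insert hi, Finset.sum_insert hi]
    refine ⟨?_, ?_, (hr i).isSelfAdjoint.add ih.2.isSelfAdjoint⟩
    · rw [hτ.map_add_of_commute (hr i).isSelfAdjoint ih.2.isSelfAdjoint (h1.trans h2.symm), ih.1]
    · change (r i + _) * (r i + _) = r i + _
      rw [add_mul, mul_add, mul_add, h1, h2, (hr i).isIdempotentElem.eq,
        ih.2.isIdempotentElem.eq, add_zero, zero_add]

/-- A projection with many orthogonal copies has small trace. -/
lemma card_mul_re_le {I : Type*} [Fintype I] {s : I → C} {q : C} (hq : IsStarProjection q)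
    (hs : ∀ i, s i * star (s i) = q) (horth : ∀ i j, i ≠ j → s i * star (s j) = 0) :
    (Fintype.card I : ℝ) * (τ q).re ≤ (τ 1).re := by
  have h1 := fun i => isStarProjection_star_mul_self hq (hs i)
  obtain ⟨h2, h3⟩ := hτ.map_sum_of_orthogonal Finset.univ h1 fun i j hij => by
    rw [mul_assoc, ← mul_assoc (s i), horth i j hij, zero_mul, mul_zero]
  have h4 : ∀ i, τ (star (s i) * s i) = τ q := fun i => by rw [hτ.trace, hs]
  simp only [h4, Finset.sum_const, Finset.card_univ, nsmul_eq_mul] at h2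
  have h5 := hτ.re_le_of_mul_eq h3 (IsStarProjection.one C) (one_mul _)
  rw [h2] at h5
  simpa using h5

end IsQuasitrace

/-- The identification of `C` with the 1×1 matrices over `C`. -/
abbrev matrixOne : C ≃⋆ₐ[ℂ] CStarMatrix (Fin 1) (Fin 1) C := CStarMatrix.toOneByOne (Fin 1) ℂ C

lemma positiveRoot_of_isStarProjection {p : C} (hp : IsStarProjection p) (k : ℕ) :
    positiveRoot k p = p := by
  rw [positiveRoot]
  conv_rhs => rw [← cfc_id' ℝ p hp.isSelfAdjoint]
  refine cfc_congr fun t ht => ?_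
  have h1 : t * t - t = 0 := by
    have h2 : cfc (fun t : ℝ => t * t - t) p = 0 := by
      rw [cfc_sub (fun t : ℝ => t * t) (fun t => t) p, cfc_mul (fun t : ℝ => t) (fun t => t) p,
        cfc_id' ℝ p hp.isSelfAdjoint, hp.isIdempotentElem.eq, sub_self]
    have h3 := norm_apply_le_norm_cfc (fun t : ℝ => t * t - t) p ht (by fun_prop) hp.isSelfAdjoint
    rw [h2, norm_zero] at h3
    exact norm_le_zero_iff.mp h3
  have h2 : t = 0 ∨ t = 1 := by
    rcases mul_eq_zero.mp (show t * (t - 1) = 0 by linarith) with h | h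
    · exact Or.inl h
    · exact Or.inr (by linarith)
  have h3 : (1 : ℝ) / ((k : ℝ) + 1) ≠ 0 := by positivity
  rcases h2 with rfl | rfl
  · exact Real.zero_rpow h3
  · exact Real.one_rpow _

lemma dimensionFunction_of_isStarProjection (τ : NormalizedQuasitrace C) {n : ℕ}
    {p : CStarMatrix (Fin n) (Fin n) C} (hp : IsStarProjection p) :
    dimensionFunction τ p = (τ.toFun n p).re := by
  rw [dimensionFunction]
  simp only [positiveRoot_of_isStarProjection hp]
  exact tendsto_const_nhds.limUnder_eq

lemma cornerEmbedding_matrixOne (n : ℕ) (a : C) (i j : Fin (n + 1)) :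
    cornerEmbedding (n + 1) (matrixOne a) i j = if i = 0 ∧ j = 0 then a else 0 := by
  change (if h : i.1 < 1 ∧ j.1 < 1 then a else 0) = _
  simp only [Nat.lt_one_iff, Fin.val_eq_zero_iff, dite_eq_ite]

/-- If `r` is a projection and `1` is a sum of `N` conjugates of `r`, then `r` has trace at least
`1 / N`. In the `N × N` matrices, the corner projection `1` is equivalent to a subprojection of
`diag (r, …, r)`. -/
lemma NormalizedQuasitrace.one_le_card_mul (τ : NormalizedQuasitrace C) {r : C}
    (hr : IsStarProjection r) {N : ℕ} (v : Fin N → C) (h : ∑ i, v i * r * star (v i) = 1) :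
    1 ≤ (N : ℝ) * (τ.toFun 1 (matrixOne r)).re := by
  classical
  have hrr : r * r = r := hr.isIdempotentElem
  have hrs : star r = r := hr.isSelfAdjoint
  cases N with
  | zero =>
    exfalso
    rw [Fin.sum_univ_zero] at h
    have h1 : (1 : CStarMatrix (Fin 1) (Fin 1) C) = 0 := by
      rw [← map_one (matrixOne (C := C)), ← h, _root_.map_zero]
    have h2 := τ.normalized
    rw [h1, (τ.isQuasitrace 1).map_zero] at h2
    exact zero_ne_one h2
  | succ n =>
    have hτ := τ.isQuasitrace (n + 1)
    -- with `V` the row of the `v j * r` and `R = diag (r, …, r)`, the corner projection `1` is `V *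
    -- star V`, and `V * R = V`; the `s k` exhibit `R` as a sum of orthogonal copies of `r`
    obtain ⟨V, hV⟩ : ∃ V : CStarMatrix (Fin (n + 1)) (Fin (n + 1)) C,
        ∀ i j, V i j = if i = 0 then v j * r else 0 := ⟨fun i j => _, fun i j => rfl⟩
    obtain ⟨s, hs⟩ : ∃ s : Fin (n + 1) → CStarMatrix (Fin (n + 1)) (Fin (n + 1)) C,
        ∀ k i j, s k i j = if i = 0 ∧ j = k then r else 0 :=
      ⟨fun k i j => _, fun k i j => rfl⟩
    obtain ⟨R, hR⟩ : ∃ R : CStarMatrix (Fin (n + 1)) (Fin (n + 1)) C,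
        ∀ i j, R i j = if i = j then r else 0 := ⟨fun i j => _, fun i j => rfl⟩
    have hs1 : ∀ k, s k * star (s k) = cornerEmbedding (n + 1) (matrixOne r) := by
      intro k
      ext i j
      rw [cornerEmbedding_matrixOne, CStarMatrix.mul_apply]
      simp only [CStarMatrix.star_apply, hs]
      by_cases hi : i = 0
      · by_cases hj : j = 0
        · simp [hi, hj, hrr, hrs]
        · simp [hj]
      · simp [hi]
    have hs2 : ∀ k l, k ≠ l → s k * star (s l) = 0 := by
      intro k l hkl
      ext i j
      rw [CStarMatrix.mul_apply]
      simp only [CStarMatrix.star_apply, hs]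
      refine Finset.sum_eq_zero fun m _ => ?_
      by_cases hk : m = k
      · have : m ≠ l := fun h => hkl (hk.symm.trans h)
        simp [this]
      · simp [hk]
    have hs3 : ∑ k, star (s k) * s k = R := by
      have h1 : ∀ k i j, (star (s k) * s k) i j = if i = k ∧ j = k then r else 0 := by
        intro k i j
        rw [CStarMatrix.mul_apply]
        simp only [CStarMatrix.star_apply, hs]
        rw [Finset.sum_eq_single 0 (fun m _ hm => by simp [hm]) (by simp)]
        by_cases hi : i = k <;> by_cases hj : j = k <;> simp [hi, hj, hrr, hrs]
      have h2 : ∀ (t : Finset (Fin (n + 1))) (i j : Fin (n + 1)),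
          (∑ k ∈ t, star (s k) * s k) i j = ∑ k ∈ t, (star (s k) * s k) i j := by
        intro t i j
        induction t using Finset.induction_on with
        | empty => rfl
        | insert a t ha ih =>
          rw [Finset.sum_insert ha, Finset.sum_insert ha, CStarMatrix.add_apply, ih]
      ext i j
      rw [h2, hR]
      simp only [h1]
      by_cases hij : i = j
      · subst hij; simp
      · have : ∀ k, ¬ (i = k ∧ j = k) := fun k hk => hij (hk.1.trans hk.2.symm)
        simp [hij, this]
    have hcorner : IsStarProjection (cornerEmbedding (n + 1) (matrixOne r)) := by
      rw [← hs1 0]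
      have h1 : IsStarProjection (star (star (s 0)) * star (s 0)) := by
        have e1 : star (s 0) * s 0 * (star (s 0) * s 0) = star (s 0) * s 0 := by
          have e2 : s 0 * star (s 0) * s 0 = s 0 := by
            rw [hs1]
            ext i j
            rw [CStarMatrix.mul_apply]
            simp only [cornerEmbedding_matrixOne, hs]
            by_cases hi : i = 0
            · by_cases hj : j = 0
              · simp [hi, hj, hrr]
              · simp [hj]
            · simp [hi]
          rw [mul_assoc, ← mul_assoc (s 0), e2]
        exact isStarProjection_star_mul_self (s := star (s 0))
          ⟨e1, IsSelfAdjoint.star_mul_self _⟩ (by rw [star_star])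
      rwa [star_star] at h1
    have hsp := fun k => isStarProjection_star_mul_self hcorner (hs1 k)
    obtain ⟨h2, h3⟩ := hτ.map_sum_of_orthogonal Finset.univ hsp fun i j hij => by
      rw [mul_assoc, ← mul_assoc (s i), hs2 i j hij, zero_mul, mul_zero]
    have h4 : ∀ i, τ.toFun (n + 1) (star (s i) * s i) = τ.toFun 1 (matrixOne r) := fun i => by
      rw [hτ.trace, hs1, τ.map_corner 1 (n + 1) (Nat.le_add_left 1 n)]
    rw [hs3] at h2 h3
    simp only [h4, Finset.sum_const, Finset.card_univ, nsmul_eq_mul, Fintype.card_fin] at h2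
    have hV1 : V * star V = cornerEmbedding (n + 1) (matrixOne 1) := by
      ext i j
      rw [cornerEmbedding_matrixOne, CStarMatrix.mul_apply]
      simp only [CStarMatrix.star_apply, hV]
      by_cases hi : i = 0
      · by_cases hj : j = 0
        · simp only [hi, hj, if_true, and_self, star_mul, hrs]
          rw [← h]
          refine Finset.sum_congr rfl fun k _ => ?_
          rw [mul_assoc, ← mul_assoc r, hrr, mul_assoc]
        · simp [hj]
      · simp [hi]
    have hVR : V * R = V := by
      ext i j
      rw [CStarMatrix.mul_apply]
      simp only [hR, hV]
      by_cases hi : i = 0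
      · simp [hi, mul_assoc, hrr]
      · simp [hi]
    have hone : IsStarProjection (cornerEmbedding (n + 1) (matrixOne (1 : C))) := by
      refine ⟨?_, ?_⟩
      · change _ * _ = _
        ext i j
        rw [CStarMatrix.mul_apply]
        simp only [cornerEmbedding_matrixOne]
        by_cases hi : i = 0 <;> by_cases hj : j = 0 <;> simp [hi, hj]
      · rw [← hV1]; exact IsSelfAdjoint.mul_star_self V
    have hVp := isStarProjection_star_mul_self hone hV1
    have h5 := hτ.re_le_of_mul_eq hVp h3 (by
      rw [← h3.isSelfAdjoint.star_eq, ← mul_assoc, ← star_mul, hVR])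
    rw [hτ.trace, hV1, τ.map_corner 1 (n + 1) (Nat.le_add_left 1 n), map_one, τ.normalized, h2]
      at h5
    simpa using h5

end Quasitrace

/-! ### Comparison in the fixed point algebra of a finite group action -/

section FiniteGroup

variable {C H : Type*} [CStarAlgebra C] [Group H] (β : H →* (C ≃⋆ₐ[ℂ] C))

lemma conj_ne_zero_of_mul_ne_zero {x w : C} (hx : 0 ≤ x) (h : w * x ≠ 0) :
    w * x * star w ≠ 0 := by
  intro h0
  have h1 : w * CFC.sqrt x = 0 := by
    refine (CStarRing.mul_star_self_eq_zero_iff _).mp ?_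
    rw [star_mul, (IsSelfAdjoint.of_nonneg (CFC.sqrt_nonneg x)).star_eq, ← mul_assoc, mul_assoc w,
      CFC.sqrt_mul_sqrt_self x hx, h0]
  exact h (by rw [← CFC.sqrt_mul_sqrt_self x hx, ← mul_assoc, h1, zero_mul])

/-- `a` is dominated by a conjugate of `b`, by an element which is fixed by the action. -/
def DominatedIn (a b : C) : Prop := ∃ t, (∀ h, β h t = t) ∧ a ≤ t * b * star t

variable {β}

lemma DominatedIn.trans {a b c : C} (h : DominatedIn β a b) (h' : DominatedIn β b c) :
    DominatedIn β a c := by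
  obtain ⟨t, htf, ht⟩ := h
  obtain ⟨s, hsf, hs⟩ := h'
  refine ⟨t * s, fun h => by rw [map_mul, htf, hsf],
    ht.trans ((star_right_conjugate_le_conjugate hs t).trans_eq ?_)⟩
  simp only [star_mul, mul_assoc]

lemma DominatedIn.of_smul {a b : C} {r : ℝ} (hr : 0 < r) (h : DominatedIn β (r • a) b) :
    DominatedIn β a b := by
  obtain ⟨t, htf, ht⟩ := h
  refine ⟨((√r⁻¹ : ℝ) : ℂ) • t, fun h => by rw [map_smul, htf], ?_⟩
  have h1 := smul_le_smul_of_nonneg_left ht (inv_nonneg.mpr hr.le)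
  rw [smul_smul, inv_mul_cancel₀ hr.ne', one_smul] at h1
  refine h1.trans_eq ?_
  rw [Complex.coe_smul, star_smul, star_trivial (√r⁻¹), smul_mul_assoc, smul_mul_assoc, mul_smul_comm,
    smul_smul, Real.mul_self_sqrt (inv_nonneg.mpr hr.le)]

variable [Fintype H]

/-- If `q` is fixed and dominated by the cube of an element `d` whose translates are orthogonal,
then averaging over the group yields a domination in the fixed point algebra: with `v` the given
conjugating element, the sum of the translates of `v * d` is fixed, and by orthogonality no cross
terms appear. -/
lemma dominatedIn_sum_of_le_cube {q v d : C} (hq0 : 0 ≤ q) (hq : ∀ h, β h q = q)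
    (hd : IsSelfAdjoint d) (horth : ∀ h, h ≠ 1 → d * β h d = 0)
    (h : q ≤ v * (d * d * d) * star v) : DominatedIn β q (∑ h, β h d) := by
  classical
  have horth' : ∀ g h, g ≠ h → β g d * β h d = 0 := by
    intro g h hgh
    have h1 := horth (g⁻¹ * h) (fun h0 => hgh (inv_mul_eq_one.mp h0))
    have h2 := congrArg (β g) h1
    rw [map_mul, map_zero, map_mul] at h2
    have h3 : β g ((β g⁻¹ * β h) d) = β h d := by
      change (β g * (β g⁻¹ * β h)) d = _
      rw [← map_mul, ← map_mul, mul_inv_cancel_left]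
    rwa [h3] at h2
  have hdsa : ∀ h, star (β h d) = β h d := fun h => (hd.map (β h)).star_eq
  refine ⟨∑ h, β h (v * d), fun g => ?_, ?_⟩
  · rw [map_sum]
    refine Fintype.sum_equiv (Equiv.mulLeft g) _ _ fun h => ?_
    change _ = β (g * h) _
    rw [map_mul β]; rfl
  · have h1 : q ≤ ∑ h, β h q := by
      simp only [hq]
      exact Finset.single_le_sum (f := fun _ : H => q) (fun _ _ => hq0) (Finset.mem_univ 1)
    have h2 : ∑ h, β h q ≤ ∑ h, β h (v * (d * d * d) * star v) :=
      Finset.sum_le_sum fun g _ => OrderHomClass.mono (β g) h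
    refine (h1.trans h2).trans_eq ?_
    rw [star_sum, Finset.sum_mul, Finset.sum_mul]
    refine Finset.sum_congr rfl fun g _ => ?_
    have h3 : β g (v * d) * ∑ h, β h d = β g (v * d) * β g d := by
      rw [Finset.mul_sum, Finset.sum_eq_single g (fun h _ hh => by
        rw [map_mul, mul_assoc, horth' g h hh.symm, mul_zero])
        (fun h => absurd (Finset.mem_univ g) h)]
    rw [h3, Finset.mul_sum, Finset.sum_eq_single g (fun h _ hh => by
        rw [map_mul, map_mul, star_mul, hdsa, mul_assoc, ← mul_assoc (β g d),
          horth' g h hh.symm, zero_mul, mul_zero])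
        (fun h => absurd (Finset.mem_univ g) h)]
    simp only [map_mul, map_star, star_mul, hdsa, mul_assoc]

variable (β) in
/-- The Rokhlin property used for finite stages of the tensor product: there are exact Rokhlin
families which are approximately central, whose defect is dominated by a prescribed element `z`,
and whose sum does not make `y` small, with a bound that depends on `y` only. -/
def HasExactRokhlin : Prop :=
  ∀ y : C, 0 ≤ y → y ≠ 0 → ∃ δ : ℝ, 0 < δ ∧ ∀ (F : Finset C) (ε : ℝ), 0 < ε →
    ∀ z : C, 0 ≤ z → z ≠ 0 → ∃ f, IsRokhlinFamily β f ∧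
      (∀ h, ∀ a ∈ F, ‖f h * a - a * f h‖ < ε) ∧ Dominated (1 - ∑ h, f h) z ∧
      δ ≤ ‖(∑ h, f h) * y * (∑ h, f h)‖

namespace IsRokhlinFamily

variable {f : H → C} (hf : IsRokhlinFamily β f)
include hf

lemma norm_sum_conj_sub_le {y : C} {ε : ℝ} (hε : 0 ≤ ε)
    (h : ∀ g, ‖f g * y - y * f g‖ ≤ ε) :
    ‖∑ g, f g * y * f g - (∑ g, f g) * y * (∑ g, f g)‖
      ≤ (Fintype.card H : ℝ) * Fintype.card H * ε := by
  classical
  have h1 : ∑ g, f g * y * f g - (∑ g, f g) * y * (∑ g, f g)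
      = ∑ g, ∑ k, if g = k then 0 else -(f g * y * f k) := by
    have e1 : ∑ g, f g * y * f g = ∑ g, ∑ k, if g = k then f g * y * f k else 0 := by
      simp only [Finset.sum_ite_eq, Finset.mem_univ, if_true]
    have e2 : (∑ g, f g) * y * (∑ g, f g) = ∑ g, ∑ k, f g * y * f k := by
      rw [Finset.sum_mul, Finset.sum_mul_sum]
    rw [e1, e2, ← Finset.sum_sub_distrib]
    refine Finset.sum_congr rfl fun g _ => ?_
    rw [← Finset.sum_sub_distrib]
    refine Finset.sum_congr rfl fun k _ => ?_
    by_cases hgk : g = k <;> simp [hgk]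
  rw [h1]
  calc _ ≤ ∑ _g : H, ∑ _k : H, ε := norm_sum_le_of_le _ fun g _ => norm_sum_le_of_le _ fun k _ => by
        by_cases hgk : g = k
        · simp [hgk, hε]
        · have e1 : f g * y * f k = (f g * y - y * f g) * f k := by
            rw [sub_mul, mul_assoc y, hf.orth g k hgk, mul_zero, sub_zero]
          rw [if_neg hgk, norm_neg, e1]
          refine (norm_mul_le _ _).trans ?_
          have := h g
          calc _ ≤ ε * 1 := by
                have := (hf.proj k).norm_le
                gcongr
            _ = ε := mul_one ε
    _ = _ := by simp [mul_assoc]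

lemma mul_sum_conj (y : C) (g : H) : f g * ∑ k, f k * y * f k = f g * y * f g := by
  classical
  rw [Finset.mul_sum, Finset.sum_eq_single g (fun k _ hk => by
    rw [mul_assoc (f k), ← mul_assoc (f g), hf.orth g k hk.symm, zero_mul])
    (fun h => absurd (Finset.mem_univ g) h), mul_assoc (f g), ← mul_assoc (f g) (f g),
    (hf.proj g).isIdempotentElem.eq]

lemma sum_conj_mul (y : C) (g : H) : (∑ k, f k * y * f k) * f g = f g * y * f g := by
  classical
  rw [Finset.sum_mul, Finset.sum_eq_single g (fun k _ hk => by
    rw [mul_assoc, hf.orth k g hk, mul_zero])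
    (fun h => absurd (Finset.mem_univ g) h), mul_assoc (f g * y),
    (hf.proj g).isIdempotentElem.eq]

lemma commute_sum_conj (y : C) (g : H) : Commute (∑ k, f k * y * f k) (f g) :=
  (hf.sum_conj_mul y g).trans (hf.mul_sum_conj y g).symm

lemma map_sum_conj {y : C} (hy : ∀ h, β h y = y) (g : H) :
    β g (∑ k, f k * y * f k) = ∑ k, f k * y * f k := by
  rw [_root_.map_sum]
  simp only [map_mul, hy, hf.equivariant]
  exact Fintype.sum_equiv (Equiv.mulLeft g) _ _ fun h => rfl

lemma isSelfAdjoint_sum_conj {y : C} (hy : IsSelfAdjoint y) :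
    IsSelfAdjoint (∑ k, f k * y * f k) :=
  isSelfAdjoint_sum _ fun k _ => by
    have := hy.conjugate (f k)
    rwa [(hf.proj k).isSelfAdjoint.star_eq] at this

/-- Each translate of `f 1 * D`, where `D` is fixed and commutes with the family, is orthogonal
to it, and the translates sum up to `(∑ h, f h) * D`. -/
lemma orthogonal_translates {D : C} (hD : ∀ h, β h D = D) (hc : ∀ h, Commute D (f h)) :
    (∀ h, h ≠ 1 → f 1 * D * β h (f 1 * D) = 0) ∧
      ∑ h, β h (f 1 * D) = (∑ h, f h) * D := by
  refine ⟨fun h hh => ?_, ?_⟩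
  · rw [map_mul, hD, hf.equivariant, mul_one, mul_assoc, ← mul_assoc D, (hc h).eq,
      mul_assoc (f h), ← mul_assoc, hf.orth 1 h hh.symm, zero_mul]
  · simp only [map_mul, hD, hf.equivariant, mul_one]
    rw [Finset.sum_mul]

end IsRokhlinFamily

/-- Smallness in `C` is enough for domination in the fixed point algebra: there is a test element
such that every fixed projection dominated by it is dominated by `x`, and dominated by the fixed
element `y` within the fixed point algebra. -/
lemma HasExactRokhlin.exists_test (hβ : HasExactRokhlin β)
    (hfull : ∀ x : C, 0 ≤ x → x ≠ 0 → IsFullElement x) {x y : C} (hx : 0 ≤ x) (hx0 : x ≠ 0)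
    (hy : 0 ≤ y) (hy0 : y ≠ 0) (hyf : ∀ h, β h y = y) :
    ∃ z : C, 0 ≤ z ∧ z ≠ 0 ∧ ∀ q, IsStarProjection q → (∀ h, β h q = q) → Dominated q z →
      Dominated q x ∧ DominatedIn β q y := by
  have : Nontrivial C := ⟨y, 0, hy0⟩
  obtain ⟨δ, hδ, hβy⟩ := hβ y hy hy0
  obtain ⟨N, hN⟩ : ∃ N : ℝ, N = Fintype.card H := ⟨_, rfl⟩
  have hN1 : 1 ≤ N := by rw [hN]; exact_mod_cast Fintype.card_pos
  obtain ⟨f, hf, hfc, -, hfn⟩ := hβy {y} (δ / (4 * (N * N))) (by positivity) 1 zero_le_one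
    one_ne_zero
  have hysa := IsSelfAdjoint.of_nonneg hy
  -- the sum of the compressions `f k * y * f k` is fixed, commutes with the family and is close to
  -- the compression of `y` by the sum `P` of the family
  have hnear := hf.norm_sum_conj_sub_le (ε := δ / (4 * (N * N))) (by positivity)
    fun g => (hfc g y (Finset.mem_singleton_self y)).le
  rw [← hN, show N * N * (δ / (4 * (N * N))) = δ / 4 by field_simp] at hnear
  have hasa := hf.isSelfAdjoint_sum_conj hysa
  have hac := hf.commute_sum_conj y
  have haf := hf.map_sum_conj hyf
  obtain ⟨a, ha⟩ : ∃ a, a = ∑ k, f k * y * f k := ⟨_, rfl⟩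
  have hPp := hf.isStarProjection_sum
  have hPf := hf.map_sum
  obtain ⟨P, hP⟩ : ∃ P, P = ∑ k, f k := ⟨_, rfl⟩
  rw [← ha, ← hP] at hnear
  rw [← ha] at hasa
  rw [← hP] at hPp hPf hfn
  simp only [← ha] at hac haf
  have hPyP : 0 ≤ P * y * P := hPp.isSelfAdjoint.conjugate_nonneg hy
  -- the cut-down `g` is nonzero since the compression of `y` by `P` has norm at least `δ`
  have hg0 := cutDown_ne_zero_of_norm_lt hasa hPyP hnear (by linarith)
  have hgle := cutDown_cube_le hasa (IsSelfAdjoint.of_nonneg hPyP) hnear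
  have hgf : ∀ h, β h (cutDown (δ / 4) a) = cutDown (δ / 4) a := fun h => by
    rw [map_cutDown (β h) hasa, haf]
  have hgc : ∀ h, Commute (cutDown (δ / 4) a) (f h) := fun h => (hac h).cutDown
  have hgn : 0 ≤ cutDown (δ / 4) a := cutDown_nonneg
  obtain ⟨g, hg⟩ : ∃ g, g = cutDown (δ / 4) a := ⟨_, rfl⟩
  simp only [← hg] at hg0 hgle hgf hgc hgn
  have hgP : Commute g P := by
    rw [hP]; exact Commute.sum_right _ _ _ fun h _ => hgc h
  have hgsa := IsSelfAdjoint.of_nonneg hgn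
  obtain ⟨D, hD⟩ : ∃ D, D = g * g * g := ⟨_, rfl⟩
  have hD0 : 0 ≤ D := by rw [hD]; exact cube_nonneg hgn
  have hDf : ∀ h, β h D = D := fun h => by rw [hD, map_mul, map_mul, hgf]
  have hDc : ∀ h, Commute D (f h) := fun h => by
    rw [hD]; exact ((hgc h).mul_left (hgc h)).mul_left (hgc h)
  have hPD : P * D ≠ 0 := by
    intro h0
    have h1 : P * g = 0 := by
      refine cube_eq_zero_of_nonneg (Commute.mul_nonneg hPp.nonneg hgn hgP.symm) ?_
      have e1 : ∀ k : C, Commute k P → P * k * (P * g) = P * (k * g) := fun k hk => by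
        rw [mul_assoc P k, ← mul_assoc k P, hk.eq, mul_assoc P k, ← mul_assoc P P,
          hPp.isIdempotentElem.eq]
      rw [e1 g hgP, e1 (g * g) (hgP.mul_left hgP), ← hD, h0]
    have h2 : g * (P * y * P) * g = 0 := by
      rw [show g * (P * y * P) * g = g * P * y * (P * g) by simp only [mul_assoc], h1, mul_zero]
    rw [h2] at hgle
    exact hg0 (cube_eq_zero_of_nonneg hgn (le_antisymm hgle (cube_nonneg hgn)))
  -- the translates of `d` are orthogonal, with sum `P * D`
  obtain ⟨horth, hsum⟩ := hf.orthogonal_translates hDf hDc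
  have hdn : 0 ≤ f 1 * D := Commute.mul_nonneg (hf.proj 1).nonneg hD0 (hDc 1).symm
  obtain ⟨d, hd⟩ : ∃ d, d = f 1 * D := ⟨_, rfl⟩
  rw [← hd, ← hP] at hsum
  simp only [← hd] at horth hdn
  have hd0 : d ≠ 0 := by
    intro h0
    rw [h0] at hsum
    simp only [map_zero, Finset.sum_const_zero] at hsum
    exact hPD hsum.symm
  have hdsa := IsSelfAdjoint.of_nonneg hdn
  obtain ⟨u, hu⟩ : ∃ u, u = d * d * d := ⟨_, rfl⟩
  have hun : 0 ≤ u := by rw [hu]; exact cube_nonneg hdn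
  have husa := IsSelfAdjoint.of_nonneg hun
  have hu0 : u ≠ 0 := fun h => hd0 (cube_eq_zero_of_nonneg hdn (hu ▸ h))
  obtain ⟨b, hb⟩ := (hfull x hx hx0).exists_mul_mul_ne_zero hu0
  -- the test element is dominated by `x` and by `u = d * d * d`, and the sum `P * D` of the
  -- translates of `d` is dominated by `y`
  refine ⟨u * b * x * star (u * b), star_right_conjugate_nonneg hx _,
    conj_ne_zero_of_mul_ne_zero hx hb, fun q hq hqf hqz => ⟨hqz.trans (dominated_conj _ _), ?_⟩⟩
  have h1 : u * b * x * star (u * b) = u * (b * x * star b) * u := by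
    rw [star_mul, husa.star_eq]; simp only [mul_assoc]
  rw [h1] at hqz
  obtain ⟨v, hv⟩ := hqz.trans (dominated_mul_mul_of_le husa (star_right_conjugate_nonneg hx b) hun)
  rw [hu] at hv
  have h2 := dominatedIn_sum_of_le_cube hq.nonneg hqf hdsa horth hv
  rw [hsum] at h2
  refine h2.trans ⟨P * g * P, fun h => by rw [map_mul, map_mul, hPf, hgf], ?_⟩
  have h3 := hPp.isSelfAdjoint.conjugate_le_conjugate hgle
  have hDP : Commute D P := by
    rw [hD]; exact (hgP.mul_left hgP).mul_left hgP
  rw [← hD, mul_assoc, hDP.eq, ← mul_assoc, hPp.isIdempotentElem.eq] at h3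
  refine h3.trans_eq ?_
  rw [star_mul, star_mul, hPp.isSelfAdjoint.star_eq, hgsa.star_eq]
  simp only [mul_assoc]

end FiniteGroup

/-! ### Strict comparison and the defect of a Rokhlin family -/

section StrictComparison

lemma IsQuasitrace.comp_starAlgEquiv {C C' : Type*} [CStarAlgebra C] [CStarAlgebra C']
    {τ : C' → ℂ} (hτ : IsQuasitrace τ) (θ : C ≃⋆ₐ[ℂ] C') : IsQuasitrace fun a => τ (θ a) where
  nonneg x := by simpa only [map_mul, map_star] using hτ.nonneg (θ x)
  trace x := by simpa only [map_mul, map_star] using hτ.trace (θ x)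
  map_add_I_smul a b ha hb := by
    simpa only [map_add, map_smul] using hτ.map_add_I_smul (θ a) (θ b) (ha.map θ) (hb.map θ)
  linear D hD hcomm x hx y hy c d := by
    let D' : NonUnitalStarSubalgebra ℂ C' := D.comap (θ.symm : C' →⋆ₐ[ℂ] C)
    have hD' : IsClosed (D' : Set C') :=
      hD.preimage (f := θ.symm) (StarAlgEquiv.isometry θ.symm).continuous
    have hmem : ∀ z ∈ D, θ z ∈ D' := fun z hz => by
      change θ.symm (θ z) ∈ D
      rwa [StarAlgEquiv.symm_apply_apply]
    have hcomm' : ∀ x ∈ D', ∀ y ∈ D', x * y = y * x := fun x hx y hy =>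
      θ.symm.injective (by
        rw [map_mul, map_mul]
        exact hcomm _ hx _ hy)
    simpa only [map_add, map_smul] using
      hτ.linear D' hD' hcomm' (θ x) (hmem x hx) (θ y) (hmem y hy) c d

lemma CuntzSubeq.map {C C' : Type*} [CStarAlgebra C] [CStarAlgebra C'] {a b : C}
    (h : CuntzSubeq a b) (θ : C ≃⋆ₐ[ℂ] C') : CuntzSubeq (θ a) (θ b) := by
  have h1 := image_closure_subset_closure_image
    (StarAlgEquiv.isometry θ).continuous ⟨a, h, rfl⟩
  refine closure_mono ?_ h1
  rintro _ ⟨_, ⟨v, rfl⟩, rfl⟩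
  exact ⟨θ v, by simp only [map_mul, map_star]⟩

variable {C : Type*} [CStarAlgebra C]

/-- Under strict comparison, a projection `q` is equivalent to a subprojection of `r` if it has many
orthogonal copies, while a projection `e = r + s` with `s` dominated by `q` is full. -/
lemma HasStrictComparison.exists_eq (hC : HasStrictComparison C) {q r s w : C}
    (hq : IsStarProjection q) (hr : IsStarProjection r) (hs : IsStarProjection s)
    (hrs : r * s = 0) (hw : w * q * star w = s) {N : ℕ} (v : Fin N → C)
    (hv : ∑ i, v i * (r + s) * star (v i) = 1) {t : Fin (2 * N + 1) → C}
    (ht : ∀ i, t i * star (t i) = q) (horth : ∀ i j, i ≠ j → t i * star (t j) = 0) :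
    ∃ u, u * r * star u = q := by
  have hsr : s * r = 0 := by
    have := congrArg star hrs
    rwa [star_mul, hr.isSelfAdjoint.star_eq, hs.isSelfAdjoint.star_eq, star_zero] at this
  have hrsp : IsStarProjection (r + s) := by
    refine ⟨?_, hr.isSelfAdjoint.add hs.isSelfAdjoint⟩
    change (r + s) * (r + s) = r + s
    rw [add_mul, mul_add, mul_add, hrs, hsr, hr.isIdempotentElem.eq, hs.isIdempotentElem.eq,
      add_zero, zero_add]
  have hlt : ∀ τ : NormalizedQuasitrace C,
      dimensionFunction τ (matrixOne q) < dimensionFunction τ (matrixOne r) := by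
    intro τ
    rw [dimensionFunction_of_isStarProjection τ (hq.map matrixOne),
      dimensionFunction_of_isStarProjection τ (hr.map matrixOne)]
    have hτ := (τ.isQuasitrace 1).comp_starAlgEquiv (matrixOne (C := C))
    have h1 := τ.one_le_card_mul hrsp v hv
    have h2 := hτ.card_mul_re_le hq ht horth
    have h3 := hτ.map_add_of_commute hr.isSelfAdjoint hs.isSelfAdjoint (hrs.trans hsr.symm)
    have hW : w * q * star (w * q) = s := by
      rw [star_mul, hq.isSelfAdjoint.star_eq, ← mul_assoc, mul_assoc w, hq.isIdempotentElem.eq, hw]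
    have hWp := isStarProjection_star_mul_self hs hW
    have h4 := hτ.re_le_of_mul_eq hWp hq (by
      have e1 : q * star (w * q) = star (w * q) := by
        rw [star_mul, hq.isSelfAdjoint.star_eq, ← mul_assoc, hq.isIdempotentElem.eq]
      rw [← mul_assoc, e1])
    have h5 := hτ.trace (w * q)
    have h6 := hτ.re_nonneg_of_isStarProjection hq
    beta_reduce at h2 h3 h4 h5 h6
    rw [hW] at h5
    rw [h5] at h4
    rw [h3, Complex.add_re] at h1
    rw [map_one, τ.normalized, Fintype.card_fin, Complex.one_re] at h2
    push_cast at h2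
    obtain ⟨Q, hQ⟩ : ∃ Q, Q = (τ.toFun 1 (matrixOne q)).re := ⟨_, rfl⟩
    obtain ⟨R, hR⟩ : ∃ R, R = (τ.toFun 1 (matrixOne r)).re := ⟨_, rfl⟩
    obtain ⟨S, hS⟩ : ∃ S, S = (τ.toFun 1 (matrixOne s)).re := ⟨_, rfl⟩
    rw [← hQ] at h2 h4 h6 ⊢
    rw [← hR] at h1 ⊢
    rw [← hS] at h1 h4
    -- `S ≤ Q`, `(2 * N + 1) * Q ≤ 1` and `1 ≤ N * (R + S)`, so that `R ≤ Q` would imply `(2 * N +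
    -- 1) * Q ≤ 2 * N * Q`, hence `Q = 0`, and then `1 ≤ 0`
    by_contra! h7
    have hN : (0 : ℝ) ≤ N := Nat.cast_nonneg N
    have h8 : (N : ℝ) * (R + S) ≤ N * (Q + Q) := by gcongr
    have h9 : Q = 0 := le_antisymm (by linarith) h6
    rw [h9] at h8
    linarith
  have h1 := hC 1 _ _ (hq.map matrixOne).nonneg (hr.map matrixOne).nonneg hlt
  have h2 := h1.map (matrixOne (C := C)).symm
  rw [StarAlgEquiv.symm_apply_apply, StarAlgEquiv.symm_apply_apply] at h2
  exact h2.exists_eq_of_isStarProjection hq hr.isSelfAdjoint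

end StrictComparison

section FiniteGroup

variable {C H : Type*} [CStarAlgebra C] [Group H] [Fintype H] {β : H →* (C ≃⋆ₐ[ℂ] C)}

/-- Given strict comparison, the defect of a Rokhlin family can be made small enough to be
dominated by the sum of the family within the fixed point algebra. The comparison in `C` is made
with one of the projections of another Rokhlin family, cut down to be orthogonal to the defect. -/
lemma HasExactRokhlin.exists_isRokhlinFamily_dominatedIn_sum (hβ : HasExactRokhlin β)
    (hfull : ∀ x : C, 0 ≤ x → x ≠ 0 → IsFullElement x) (hinf : ¬ FiniteDimensional ℂ C)
    (hC : HasStrictComparison C) (F : Finset C) {ε : ℝ} (hε : 0 < ε) {z : C} (hz : 0 ≤ z)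
    (hz0 : z ≠ 0) :
    ∃ e, IsRokhlinFamily β e ∧ (∀ h, ∀ a ∈ F, ‖e h * a - a * e h‖ < ε) ∧
      Dominated (1 - ∑ h, e h) z ∧ DominatedIn β (1 - ∑ h, e h) (∑ h, e h) := by
  classical
  have : Nontrivial C := ⟨z, 0, hz0⟩
  obtain ⟨δ, hδ, hβ1⟩ := hβ 1 zero_le_one one_ne_zero
  obtain ⟨N, hN⟩ : ∃ N : ℝ, N = Fintype.card H := ⟨_, rfl⟩
  have hN1 : 1 ≤ N := by rw [hN]; exact_mod_cast Fintype.card_pos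
  obtain ⟨f, hf, -, -, hfn⟩ := hβ1 ∅ 1 one_pos 1 zero_le_one one_ne_zero
  have hf1 : f 1 ≠ 0 := by
    intro h0
    have h1 : ∀ h, f h = 0 := fun h => by
      have := hf.equivariant h 1
      rw [h0, map_zero, mul_one] at this
      exact this.symm
    simp only [h1, Finset.sum_const_zero, zero_mul, norm_zero] at hfn
    linarith
  obtain ⟨I, hI, v, hv⟩ := hfull (f 1) (hf.proj 1).nonneg hf1
  have hv' : ∑ i, v ((Fintype.equivFin I).symm i) * f 1 * star (v ((Fintype.equivFin I).symm i))
      = 1 := by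
    rw [← hv]
    exact Fintype.sum_equiv (Fintype.equivFin I).symm _ _ fun i => rfl
  -- a defect dominated by `Z` has `2 * N + 1` orthogonal copies, where `N` is the number of
  -- conjugates of `f 1` that sum up to `1`
  obtain ⟨zz, Z, hZ, hZ0, hzz, hZz⟩ := exists_orthogonal_copies hfull hinf
    (Fin (2 * Fintype.card I + 1)) hz hz0
  obtain ⟨κ, hκ, hκN⟩ : ∃ κ : ℝ, 0 < κ ∧ N * N * (N * κ) = 1 / 16 :=
    ⟨1 / (16 * (N * N * N)), by positivity, by field_simp⟩
  have hκN' : N * (N * κ) ≤ 1 / 16 := by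
    rw [← hκN, mul_assoc N N]
    exact le_mul_of_one_le_left (by positivity) hN1
  obtain ⟨e, he, hec, heZ, -⟩ := hβ1 (F ∪ Finset.univ.image f) (min ε κ) (lt_min hε hκ) Z hZ hZ0
  refine ⟨e, he, fun h a ha => (hec h a (Finset.mem_union_left _ ha)).trans_le (min_le_left _ _),
    heZ.trans ((Dominated.of_le (hZz 0)).trans (dominated_conj _ _)), ?_⟩
  have hpp := he.isStarProjection_sum
  have hpf := he.map_sum
  have hfp : ∀ h, ‖f h * (∑ g, e g) - (∑ g, e g) * f h‖ ≤ N * κ := by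
    intro h
    rw [Finset.mul_sum, Finset.sum_mul, ← Finset.sum_sub_distrib]
    refine (norm_sum_le_of_le _ (fun g _ => (norm_sub_rev _ _).le.trans
      ((hec g (f h) (Finset.mem_union_right _ (Finset.mem_image_of_mem f
        (Finset.mem_univ h)))).le.trans (min_le_right _ _)))).trans_eq ?_
    rw [Finset.sum_const, nsmul_eq_mul, Finset.card_univ, hN]
  obtain ⟨p, hp⟩ : ∃ p, p = ∑ g, e g := ⟨_, rfl⟩
  rw [← hp] at hpp heZ ⊢
  simp only [← hp] at hpf hfp
  have hq := hpp.one_sub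
  have hqf : ∀ h, β h (1 - p) = 1 - p := fun h => by rw [map_sub, map_one, hpf]
  -- `a`, a compression of `p` that commutes with the family `f`, is nearly a projection
  have hnear := hf.norm_sum_conj_sub_le (ε := N * κ) (by positivity) hfp
  have hasa := hf.isSelfAdjoint_sum_conj hpp.isSelfAdjoint
  have hac := hf.commute_sum_conj p
  have haf := hf.map_sum_conj hpf
  have hma := hf.mul_sum_conj p
  have haa : ‖(∑ g, f g * p * f g) * (∑ g, f g * p * f g) - ∑ g, f g * p * f g‖ < 3 / 16 := by
    have e1 : (∑ g, f g * p * f g) * (∑ g, f g * p * f g) - ∑ g, f g * p * f g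
        = -∑ g, f g * (f g * p - p * f g) * p * f g := by
      rw [Finset.sum_mul, ← Finset.sum_sub_distrib, ← Finset.sum_neg_distrib]
      refine Finset.sum_congr rfl fun g _ => ?_
      rw [mul_assoc (f g * p), hma, mul_sub, ← mul_assoc (f g) (f g),
        (hf.proj g).isIdempotentElem.eq, sub_mul, sub_mul, neg_sub, mul_assoc (f g) p p,
        hpp.isIdempotentElem.eq]
      simp only [mul_assoc]
    rw [e1, norm_neg]
    have e2 : ‖∑ g, f g * (f g * p - p * f g) * p * f g‖ ≤ ∑ _g : H, N * κ :=
      norm_sum_le_of_le _ fun g _ => by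
        have h1 := (hf.proj g).norm_le
        have h2 := hpp.norm_le
        have h3 := hfp g
        calc _ ≤ ‖f g‖ * ‖f g * p - p * f g‖ * ‖p‖ * ‖f g‖ := by
              refine (norm_mul_le _ _).trans (mul_le_mul_of_nonneg_right ?_ (norm_nonneg _))
              refine (norm_mul_le _ _).trans (mul_le_mul_of_nonneg_right ?_ (norm_nonneg _))
              exact norm_mul_le _ _
          _ ≤ 1 * (N * κ) * 1 * 1 := by gcongr
          _ = N * κ := by ring
    rw [Finset.sum_const, nsmul_eq_mul, Finset.card_univ, ← hN] at e2
    linarith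
  rw [← hN, hκN] at hnear
  obtain ⟨a, ha⟩ : ∃ a, a = ∑ g, f g * p * f g := ⟨_, rfl⟩
  rw [← ha] at hnear hasa haa
  simp only [← ha] at hac haf hma
  have hPp := hf.isStarProjection_sum
  have hPf := hf.map_sum
  have hPf1 := hf.sum_mul
  obtain ⟨P, hP⟩ : ∃ P, P = ∑ g, f g := ⟨_, rfl⟩
  rw [← hP] at hnear hPp
  simp only [← hP] at hPf hPf1
  -- the spectral projection `R` of `a` is fixed, commutes with the family `f` and lies under `P`
  have hR := isStarProjection_gapProj hasa haa
  have hRc : ∀ h, Commute (gapProj a) (f h) := fun h => (hac h).gapProj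
  have hRf : ∀ h, β h (gapProj a) = gapProj a := fun h => by
    rw [map_gapProj (β h) hasa, haf]
  have hRle := half_smul_gapProj_le hasa haa
  have hRle' := conj_one_sub_gapProj_le hasa haa
  obtain ⟨R, hRdef⟩ : ∃ R, R = gapProj a := ⟨_, rfl⟩
  simp only [← hRdef] at hR hRc hRf hRle hRle'
  have hRP : Commute R P := by rw [hP]; exact Commute.sum_right _ _ _ fun h _ => hRc h
  have hPa : (1 - P) * a = 0 := by
    rw [ha, Finset.mul_sum]
    refine Finset.sum_eq_zero fun g _ => ?_
    rw [← mul_assoc, ← mul_assoc, sub_mul, one_mul, hPf1, sub_self, zero_mul, zero_mul]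
  have hPR : P * R = R := by
    have hc : Commute (1 - P) R := (Commute.one_left R).sub_left hRP.symm
    have h1 := hPp.one_sub.isSelfAdjoint.conjugate_le_conjugate hRle
    have h2 : (1 - P) * (R * a * R) * (1 - P) = 0 := by
      rw [← mul_assoc, ← mul_assoc, hc.eq, mul_assoc R, hPa, mul_zero, zero_mul, zero_mul]
    rw [h2, mul_smul_comm, smul_mul_assoc] at h1
    have h3 := smul_le_smul_of_nonneg_left h1 (zero_le_two (α := ℝ))
    rw [smul_smul, smul_zero, show (2 : ℝ) * (1 / 2) = 1 by norm_num, one_smul] at h3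
    have h4 : (1 - P) * R * star ((1 - P) * R) ≤ 0 := by
      rwa [star_mul, hR.isSelfAdjoint.star_eq, hPp.one_sub.isSelfAdjoint.star_eq, ← mul_assoc,
        mul_assoc (1 - P), hR.isIdempotentElem.eq]
    have h5 := eq_zero_of_mul_star_le_zero h4
    rw [sub_mul, one_mul, sub_eq_zero] at h5
    exact h5.symm
  have hf1p := hf.proj 1
  have hr1 : IsStarProjection (f 1 * R) := by
    refine ⟨?_, ?_⟩
    · change f 1 * R * (f 1 * R) = f 1 * R
      rw [mul_assoc, ← mul_assoc R, (hRc 1).eq, mul_assoc (f 1) R, hR.isIdempotentElem.eq,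
        ← mul_assoc, hf1p.isIdempotentElem.eq]
    · rw [IsSelfAdjoint, star_mul, hR.isSelfAdjoint.star_eq, hf1p.isSelfAdjoint.star_eq,
        (hRc 1).eq]
  have hsc : Commute (1 - R) (f 1) := (Commute.one_left _).sub_left (hRc 1)
  have hs : IsStarProjection (f 1 * (1 - R)) := by
    refine ⟨?_, ?_⟩
    · change f 1 * (1 - R) * (f 1 * (1 - R)) = f 1 * (1 - R)
      rw [mul_assoc, ← mul_assoc (1 - R), hsc.eq, mul_assoc (f 1) (1 - R),
        hR.one_sub.isIdempotentElem.eq, ← mul_assoc, hf1p.isIdempotentElem.eq]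
    · rw [IsSelfAdjoint, star_mul, hR.one_sub.isSelfAdjoint.star_eq, hf1p.isSelfAdjoint.star_eq,
        hsc.eq]
  have hrs : f 1 * R * (f 1 * (1 - R)) = 0 := by
    rw [mul_assoc, ← mul_assoc R, (hRc 1).eq, mul_assoc (f 1) R, mul_sub, mul_one,
      hR.isIdempotentElem.eq, sub_self, mul_zero, mul_zero]
  have hsum : f 1 * R + f 1 * (1 - R) = f 1 := by rw [← mul_add, add_sub_cancel, mul_one]
  -- the complementary part `s` of `f 1` is dominated by the defect `1 - p`
  obtain ⟨w, hw⟩ : ∃ w, w * (1 - p) * star w = f 1 * (1 - R) := by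
    refine ⟨_, projNormalizer_mul_mul_star hs one_half_pos ?_⟩
    have h1 : f 1 * (1 - R) * p * (f 1 * (1 - R)) ≤ (1 / 2 : ℝ) • (f 1 * (1 - R)) := by
      have h2 := hf1p.isSelfAdjoint.conjugate_le_conjugate hRle'
      have e1 : f 1 * (1 - R) * p * (f 1 * (1 - R))
          = f 1 * ((1 - R) * a * (1 - R)) * f 1 := by
        have e2 : f 1 * (1 - R) * p * (f 1 * (1 - R)) = (1 - R) * (f 1 * p * f 1) * (1 - R) := by
          rw [← hsc.eq]
          nth_rw 2 [hsc.eq]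
          simp only [mul_assoc]
        rw [e2, ← hma]
        symm
        calc f 1 * ((1 - R) * a * (1 - R)) * f 1
            = (f 1 * (1 - R)) * a * ((1 - R) * f 1) := by simp only [mul_assoc]
          _ = ((1 - R) * f 1) * a * (f 1 * (1 - R)) := by rw [← hsc.eq]
          _ = (1 - R) * (f 1 * (a * f 1)) * (1 - R) := by simp only [mul_assoc]
          _ = (1 - R) * (f 1 * a) * (1 - R) := by
            rw [(hac 1).eq, ← mul_assoc (f 1) (f 1), hf1p.isIdempotentElem.eq]
      have e3 : f 1 * (1 - R) * f 1 = f 1 * (1 - R) := by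
        rw [mul_assoc, hsc.eq, ← mul_assoc, hf1p.isIdempotentElem.eq]
      rw [mul_smul_comm, smul_mul_assoc, e3] at h2
      rw [e1]
      exact h2
    have h2 := hs.isIdempotentElem.eq
    obtain ⟨s, hsdef⟩ : ∃ s, s = f 1 * (1 - R) := ⟨_, rfl⟩
    rw [← hsdef] at h1 h2 ⊢
    rw [mul_sub, mul_one, sub_mul, h2, le_sub_iff_add_le]
    calc _ ≤ (1 / 2 : ℝ) • s + (1 / 2 : ℝ) • s := by gcongr
      _ = s := by rw [← add_smul]; norm_num
  -- orthogonal copies of the defect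
  obtain ⟨t, ht⟩ := heZ
  have hD : ∀ i, 1 - p ≤ t * zz i * z * star (t * zz i) := fun i => by
    refine ht.trans ((star_right_conjugate_le_conjugate (hZz i) t).trans_eq ?_)
    simp only [star_mul, mul_assoc]
  have hcopy := fun i => projNormalizer_mul_mul_star hq one_pos (smul_le_conj_of_le hq (hD i))
  obtain ⟨W, hW⟩ : ∃ W, W = fun i => projNormalizer (1 - p) (t * zz i * z * star (t * zz i)) :=
    ⟨_, rfl⟩
  have hcopy' : ∀ i, W i * (t * zz i * z * star (t * zz i)) * star (W i) = 1 - p := by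
    rw [hW]; exact hcopy
  have hsz := CFC.sqrt_mul_sqrt_self z hz
  have hszs := (IsSelfAdjoint.of_nonneg (CFC.sqrt_nonneg z)).star_eq
  have hform : ∀ i j, W i * (t * zz i) * CFC.sqrt z * star (W j * (t * zz j) * CFC.sqrt z)
      = W i * (t * (zz i * z * star (zz j)) * star t) * star (W j) := by
    intro i j
    have e1 : zz i * z * star (zz j) = zz i * (CFC.sqrt z * CFC.sqrt z) * star (zz j) := by
      rw [hsz]
    rw [e1]
    simp only [star_mul, hszs, mul_assoc]
  obtain ⟨u, hu⟩ := hC.exists_eq hq hr1 hs hrs hw _ (by rw [hsum]; exact hv')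
    (t := fun i => W i * (t * zz i) * CFC.sqrt z)
    (fun i => by rw [hform, ← hcopy' i]; simp only [star_mul, mul_assoc])
    (fun i j hij => by rw [hform, hzz i j hij, mul_zero, zero_mul, mul_zero, zero_mul])
  -- averaging
  obtain ⟨horth, hsumR⟩ := hf.orthogonal_translates hRf hRc
  have hcube : f 1 * R * (f 1 * R) * (f 1 * R) = f 1 * R := by
    rw [hr1.isIdempotentElem.eq, hr1.isIdempotentElem.eq]
  have h1 := dominatedIn_sum_of_le_cube hq.nonneg hqf hr1.isSelfAdjoint horth
    (v := u) (by rw [hcube, hu])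
  rw [hsumR, ← hP, hPR] at h1
  refine h1.trans (DominatedIn.of_smul (r := 7 / 16) (by norm_num)
    ⟨R * P, fun h => by rw [map_mul, hRf, hPf], ?_⟩)
  -- `a ≤ P * p * P + 1 / 16` and `(1 / 2) • R ≤ R * a * R`, hence `R * P * p * P * R` is at least
  -- `(1 / 2 - 1 / 16) • R`
  have h2 : a ≤ P * p * P + (1 / 16 : ℝ) • (1 : C) := by
    have hPpP : IsSelfAdjoint (P * p * P) := by
      have := hpp.isSelfAdjoint.conjugate P
      rwa [hPp.isSelfAdjoint.star_eq] at this
    have h3 := (hasa.sub hPpP).le_algebraMap_norm_self.trans (algebraMap_mono C hnear)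
    rw [Algebra.algebraMap_eq_smul_one] at h3
    rwa [add_comm, ← sub_le_iff_le_add]
  have h3 := hR.isSelfAdjoint.conjugate_le_conjugate h2
  rw [mul_add, add_mul, mul_smul_comm, smul_mul_assoc, mul_one, hR.isIdempotentElem.eq] at h3
  have h4 := hRle.trans h3
  rw [← sub_le_iff_le_add, ← sub_smul, show (1 / 2 : ℝ) - 1 / 16 = 7 / 16 by norm_num] at h4
  refine h4.trans_eq ?_
  rw [star_mul, hR.isSelfAdjoint.star_eq, hPp.isSelfAdjoint.star_eq]
  simp only [mul_assoc]

/-- For an action with exact Rokhlin families on an algebra with strict comparison, there are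
approximately central exact Rokhlin families whose defect is dominated by a given element `x`, and,
within the fixed point algebra, by a given fixed element `y` and by the sum of the family. -/
theorem HasExactRokhlin.exists_isRokhlinFamily (hβ : HasExactRokhlin β)
    (hfull : ∀ x : C, 0 ≤ x → x ≠ 0 → IsFullElement x) (hinf : ¬ FiniteDimensional ℂ C)
    (hC : HasStrictComparison C) (F : Finset C) {ε : ℝ} (hε : 0 < ε) {x y : C} (hx : 0 ≤ x)
    (hx0 : x ≠ 0) (hy : 0 ≤ y) (hy0 : y ≠ 0) (hyf : ∀ h, β h y = y) :
    ∃ e, IsRokhlinFamily β e ∧ (∀ h, ∀ a ∈ F, ‖e h * a - a * e h‖ < ε) ∧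
      Dominated (1 - ∑ h, e h) x ∧ DominatedIn β (1 - ∑ h, e h) y ∧
      DominatedIn β (1 - ∑ h, e h) (∑ h, e h) := by
  obtain ⟨z, hz, hz0, hzq⟩ := hβ.exists_test hfull hx hx0 hy hy0 hyf
  obtain ⟨e, he, hec, hez, hep⟩ := hβ.exists_isRokhlinFamily_dominatedIn_sum hfull hinf hC F hε
    hz hz0
  obtain ⟨h1, h2⟩ := hzq _ he.isStarProjection_sum.one_sub
    (fun h => by rw [map_sub, map_one, he.map_sum]) hez
  exact ⟨e, he, hec, h1, h2, hep⟩

end FiniteGroup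

/-! ### Elementary tensors -/

section MinTensorBasic

variable {ι : Type*} {A : ι → Type*} [∀ k, CStarAlgebra (A k)]

lemma tensorAct_apply_same (k : ι) (a : A k) (x : TensorIndex A) :
    (tensorAct k a x).2.1 k = a * x.2.1 k := by simp [tensorAct]

lemma tensorAct_apply_of_ne {k l : ι} (h : l ≠ k) (a : A k) (x : TensorIndex A) :
    (tensorAct k a x).2.1 l = x.2.1 l := by
  classical exact Function.update_of_ne h _ _

namespace MinTensor

variable (A) in
/-- The defining representation of the minimal tensor product. -/
def val : MinTensor A →⋆ₐ[ℂ] (TensorHilbert A →L[ℂ] TensorHilbert A) :=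
  (generatedBy (tensorRep A)).subtype

lemma val_injective : Function.Injective (val A) := Subtype.val_injective

lemma val_incl_delta (k : ι) (a : A k) (x : TensorIndex A) :
    val A (incl A k a) (KernelSpace.delta (posSemidef_tensorKernel A) x)
      = KernelSpace.delta _ (tensorAct k a x) :=
  tensorOp_delta k a x

lemma ext_delta {S T : MinTensor A}
    (h : ∀ x, val A S (KernelSpace.delta (posSemidef_tensorKernel A) x)
      = val A T (KernelSpace.delta _ x)) : S = T :=
  val_injective (KernelSpace.op_ext fun x y => by rw [h])

lemma isometry_val : Isometry (val A) := isometry_subtype_coe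

/-- The minimal tensor product is generated by the factors. -/
lemma mem_of_isClosed {N : StarSubalgebra ℂ (MinTensor A)} (hN : IsClosed (N : Set (MinTensor A)))
    (h : ∀ k a, incl A k a ∈ N) (T : MinTensor A) : T ∈ N := by
  have h1 : IsClosed ((N.map (val A) : StarSubalgebra ℂ _) :
      Set (TensorHilbert A →L[ℂ] TensorHilbert A)) := by
    rw [StarSubalgebra.coe_map]
    exact isometry_val.isClosedEmbedding.isClosedMap _ hN
  have h2 := generatedBy.le_of_isClosed (tensorRep A) h1 fun k a => ⟨incl A k a, h k a, rfl⟩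
  obtain ⟨S, hS, hST⟩ := h2 (show val A T ∈ generatedBy (tensorRep A) from T.2)
  rwa [← val_injective hST]

lemma continuous_incl (k : ι) : Continuous (incl A k) :=
  AddMonoidHomClass.continuous_of_bound (incl A k) 1 fun a => by
    rw [one_mul]; exact NonUnitalStarAlgHom.norm_apply_le (incl A k) a

lemma starAlgHom_ext {D : Type*} [CStarAlgebra D] {θ θ' : MinTensor A →⋆ₐ[ℂ] D}
    (h : ∀ k a, θ (incl A k a) = θ' (incl A k a)) (T : MinTensor A) : θ T = θ' T := by
  have hc : ∀ θ : MinTensor A →⋆ₐ[ℂ] D, Continuous θ := fun θ =>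
    AddMonoidHomClass.continuous_of_bound θ 1 fun a => by
      rw [one_mul]; exact NonUnitalStarAlgHom.norm_apply_le θ a
  exact mem_of_isClosed (N := StarAlgHom.equalizer θ θ') (isClosed_eq (hc θ) (hc θ')) h T

end MinTensor

end MinTensorBasic

section ElementaryTensor

variable {n : ℕ} {A : Fin n → Type*} [∀ k, CStarAlgebra (A k)]

namespace MinTensor

/-- The inclusion of a factor as a continuous linear map. -/
def inclL (k : Fin n) : A k →L[ℂ] MinTensor A :=
  ⟨((incl A k : A k →⋆ₐ[ℂ] MinTensor A) : A k →ₗ[ℂ] MinTensor A), continuous_incl k⟩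

/-- The elementary tensor `x 0 ⊗ ⋯ ⊗ x (n - 1)`. -/
def tprod : ContinuousMultilinearMap ℂ A (MinTensor A) :=
  (ContinuousMultilinearMap.mkPiAlgebraFin ℂ n (MinTensor A)).compContinuousLinearMap inclL

lemma tprod_apply (x : ∀ k, A k) :
    tprod x = ((List.finRange n).map fun k => incl A k (x k)).prod := by
  rw [← List.ofFn_eq_map]
  rfl

/-- The action of an elementary tensor on the indices of the defining vectors. -/
def mulIndex (x : ∀ k, A k) (y : TensorIndex A) : TensorIndex A :=
  (y.1, ⟨fun k => x k * y.2.1 k, Set.toFinite _⟩)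

lemma val_tprod_delta (x : ∀ k, A k) (y : TensorIndex A) :
    val A (tprod x) (KernelSpace.delta (posSemidef_tensorKernel A) y)
      = KernelSpace.delta _ (mulIndex x y) := by
  classical
  have h1 : ∀ l : List (Fin n), l.Nodup → ∃ z : TensorIndex A,
      val A (l.map fun k => incl A k (x k)).prod (KernelSpace.delta (posSemidef_tensorKernel A) y)
        = KernelSpace.delta _ z ∧ z.1 = y.1 ∧
      ∀ k, z.2.1 k = if k ∈ l then x k * y.2.1 k else y.2.1 k := by
    intro l hl
    induction l with
    | nil => exact ⟨y, by simp, rfl, fun k => by simp⟩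
    | cons k l ih =>
      obtain ⟨z, hz, hz1, hz2⟩ := ih (List.nodup_cons.mp hl).2
      refine ⟨tensorAct k (x k) z, ?_, hz1, fun m => ?_⟩
      · rw [List.map_cons, List.prod_cons, map_mul (val A), mul_apply_eq_comp, hz,
          val_incl_delta]
      · by_cases hm : m = k
        · subst hm
          rw [tensorAct_apply_same, hz2, if_neg (List.nodup_cons.mp hl).1]
          simp
        · rw [tensorAct_apply_of_ne hm, hz2]
          simp [hm]
  obtain ⟨z, hz, hz1, hz2⟩ := h1 (List.finRange n) (List.nodup_finRange n)
  rw [tprod_apply, hz]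
  congr 1
  ext k
  · rw [hz1]; rfl
  · rw [hz2, if_pos (List.mem_finRange k)]; rfl

lemma tprod_mul (x y : ∀ k, A k) : tprod (x * y) = tprod x * tprod y :=
  ext_delta fun z => by
    rw [map_mul (val A), mul_apply_eq_comp, val_tprod_delta, val_tprod_delta, val_tprod_delta]
    congr 1
    ext k
    · rfl
    · simp only [mulIndex, Pi.mul_apply, mul_assoc]

lemma tprod_one : tprod (1 : ∀ k, A k) = 1 :=
  ext_delta fun z => by
    rw [map_one (val A), val_tprod_delta]
    change _ = KernelSpace.delta _ z
    congr 1
    ext k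
    · rfl
    · simp only [mulIndex, Pi.one_apply, one_mul]

lemma tensorKernel_mulIndex (x : ∀ k, A k) (y z : TensorIndex A) :
    tensorKernel A (mulIndex x y) z = tensorKernel A y (mulIndex (star x) z) := by
  rw [tensorKernel, Matrix.of_apply, Matrix.of_apply]
  by_cases h : y.1 = z.1
  · rw [if_pos (show (mulIndex x y).1 = z.1 from h),
      if_pos (show y.1 = (mulIndex (star x) z).1 from h)]
    refine finprod_congr fun k => ?_
    simp only [mulIndex, star_mul, Pi.star_apply, mul_assoc]
  · rw [if_neg (show ¬ (mulIndex x y).1 = z.1 from h),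
      if_neg (show ¬ y.1 = (mulIndex (star x) z).1 from h)]

lemma star_tprod (x : ∀ k, A k) : star (tprod x) = tprod (star x) :=
  val_injective <| KernelSpace.op_ext fun y z => by
    rw [map_star, ContinuousLinearMap.star_eq_adjoint, ContinuousLinearMap.adjoint_inner_right,
      val_tprod_delta, val_tprod_delta, KernelSpace.inner_delta, KernelSpace.inner_delta,
      tensorKernel_mulIndex]

open Classical in
lemma incl_eq_tprod (k : Fin n) (a : A k) :
    incl A k a = tprod (Function.update (1 : ∀ k, A k) k a) :=
  ext_delta fun z => by
    rw [val_incl_delta, val_tprod_delta]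
    congr 1
    ext l
    · rfl
    · by_cases h : l = k
      · subst h; simp [mulIndex, tensorAct]
      · rw [tensorAct_apply_of_ne h]
        simp [mulIndex, Function.update_of_ne h]

lemma tprod_nonneg {x : ∀ k, A k} (hx : ∀ k, 0 ≤ x k) : 0 ≤ tprod x := by
  choose c hc using fun k => CStarAlgebra.nonneg_iff_eq_star_mul_self.mp (hx k)
  have h1 : x = star c * c := funext hc
  rw [h1, tprod_mul, ← star_tprod]
  exact star_mul_self_nonneg _

lemma isStarProjection_tprod {x : ∀ k, A k} (hx : ∀ k, IsStarProjection (x k)) :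
    IsStarProjection (tprod x) := by
  refine ⟨?_, ?_⟩
  · change tprod x * tprod x = tprod x
    rw [← tprod_mul]
    congr 1
    exact funext fun k => (hx k).isIdempotentElem
  · rw [IsSelfAdjoint, star_tprod]
    congr 1
    exact funext fun k => (hx k).isSelfAdjoint.star_eq

lemma tprod_mono {x y : ∀ k, A k} (hx : ∀ k, 0 ≤ x k) (hxy : ∀ k, x k ≤ y k) :
    tprod x ≤ tprod y := by
  classical
  have h1 : ∀ s : Finset (Fin n), tprod x ≤ tprod (s.piecewise y x) := by
    intro s
    induction s using Finset.induction_on with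
    | empty => simp
    | insert k s hk ih =>
      refine ih.trans ?_
      rw [Finset.piecewise_insert, ← sub_nonneg]
      have h2 : tprod (Function.update (s.piecewise y x) k (y k)) - tprod (s.piecewise y x)
          = tprod (Function.update (s.piecewise y x) k (y k - x k)) := by
        rw [ContinuousMultilinearMap.map_update_sub]
        congr 2
        rw [eq_comm, Function.update_eq_self_iff]
        simp [hk]
      rw [h2]
      refine tprod_nonneg fun l => ?_
      by_cases hl : l = k
      · subst hl; simp [hxy]
      · rw [Function.update_of_ne hl]
        by_cases hls : l ∈ s
        · simpa [hls] using (hx l).trans (hxy l)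
        · simpa [hls] using hx l
  simpa using h1 Finset.univ

/-- The linear combinations of elementary tensors form a *-subalgebra. -/
def tprodSpan : StarSubalgebra ℂ (MinTensor A) where
  carrier := Submodule.span ℂ (Set.range (tprod : (∀ k, A k) → MinTensor A))
  mul_mem' {S T} hS hT := by
    refine Submodule.span_induction₂ (p := fun S T _ _ =>
      S * T ∈ Submodule.span ℂ (Set.range (tprod : (∀ k, A k) → MinTensor A))) ?_ ?_ ?_ ?_ ?_ ?_ ?_
      hS hT
    · rintro _ _ ⟨x, rfl⟩ ⟨y, rfl⟩
      rw [← tprod_mul]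
      exact Submodule.subset_span ⟨_, rfl⟩
    · intro y _; simp
    · intro y _; simp
    · intro x y z _ _ _ h1 h2; rw [add_mul]; exact add_mem h1 h2
    · intro x y z _ _ _ h1 h2; rw [mul_add]; exact add_mem h1 h2
    · intro r x y _ _ h; rw [smul_mul_assoc]; exact Submodule.smul_mem _ _ h
    · intro r x y _ _ h; rw [mul_smul_comm]; exact Submodule.smul_mem _ _ h
  add_mem' hS hT := add_mem (S := Submodule ℂ (MinTensor A)) hS hT
  algebraMap_mem' r := by
    rw [Algebra.algebraMap_eq_smul_one, ← tprod_one]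
    exact Submodule.smul_mem _ _ (Submodule.subset_span ⟨_, rfl⟩)
  star_mem' {S} hS := by
    refine Submodule.span_induction (p := fun S _ =>
      star S ∈ Submodule.span ℂ (Set.range (tprod : (∀ k, A k) → MinTensor A))) ?_ ?_ ?_ ?_ hS
    · rintro _ ⟨x, rfl⟩
      rw [star_tprod]
      exact Submodule.subset_span ⟨_, rfl⟩
    · simp
    · intro x y _ _ h1 h2; rw [star_add]; exact add_mem h1 h2
    · intro r x _ h; rw [star_smul]; exact Submodule.smul_mem _ _ h

/-- Linear combinations of elementary tensors are dense. -/
lemma exists_sum_tprod_near (T : MinTensor A) {ε : ℝ} (hε : 0 < ε) :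
    ∃ (s : Finset (∀ k, A k)) (c : (∀ k, A k) → ℂ), ‖T - ∑ a ∈ s, c a • tprod a‖ < ε := by
  classical
  have h1 : T ∈ (tprodSpan (A := A)).topologicalClosure :=
    mem_of_isClosed (StarSubalgebra.isClosed_topologicalClosure _) (fun k a =>
      StarSubalgebra.le_topologicalClosure _ (by
        rw [incl_eq_tprod]
        exact Submodule.subset_span ⟨_, rfl⟩)) T
  obtain ⟨S, hS, hd⟩ := Metric.mem_closure_iff.mp h1 ε hε
  rw [dist_eq_norm] at hd
  obtain ⟨c, hc⟩ := Finsupp.mem_span_range_iff_exists_finsupp.mp hS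
  refine ⟨c.support, c, ?_⟩
  rw [← hc] at hd
  exact hd

/-- Elementary tensors of projections nearly commute with a given element, provided that the
factors nearly commute with finitely many given elements. -/
lemma exists_commutator_small (T : MinTensor A) {ε : ℝ} (hε : 0 < ε) :
    ∃ (F : ∀ k, Finset (A k)) (κ : ℝ), 0 < κ ∧ ∀ f : ∀ k, A k, (∀ k, IsStarProjection (f k)) →
      (∀ k, ∀ a ∈ F k, ‖f k * a - a * f k‖ < κ) → ‖tprod f * T - T * tprod f‖ < ε := by
  classical
  obtain ⟨s, c, hs⟩ := exists_sum_tprod_near T (ε := ε / 4) (by positivity)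
  obtain ⟨K, hK⟩ : ∃ K : ℝ, K = ∑ a ∈ s, ‖c a‖ * (‖(tprod : ContinuousMultilinearMap ℂ A _)‖
    * Fintype.card (Fin n) * ‖a‖ ^ (Fintype.card (Fin n) - 1)) := ⟨_, rfl⟩
  have hK0 : 0 ≤ K := by rw [hK]; exact Finset.sum_nonneg fun a _ => by positivity
  obtain ⟨r, hr⟩ : ∃ r, r = ε / (2 * (K + 1)) := ⟨_, rfl⟩
  have hr0 : 0 < r := by rw [hr]; positivity
  refine ⟨fun k => s.image fun a => a k, r, hr0, fun f hf hfc => ?_⟩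
  have hfn := (isStarProjection_tprod hf).norm_le
  obtain ⟨S, hS⟩ : ∃ S, S = ∑ a ∈ s, c a • tprod a := ⟨_, rfl⟩
  rw [← hS] at hs
  have h1 : tprod f * T - T * tprod f
      = (tprod f * (T - S) - (T - S) * tprod f) + (tprod f * S - S * tprod f) := by noncomm_ring
  have h2 : ‖tprod f * (T - S) - (T - S) * tprod f‖ < ε / 2 := by
    have h3 : ‖tprod f * (T - S) - (T - S) * tprod f‖
        ≤ ‖tprod f‖ * ‖T - S‖ + ‖T - S‖ * ‖tprod f‖ :=
      (norm_sub_le _ _).trans (add_le_add (norm_mul_le _ _) (norm_mul_le _ _))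
    nlinarith [norm_nonneg (T - S), norm_nonneg (tprod f)]
  have h4 : ‖tprod f * S - S * tprod f‖ ≤ K * r := by
    have h5 : tprod f * S - S * tprod f = ∑ a ∈ s, c a • (tprod (f * a) - tprod (a * f)) := by
      rw [hS, Finset.mul_sum, Finset.sum_mul, ← Finset.sum_sub_distrib]
      refine Finset.sum_congr rfl fun a _ => ?_
      rw [mul_smul_comm, smul_mul_assoc, smul_sub, tprod_mul, tprod_mul]
    rw [h5, hK, Finset.sum_mul]
    refine norm_sum_le_of_le _ fun a ha => ?_
    rw [norm_smul, mul_assoc]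
    refine mul_le_mul_of_nonneg_left ?_ (norm_nonneg _)
    refine (ContinuousMultilinearMap.norm_image_sub_le _ _ _).trans ?_
    have hfa : ‖f * a‖ ≤ ‖a‖ := (pi_norm_le_iff_of_nonneg (norm_nonneg _)).mpr fun k => by
      refine (norm_mul_le _ _).trans ?_
      calc _ ≤ 1 * ‖a‖ := by
            have := (hf k).norm_le
            have := norm_le_pi_norm a k
            gcongr
        _ = ‖a‖ := one_mul _
    have haf : ‖a * f‖ ≤ ‖a‖ := (pi_norm_le_iff_of_nonneg (norm_nonneg _)).mpr fun k => by
      refine (norm_mul_le _ _).trans ?_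
      calc _ ≤ ‖a‖ * 1 := by
            have := (hf k).norm_le
            have := norm_le_pi_norm a k
            gcongr
        _ = ‖a‖ := mul_one _
    have hd : ‖f * a - a * f‖ ≤ r :=
      (pi_norm_le_iff_of_nonneg hr0.le).mpr fun k =>
        (hfc k (a k) (Finset.mem_image_of_mem (fun a => a k) ha)).le
    have hm := max_le hfa haf
    have hm0 : 0 ≤ max ‖f * a‖ ‖a * f‖ := le_max_of_le_left (norm_nonneg _)
    gcongr
  have h6 : K * r ≤ ε / 2 := by
    rw [hr, show K * (ε / (2 * (K + 1))) = ε / 2 * (K / (K + 1)) by field_simp]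
    exact mul_le_of_le_one_right (by positivity) ((div_le_one (by positivity)).mpr (by linarith))
  rw [h1]
  have := norm_add_le (tprod f * (T - S) - (T - S) * tprod f) (tprod f * S - S * tprod f)
  linarith

lemma inner_val_tprod (φ : ∀ k, CStarState (A k)) (b a : ∀ k, A k) :
    ⟪KernelSpace.delta (posSemidef_tensorKernel A) (φ, ⟨b, Set.toFinite _⟩),
      val A (tprod a) (KernelSpace.delta _ (φ, ⟨b, Set.toFinite _⟩))⟫_ℂ
      = ∏ k, (φ k).toLin (star (b k) * a k * b k) := by
  rw [val_tprod_delta, KernelSpace.inner_delta, tensorKernel, Matrix.of_apply]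
  refine (if_pos rfl).trans ?_
  rw [finprod_eq_prod_of_fintype]
  simp only [mulIndex, mul_assoc]

end MinTensor

end ElementaryTensor

/-! ### Elementary tensors below a positive element -/

section Slice

variable {n : ℕ} {A : Fin n → Type*} [∀ k, CStarAlgebra (A k)]

lemma half_le_one_sub_pow (n : ℕ) : (1 / 2 : ℝ) ≤ (1 - 1 / (2 * ((n : ℝ) + 1))) ^ n := by
  have h0 : 1 / (2 * ((n : ℝ) + 1)) ≤ 1 := by
    rw [div_le_one (by positivity)]
    have : (0 : ℝ) ≤ n := Nat.cast_nonneg n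
    linarith
  have h1 := one_add_mul_le_pow (a := -(1 / (2 * ((n : ℝ) + 1)))) (by linarith) n
  rw [← sub_eq_add_neg] at h1
  refine le_trans ?_ h1
  have h2 : (n : ℝ) * (1 / (2 * ((n : ℝ) + 1))) ≤ 1 / 2 := by
    rw [mul_one_div, div_le_div_iff₀ (by positivity) two_pos]
    linarith
  linarith

namespace MinTensor

lemma tprod_smul (c : Fin n → ℂ) (x : ∀ k, A k) :
    tprod (fun k => c k • x k) = (∏ k, c k) • tprod x :=
  ContinuousMultilinearMap.map_smul_univ _ c x

lemma tprod_real_smul (c : ℝ) (x : ∀ k, A k) :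
    tprod (fun k => c • x k) = c ^ n • tprod x := by
  have h1 : (fun k => c • x k) = fun k => (c : ℂ) • x k := funext fun k => (Complex.coe_smul c _).symm
  rw [h1, tprod_smul (fun _ => (c : ℂ)) x, Finset.prod_const, Finset.card_univ, Fintype.card_fin,
    ← Complex.ofReal_pow, Complex.coe_smul]

/-- Excision of a product state: the states of the factors are excised one after the other. -/
lemma exists_excising_family (φ : ∀ k, CStarState (A k)) {I : Type*} [Fintype I]
    (a : I → ∀ k, A k) (c : I → ℂ) {ε : ℝ} (hε : 0 < ε) (t : Finset (Fin n)) :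
    ∃ (h : ∀ k, A k) (u : I → Fin n → ℂ),
      (∀ k ∈ t, 0 ≤ h k ∧ ‖h k‖ = 1 ∧ ∀ i, ‖h k * a i k * h k - u i k • (h k * h k)‖ ≤ ε) ∧
      (∀ k ∉ t, ∀ i, u i k = (φ k).toLin (a i k)) ∧
      (∑ i, c i * ∏ k, (φ k).toLin (a i k)).re - t.card * ε ≤ (∑ i, c i * ∏ k, u i k).re := by
  classical
  induction t using Finset.induction_on with
  | empty => exact ⟨1, fun i k => (φ k).toLin (a i k), by simp, by simp, by simp⟩
  | insert k t hk ih =>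
    obtain ⟨h, u, h1, h2, h3⟩ := ih
    obtain ⟨g, s, hg, hg1, hgs, hle⟩ := (φ k).exists_excising (fun i => a i k)
      (fun i => c i * ∏ l ∈ Finset.univ.erase k, u i l) hε
    refine ⟨Function.update h k g, fun i => Function.update (u i) k (s i), fun l hl => ?_,
      fun l hl i => ?_, ?_⟩
    · by_cases hlk : l = k
      · subst hlk
        simp only [Function.update_self]
        exact ⟨hg, hg1, hgs⟩
      · simp only [Function.update_of_ne hlk]
        exact h1 l ((Finset.mem_insert.mp hl).resolve_left hlk)
    · rw [Finset.mem_insert, not_or] at hl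
      change Function.update (u i) k (s i) l = _
      rw [Function.update_of_ne hl.1]
      exact h2 l hl.2 i
    · have e1 : ∀ i, c i * ∏ l, u i l
          = (c i * ∏ l ∈ Finset.univ.erase k, u i l) * (φ k).toLin (a i k) := fun i => by
        rw [← Finset.mul_prod_erase _ _ (Finset.mem_univ k), h2 k hk]; ring
      have e2 : ∀ i, c i * ∏ l, Function.update (u i) k (s i) l
          = (c i * ∏ l ∈ Finset.univ.erase k, u i l) * s i := fun i => by
        rw [← Finset.mul_prod_erase _ _ (Finset.mem_univ k), Function.update_self,
          Finset.prod_congr rfl fun l hl => Function.update_of_ne (Finset.ne_of_mem_erase hl) _ _]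
        ring
      simp only [e2]
      simp only [e1] at h3
      rw [map_sum] at hle
      simp only [map_smul, smul_eq_mul] at hle
      rw [Finset.card_insert_of_notMem hk]
      push_cast
      linarith

/-- Every nonzero positive element of the minimal tensor product dominates an elementary tensor of
positive elements of norm one. A product state which does not vanish on the element is excised. -/
lemma exists_tprod_dominated {y : MinTensor A} (hy : 0 ≤ y) (hy0 : y ≠ 0) :
    ∃ x : ∀ k, A k, (∀ k, 0 ≤ x k ∧ ‖x k‖ = 1) ∧ Dominated (tprod x) y := by
  classical
  obtain ⟨r, hsy, hsys⟩ : ∃ r : MinTensor A, r * r = y ∧ star r = r :=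
    ⟨CFC.sqrt y, CFC.sqrt_mul_sqrt_self y hy,
      (IsSelfAdjoint.of_nonneg (CFC.sqrt_nonneg y)).star_eq⟩
  -- the square root of `y` does not vanish on some defining vector, so the product state `φ` does
  -- not vanish on the conjugate of `y` by an elementary tensor `tprod b`
  obtain ⟨⟨φ, ⟨b, hb⟩⟩, hx⟩ : ∃ x : TensorIndex A,
      val A r (KernelSpace.delta (posSemidef_tensorKernel A) x) ≠ 0 := by
    by_contra! h
    have h1 : r = 0 := ext_delta fun x => by rw [h x, _root_.map_zero]; rfl
    exact hy0 (by rw [← hsy, h1, zero_mul])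
  have hntA : ∀ k, Nontrivial (A k) := fun k => ⟨1, 0, fun h => by
    have := (φ k).map_one
    rw [h, map_zero] at this
    exact zero_ne_one this⟩
  obtain ⟨ξ, hξ⟩ : ∃ ξ, ξ = KernelSpace.delta (posSemidef_tensorKernel A)
    (φ, ⟨(1 : ∀ k, A k), Set.toFinite _⟩) := ⟨_, rfl⟩
  have hξin : ⟪ξ, ξ⟫_ℂ = 1 := by
    rw [hξ, KernelSpace.inner_delta, tensorKernel, Matrix.of_apply]
    refine (if_pos rfl).trans ?_
    simp [(φ _).map_one]
  have hξn : ‖ξ‖ = 1 := by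
    rw [@norm_eq_sqrt_re_inner ℂ, hξin]; simp
  have hbξ : val A (tprod b) ξ = KernelSpace.delta _ (φ, ⟨b, hb⟩) := by
    rw [hξ, val_tprod_delta]
    congr 1
    ext k
    · rfl
    · simp [mulIndex]
  obtain ⟨y', hy'⟩ : ∃ y', y' = star (tprod b) * y * tprod b := ⟨_, rfl⟩
  have hy'0 : 0 ≤ y' := by rw [hy']; exact star_left_conjugate_nonneg hy _
  obtain ⟨μ, hμ⟩ : ∃ μ, μ = (⟪ξ, val A y' ξ⟫_ℂ).re := ⟨_, rfl⟩
  have hμ0 : 0 < μ := by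
    have e1 : ⟪ξ, val A y' ξ⟫_ℂ = ⟪val A r (val A (tprod b) ξ),
        val A r (val A (tprod b) ξ)⟫_ℂ := by
      rw [hy', ← hsy]
      nth_rw 1 [← hsys]
      rw [← mul_assoc, ← star_mul, mul_assoc, map_mul (val A), map_star, mul_apply_eq_comp,
        ContinuousLinearMap.star_eq_adjoint, ContinuousLinearMap.adjoint_inner_right,
        map_mul (val A), mul_apply_eq_comp]
    have : 0 < ‖val A r (KernelSpace.delta (posSemidef_tensorKernel A) (φ, ⟨b, hb⟩))‖ :=
      norm_pos_iff.mpr hx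
    rw [hμ, e1, hbξ]
    refine lt_of_lt_of_eq ?_ (inner_self_eq_norm_sq (𝕜 := ℂ) _).symm
    positivity
  -- excision is applied to an approximation `S` of the conjugate by elementary tensors
  obtain ⟨s, c, hs⟩ := exists_sum_tprod_near y' (ε := μ / 16) (by positivity)
  obtain ⟨S, hS⟩ : ∃ S, S = ∑ a : s, c a.1 • tprod a.1 := ⟨_, rfl⟩
  have hS' : ∑ a ∈ s, c a • tprod a = S := by
    rw [hS, ← Finset.sum_coe_sort]
  rw [hS'] at hs
  have hSμ : μ - μ / 16 ≤ (∑ a : s, c a.1 * ∏ k, (φ k).toLin (a.1 k)).re := by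
    have e1 : ⟪ξ, val A S ξ⟫_ℂ = ∑ a : s, c a.1 * ∏ k, (φ k).toLin (a.1 k) := by
      rw [hS, map_sum, sum_apply, inner_sum]
      refine Finset.sum_congr rfl fun a _ => ?_
      rw [map_smul, smul_apply, inner_smul_right, hξ]
      congr 1
      have := inner_val_tprod φ 1 a.1
      simpa using this
    have e2 : ‖⟪ξ, val A (y' - S) ξ⟫_ℂ‖ ≤ μ / 16 := by
      refine (norm_inner_le_norm _ _).trans ?_
      rw [hξn, one_mul]
      refine (ContinuousLinearMap.le_opNorm _ _).trans ?_
      rw [hξn, mul_one]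
      exact (NonUnitalStarAlgHom.norm_apply_le (val A) _).trans hs.le
    have e3 := (Complex.re_le_norm _).trans e2
    rw [map_sub, sub_apply, inner_sub_right, Complex.sub_re, ← hμ, e1] at e3
    linarith
  obtain ⟨K, hK⟩ : ∃ K : ℝ, K = ∑ a : s, ‖c a.1‖ * (‖(tprod : ContinuousMultilinearMap ℂ A _)‖
    * Fintype.card (Fin n) * (‖a.1‖ + 1) ^ (Fintype.card (Fin n) - 1)) := ⟨_, rfl⟩
  have hK0 : 0 ≤ K := by rw [hK]; exact Finset.sum_nonneg fun a _ => by positivity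
  obtain ⟨ε, hε, hε1, hεn, hεK⟩ : ∃ ε : ℝ, 0 < ε ∧ ε ≤ 1 ∧ n * ε ≤ μ / 16 ∧ K * ε ≤ μ / 16 := by
    refine ⟨min 1 (μ / (16 * (n + K + 1))), by positivity, min_le_left _ _, ?_, ?_⟩ <;>
    · have h1 : min 1 (μ / (16 * (n + K + 1))) ≤ μ / (16 * (n + K + 1)) := min_le_right _ _
      have h2 : 0 < min 1 (μ / (16 * (n + K + 1))) := by positivity
      rw [le_div_iff₀ (by positivity)] at h1
      have h3 : (0 : ℝ) ≤ n := Nat.cast_nonneg n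
      nlinarith
  obtain ⟨h, u, hh, -, hu⟩ := exists_excising_family φ (fun a : s => a.1) (fun a => c a.1) hε
    Finset.univ
  rw [Finset.card_univ, Fintype.card_fin] at hu
  have hhn : ∀ k, 0 ≤ h k := fun k => (hh k (Finset.mem_univ k)).1
  have hh1 : ∀ k, ‖h k‖ = 1 := fun k => (hh k (Finset.mem_univ k)).2.1
  have hhs : ∀ k, star (h k) = h k := fun k => (IsSelfAdjoint.of_nonneg (hhn k)).star_eq
  obtain ⟨w, hw⟩ : ∃ w : ℂ, w = ∑ a : s, c a.1 * ∏ k, u a k := ⟨_, rfl⟩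
  have hwre : μ / 2 ≤ w.re := by rw [hw]; linarith
  have hTn := tprod_nonneg hhn
  obtain ⟨T, hT⟩ : ∃ T, T = tprod h := ⟨_, rfl⟩
  have hTs : star T = T := by rw [hT]; exact (IsSelfAdjoint.of_nonneg hTn).star_eq
  have hT1 : ‖T‖ ≤ 1 := by
    have h1 : T * T ≤ 1 := by
      rw [hT, ← tprod_mul, ← tprod_one]
      exact tprod_mono (fun k => (IsSelfAdjoint.of_nonneg (hhn k)).mul_self_nonneg)
        fun k => mul_self_le_one_of_norm_le_one (IsSelfAdjoint.of_nonneg (hhn k)) (hh1 k).le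
    have h2 : 0 ≤ T * T := IsSelfAdjoint.mul_self_nonneg hTs
    have h3 := norm_le_of_nonneg_of_le_smul_one (r := 1) h2 (by rwa [one_smul]) zero_le_one
    have h4 : ‖T‖ * ‖T‖ ≤ 1 := by
      rw [← CStarRing.norm_star_mul_self, hTs]; exact h3
    nlinarith [norm_nonneg T]
  -- the compression by `T` is nearly a multiple of `T * T`
  have hTS : ‖T * S * T - w • (T * T)‖ ≤ μ / 16 := by
    have e1 : T * S * T - w • (T * T)
        = ∑ a : s, c a.1 • (tprod (fun k => h k * a.1 k * h k)
          - tprod (fun k => u a k • (h k * h k))) := by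
      rw [hS, hw, Finset.mul_sum, Finset.sum_mul, Finset.sum_smul, ← Finset.sum_sub_distrib]
      refine Finset.sum_congr rfl fun a _ => ?_
      rw [tprod_smul, smul_sub, smul_smul, mul_smul_comm, smul_mul_assoc, hT]
      congr 2
      · rw [← tprod_mul, ← tprod_mul]; rfl
      · rw [← tprod_mul]; rfl
    rw [e1]
    refine le_trans ?_ hεK
    have e2 : K * ε = ∑ a : s, ‖c a.1‖ * (‖(tprod : ContinuousMultilinearMap ℂ A _)‖
        * Fintype.card (Fin n) * (‖a.1‖ + 1) ^ (Fintype.card (Fin n) - 1)) * ε := by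
      rw [hK, Finset.sum_mul]
    rw [e2]
    refine norm_sum_le_of_le _ fun a _ => ?_
    rw [norm_smul, mul_assoc]
    refine mul_le_mul_of_nonneg_left ?_ (norm_nonneg _)
    refine (ContinuousMultilinearMap.norm_image_sub_le _ _ _).trans ?_
    have h1 : ∀ k, ‖h k * a.1 k * h k‖ ≤ ‖a.1‖ := fun k => by
      refine (norm_mul_le _ _).trans ?_
      rw [hh1, mul_one]
      refine (norm_mul_le _ _).trans ?_
      rw [hh1, one_mul]
      exact norm_le_pi_norm a.1 k
    have h2 : ‖(fun k => h k * a.1 k * h k : ∀ k, A k)‖ ≤ ‖a.1‖ + 1 :=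
      (pi_norm_le_iff_of_nonneg (by positivity)).mpr fun k => (h1 k).trans (by linarith)
    have h3 : ‖(fun k => u a k • (h k * h k) : ∀ k, A k)‖ ≤ ‖a.1‖ + 1 :=
      (pi_norm_le_iff_of_nonneg (by positivity)).mpr fun k => by
        have h4 := (hh k (Finset.mem_univ k)).2.2 a
        have h5 := norm_sub_norm_le (u a k • (h k * h k)) (h k * a.1 k * h k)
        rw [norm_sub_rev] at h5
        linarith [h1 k]
    have h4 : ‖(fun k => h k * a.1 k * h k : ∀ k, A k) - (fun k => u a k • (h k * h k))‖ ≤ ε :=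
      (pi_norm_le_iff_of_nonneg hε.le).mpr fun k => (hh k (Finset.mem_univ k)).2.2 a
    have h5 := max_le h2 h3
    have h6 : 0 ≤ max ‖(fun k => h k * a.1 k * h k : ∀ k, A k)‖
      ‖(fun k => u a k • (h k * h k) : ∀ k, A k)‖ := le_max_of_le_left (norm_nonneg _)
    gcongr
  have hTy : ‖T * y' * T - w • (T * T)‖ ≤ μ / 8 := by
    have e1 : T * y' * T - w • (T * T) = T * (y' - S) * T + (T * S * T - w • (T * T)) := by
      rw [mul_sub, sub_mul]; abel
    rw [e1]
    have e2 : ‖T * (y' - S) * T‖ ≤ μ / 16 := by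
      calc _ ≤ ‖T‖ * ‖y' - S‖ * ‖T‖ := (norm_mul_le _ _).trans
            (mul_le_mul_of_nonneg_right (norm_mul_le _ _) (norm_nonneg _))
        _ ≤ 1 * (μ / 16) * 1 := by gcongr
        _ = μ / 16 := by ring
    linarith [norm_add_le (T * (y' - S) * T) (T * S * T - w • (T * T))]
  have hTle : w.re • (T * T) - (μ / 8) • (1 : MinTensor A) ≤ T * y' * T := by
    obtain ⟨R, hR⟩ : ∃ R, R = T * y' * T - w • (T * T) := ⟨_, rfl⟩
    have hyT : IsSelfAdjoint (T * y' * T) := by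
      have := (IsSelfAdjoint.of_nonneg hy'0).conjugate T
      rwa [hTs] at this
    have e1 : (2 : ℝ) • (w.re • (T * T) - T * y' * T) = -R + star (-R) := by
      rw [hR, star_neg, star_sub, hyT.star_eq, star_smul, star_mul, hTs]
      have e3 : w • (T * T) + star w • (T * T) = (2 * w.re : ℝ) • (T * T) := by
        rw [← add_smul, ← Complex.coe_smul]
        congr 1
        have := Complex.add_conj w
        simpa using this
      rw [smul_sub, smul_smul, ← e3, two_smul]
      abel
    have hsa : IsSelfAdjoint (-R + star (-R)) := IsSelfAdjoint.add_star_self _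
    have e2 : ‖-R + star (-R)‖ ≤ 2 * (μ / 8) := by
      refine (norm_add_le _ _).trans ?_
      rw [norm_star, norm_neg, hR]
      linarith
    have e3 := hsa.le_algebraMap_norm_self.trans (algebraMap_mono _ e2)
    rw [← e1, Algebra.algebraMap_eq_smul_one, ← smul_smul] at e3
    have e4 := smul_le_smul_of_nonneg_left e3 (by norm_num : (0 : ℝ) ≤ 1 / 2)
    rw [smul_smul, smul_smul, show (1 / 2 : ℝ) * 2 = 1 by norm_num, one_smul, one_smul] at e4
    rwa [sub_le_comm]
  -- after cutting the factors of `T` down to the tops of their spectra, `T * T` is at least `1 /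
  -- 2`, so that the error `μ / 8` is absorbed
  have hconc := fun k => exists_concentrated (c := h k * h k)
    (IsSelfAdjoint.of_nonneg (hhn k)).mul_self_nonneg (η := 1 / (2 * ((n : ℝ) + 1))) (by positivity)
  choose g hg hg1 hgle _ _ using hconc
  have hhh : ∀ k, ‖h k * h k‖ = 1 := fun k => by
    have := CStarRing.norm_star_mul_self (x := h k)
    rw [hhs, hh1, one_mul] at this
    exact this
  have hgs : ∀ k, star (g k) = g k := fun k => (IsSelfAdjoint.of_nonneg (hg k)).star_eq
  have hgg : ∀ k, ‖g k * g k‖ = 1 := fun k => by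
    have := CStarRing.norm_star_mul_self (x := g k)
    rw [hgs, hg1, one_mul] at this
    exact this
  have hggn : ∀ k, 0 ≤ g k * g k := fun k => (IsSelfAdjoint.of_nonneg (hg k)).mul_self_nonneg
  simp only [hhh] at hgle
  obtain ⟨P, hP⟩ : ∃ P, P = tprod g := ⟨_, rfl⟩
  have hPs : IsSelfAdjoint P := by rw [hP]; exact IsSelfAdjoint.of_nonneg (tprod_nonneg hg)
  have hPP : P * P = tprod fun k => g k * g k := by rw [hP, ← tprod_mul]; rfl
  have hPP0 : 0 ≤ P * P := hPs.mul_self_nonneg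
  have hPTP : (1 / 2 : ℝ) • (P * P) ≤ P * (T * T) * P := by
    have e1 : P * (T * T) * P = tprod fun k => g k * (h k * h k) * g k := by
      rw [hP, hT, ← tprod_mul, ← tprod_mul, ← tprod_mul]; rfl
    have hη : (0 : ℝ) ≤ 1 - 1 / (2 * ((n : ℝ) + 1)) := by
      rw [sub_nonneg, div_le_one (by positivity)]
      have : (0 : ℝ) ≤ n := Nat.cast_nonneg n
      linarith
    have e2 := tprod_mono (fun k => smul_nonneg hη (hggn k)) hgle
    rw [tprod_real_smul, ← hPP, ← e1] at e2
    exact (smul_le_smul_of_nonneg_right (half_le_one_sub_pow n) hPP0).trans e2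
  refine ⟨fun k => g k * g k, fun k => ⟨hggn k, hgg k⟩, ?_⟩
  rw [← hPP]
  refine Dominated.of_smul (r := μ / 8) (by positivity) ⟨P * T * star (tprod b), ?_⟩
  have e1 : P * T * star (tprod b) * y * star (P * T * star (tprod b)) = P * (T * y' * T) * P := by
    rw [hy', star_mul, star_mul, star_star, hTs, hPs.star_eq]
    simp only [mul_assoc]
  rw [e1]
  refine le_trans ?_ (hPs.conjugate_le_conjugate hTle)
  rw [mul_sub, sub_mul, mul_smul_comm, mul_smul_comm, smul_mul_assoc, smul_mul_assoc, mul_one,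
    le_sub_iff_add_le, ← add_smul]
  calc (μ / 8 + μ / 8) • (P * P) = (μ / 2) • ((1 / 2 : ℝ) • (P * P)) := by
        rw [smul_smul]; congr 1; ring
    _ ≤ (μ / 2) • (P * (T * T) * P) := smul_le_smul_of_nonneg_left hPTP (by positivity)
    _ ≤ w.re • (P * (T * T) * P) := smul_le_smul_of_nonneg_right hwre
        (hPs.conjugate_nonneg (IsSelfAdjoint.mul_self_nonneg hTs))

end MinTensor

end Slice

/-! ### Fullness, size and dimension in minimal tensor products -/

section States

/-- A functional of norm one which takes the value `1` at the unit is a state. -/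
lemma nonempty_cstarState (C : Type*) [CStarAlgebra C] [Nontrivial C] :
    Nonempty (CStarState C) := by
  have h1 : ‖(1 : C)‖ = 1 := CStarRing.norm_one
  obtain ⟨f, hf, hf1⟩ := exists_dual_vector ℂ (1 : C) (by rw [h1]; exact one_ne_zero)
  rw [h1, RCLike.ofReal_one] at hf1
  have hle : ∀ a, ‖f a‖ ≤ ‖a‖ := fun a => by
    have := f.le_opNorm a
    rwa [hf, one_mul] at this
  -- the value at a self-adjoint `a` is real, by the bounds for the norms of `a + i t` for real `t`
  have him : ∀ a : C, IsSelfAdjoint a → (f a).im = 0 := by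
    intro a ha
    have h2 : ∀ t : ℝ, (f a).im * (f a).im + 2 * (f a).im * t ≤ ‖a‖ * ‖a‖ := by
      intro t
      obtain ⟨b, hb⟩ : ∃ b, b = a + ((t : ℂ) * Complex.I) • (1 : C) := ⟨_, rfl⟩
      have h3 : star b * b = a * a + ((t * t : ℝ) : ℂ) • (1 : C) := by
        rw [hb, star_add, ha.star_eq, star_smul, star_one, add_mul, mul_add, mul_add,
          mul_smul_comm, smul_mul_assoc, smul_mul_assoc, mul_one, one_mul, one_mul]
        have h4 : star ((t : ℂ) * Complex.I) = -((t : ℂ) * Complex.I) := by simp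
        have h5 : star ((t : ℂ) * Complex.I) • ((t : ℂ) * Complex.I) • (1 : C)
            = ((t * t : ℝ) : ℂ) • (1 : C) := by
          rw [h4, smul_smul]
          congr 1
          push_cast
          linear_combination (-(t : ℂ) * t) * Complex.I_mul_I
        rw [h5, h4, neg_smul]
        abel
      have h4 : ‖b‖ * ‖b‖ ≤ ‖a‖ * ‖a‖ + t * t := by
        rw [← CStarRing.norm_star_mul_self, h3]
        refine (norm_add_le _ _).trans (add_le_add (norm_mul_le _ _) ?_)
        rw [norm_smul, h1, mul_one, Complex.norm_real, Real.norm_of_nonneg (mul_self_nonneg t)]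
      have h5 := hle b
      have h6 : f b = f a + (t : ℂ) * Complex.I := by rw [hb, map_add, map_smul, hf1]; simp
      have h7 := (Complex.abs_im_le_norm (f b)).trans h5
      rw [h6] at h7
      simp only [Complex.add_im, Complex.mul_im, Complex.ofReal_re, Complex.I_im, mul_one,
        Complex.ofReal_im, Complex.I_re, mul_zero, add_zero] at h7
      have h8 := mul_self_le_mul_self (abs_nonneg _) h7
      rw [abs_mul_abs_self] at h8
      nlinarith
    by_contra h0
    have h3 := h2 ((‖a‖ * ‖a‖ + 1) / (2 * (f a).im))
    rw [mul_div_cancel₀ _ (mul_ne_zero two_ne_zero h0)] at h3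
    nlinarith [mul_self_nonneg (f a).im]
  refine ⟨⟨f, by simpa using hf1, fun b => ?_⟩⟩
  have hb := star_mul_self_nonneg b
  have hbsa := IsSelfAdjoint.star_mul_self b
  obtain ⟨a, ha⟩ : ∃ a, a = star b * b := ⟨_, rfl⟩
  rw [← ha] at hb hbsa ⊢
  -- positivity follows from the bound for the value at `‖a‖ - a`
  have h2 : ‖‖a‖ • (1 : C) - a‖ ≤ ‖a‖ := by
    refine norm_le_of_nonneg_of_le_smul_one ?_ ?_ (norm_nonneg _)
    · have := hbsa.le_algebraMap_norm_self
      rwa [Algebra.algebraMap_eq_smul_one, ← sub_nonneg] at this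
    · rwa [sub_le_self_iff]
  have h3 := (Complex.re_le_norm _).trans ((hle _).trans h2)
  rw [map_sub, ← Complex.coe_smul, map_smul, hf1, Complex.sub_re] at h3
  simp only [smul_eq_mul, mul_one, Complex.ofReal_re] at h3
  refine Complex.nonneg_iff.mpr ⟨?_, (him a hbsa).symm⟩
  change 0 ≤ (f a).re
  linarith

lemma MinTensor.nontrivial {ι : Type*} {A : ι → Type*} [∀ k, CStarAlgebra (A k)]
    [∀ k, Nontrivial (A k)] : Nontrivial (MinTensor A) := by
  refine ⟨1, 0, fun h => ?_⟩
  obtain ⟨φ⟩ : Nonempty (∀ k, CStarState (A k)) :=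
    Classical.nonempty_pi.mpr fun k => nonempty_cstarState (A k)
  obtain ⟨x, hx⟩ : ∃ x : TensorIndex A, x = (φ, ⟨1, by simp⟩) := ⟨_, rfl⟩
  have h1 : KernelSpace.delta (posSemidef_tensorKernel A) x = 0 := by
    have := congrArg (fun T => val A T (KernelSpace.delta (posSemidef_tensorKernel A) x)) h
    rw [map_one (val A), map_zero (val A)] at this
    exact this
  have h2 := KernelSpace.inner_delta (posSemidef_tensorKernel A) x x
  rw [h1, inner_zero_left, tensorKernel, Matrix.of_apply, if_pos rfl, hx] at h2
  simp [(φ _).map_one] at h2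

/-- A factor in which nonzero positive elements are full embeds in the tensor product, since the
images of such elements are full, hence nonzero. -/
lemma MinTensor.not_finiteDimensional {ι : Type*} {A : ι → Type*} [∀ k, CStarAlgebra (A k)]
    [Nontrivial (MinTensor A)] {k : ι} (hA : ∀ x : A k, 0 ≤ x → x ≠ 0 → IsFullElement x)
    (hk : ¬ FiniteDimensional ℂ (A k)) : ¬ FiniteDimensional ℂ (MinTensor A) := by
  intro h
  refine hk (FiniteDimensional.of_injective
    ((incl A k : A k →⋆ₐ[ℂ] MinTensor A) : A k →ₗ[ℂ] MinTensor A) ?_)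
  rw [injective_iff_map_eq_zero]
  intro a ha
  by_contra ha0
  have h1 : star a * a ≠ 0 := fun h => ha0 ((CStarRing.star_mul_self_eq_zero_iff a).mp h)
  refine ((hA _ (star_mul_self_nonneg a) h1).map (incl A k)).ne_zero ?_
  rw [map_mul]
  have ha' : incl A k a = 0 := ha
  rw [ha', mul_zero]

end States

section Fullness

variable {n : ℕ} {A : Fin n → Type*} [∀ k, CStarAlgebra (A k)]

namespace MinTensor

lemma tprod_sum {J : Fin n → Type*} [∀ k, Fintype (J k)] (g : ∀ k, J k → A k) :
    tprod (fun k => ∑ j, g k j) = ∑ r : ∀ k, J k, tprod fun k => g k (r k) := by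
  classical
  exact ContinuousMultilinearMap.map_sum _ _

/-- An elementary tensor of full elements is full: the unit is the tensor product of the units, each
of which is a sum of conjugates. -/
lemma isFullElement_tprod {x : ∀ k, A k} (hx : ∀ k, IsFullElement (x k)) :
    IsFullElement (tprod x) := by
  choose J hJ v hv using hx
  refine ⟨∀ k, J k, inferInstance, fun r => tprod fun k => v k (r k), ?_⟩
  have h1 := tprod_sum fun k j => v k j * x k * star (v k j)
  simp only [hv] at h1
  rw [← tprod_one]
  refine Eq.trans ?_ h1.symm
  refine Finset.sum_congr rfl fun r _ => ?_
  rw [star_tprod, ← tprod_mul, ← tprod_mul]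
  rfl

lemma isFullElement (hA : ∀ k, ∀ x : A k, 0 ≤ x → x ≠ 0 → IsFullElement x) (y : MinTensor A)
    (hy : 0 ≤ y) (hy0 : y ≠ 0) : IsFullElement y := by
  obtain ⟨x, hx, w, hw⟩ := exists_tprod_dominated hy hy0
  refine (isFullElement_tprod fun k => hA k (x k) (hx k).1 fun h => ?_).of_le hw
  have := (hx k).2
  rw [h, norm_zero] at this
  exact zero_ne_one this

/-- A lower bound for the norm of an elementary tensor of positive elements, obtained by cutting
the factors down to the top of their spectra. -/
lemma pow_le_norm_tprod [Nontrivial (MinTensor A)]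
    (hA : ∀ k, ∀ x : A k, 0 ≤ x → x ≠ 0 → IsFullElement x) {z : ∀ k, A k} (hz : ∀ k, 0 ≤ z k)
    {c : ℝ} (hc : 0 ≤ c) (hcz : ∀ k, c < ‖z k‖) : c ^ n ≤ ‖tprod z‖ := by
  have hnt : ∀ k, Nontrivial (A k) := fun k =>
    ⟨z k, 0, norm_pos_iff.mp (hc.trans_lt (hcz k))⟩
  choose g hg hg1 hgle _ _ using fun k =>
    exists_concentrated (hz k) (η := ‖z k‖ - c) (sub_pos.mpr (hcz k))
  have hgsa := fun k => IsSelfAdjoint.of_nonneg (hg k)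
  have hggn : ∀ k, 0 ≤ g k * g k := fun k => (hgsa k).mul_self_nonneg
  have hgg0 : ∀ k, g k * g k ≠ 0 := fun k h => by
    have h1 : g k = 0 := (CStarRing.star_mul_self_eq_zero_iff (g k)).mp (by
      rwa [(hgsa k).star_eq])
    have h2 := hg1 k
    rw [h1, norm_zero] at h2
    exact zero_ne_one h2
  have hfull := isFullElement_tprod fun k => hA k _ (hggn k) (hgg0 k)
  have hQ0 := tprod_nonneg hggn
  obtain ⟨Q, hQ⟩ : ∃ Q, Q = tprod fun k => g k * g k := ⟨_, rfl⟩
  rw [← hQ] at hfull hQ0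
  have h1 : c ^ n • Q ≤ ‖tprod z‖ • Q := by
    have e1 : Q = tprod g * tprod g := by rw [hQ, ← tprod_mul]; rfl
    have e2 := tprod_mono (x := fun k => c • (g k * g k))
      (y := fun k => g k * z k * g k) (fun k => smul_nonneg hc (hggn k))
      fun k => by
        have := hgle k
        rwa [sub_sub_cancel] at this
    rw [tprod_real_smul, ← hQ] at e2
    have e3 : (tprod fun k => g k * z k * g k) = tprod g * tprod z * tprod g := by
      rw [← tprod_mul, ← tprod_mul]; rfl
    rw [e3] at e2
    have hgs : IsSelfAdjoint (tprod g) := IsSelfAdjoint.of_nonneg (tprod_nonneg hg)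
    have e4 := hgs.conjugate_le_conjugate
      (IsSelfAdjoint.of_nonneg (tprod_nonneg hz)).le_algebraMap_norm_self
    rw [Algebra.algebraMap_eq_smul_one, mul_smul_comm, smul_mul_assoc, mul_one, ← e1] at e4
    exact e2.trans e4
  by_contra! h2
  have h3 : (c ^ n - ‖tprod z‖) • Q ≤ 0 := by rwa [sub_smul, sub_nonpos]
  have h4 := smul_le_smul_of_nonneg_left h3 (inv_nonneg.mpr (sub_pos.mpr h2).le)
  rw [smul_smul, inv_mul_cancel₀ (sub_pos.mpr h2).ne', one_smul, smul_zero] at h4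
  exact hfull.ne_zero (le_antisymm h4 hQ0)

/-- Below every nonzero positive element of the tensor product there is a nonzero positive element
of a given factor: the other components of an elementary tensor are full, and the orthogonal copies
that are needed to sum up conjugates of them can be made in the given factor. -/
lemma exists_incl_dominated (hA : ∀ k, ∀ x : A k, 0 ≤ x → x ≠ 0 → IsFullElement x) (k : Fin n)
    (hk : ¬ FiniteDimensional ℂ (A k)) {d : MinTensor A} (hd : 0 ≤ d) (hd0 : d ≠ 0) :
    ∃ Z : A k, 0 ≤ Z ∧ Z ≠ 0 ∧ Dominated (incl A k Z) d := by
  classical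
  obtain ⟨x, hx, hxd⟩ := exists_tprod_dominated hd hd0
  have hx0 : ∀ l, x l ≠ 0 := fun l h => by
    have := (hx l).2
    rw [h, norm_zero] at this
    exact zero_ne_one this
  have hv : ∀ l, ∃ (J : Type) (_ : Fintype J) (v : J → A l), ∀ w : A k,
      ∑ j, v j * Function.update x k w l * star (v j) = Function.update (1 : ∀ l, A l) k w l := by
    intro l
    by_cases h : l = k
    · subst h
      exact ⟨Unit, inferInstance, fun _ => 1, fun w => by simp⟩
    · obtain ⟨J, hJ, v, hv⟩ := hA l (x l) (hx l).1 (hx0 l)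
      refine ⟨J, hJ, v, fun w => ?_⟩
      rw [Function.update_of_ne h, Function.update_of_ne h]
      exact hv
  choose J hJ v hv using hv
  obtain ⟨z, Z, hZ, hZ0, hzz, hZz⟩ := exists_orthogonal_copies (hA k) hk (∀ l, J l) (hx k).1 (hx0 k)
  refine ⟨Z, hZ, hZ0, Dominated.trans ?_ hxd⟩
  obtain ⟨m, hm⟩ : ∃ m : (∀ l, J l) → ∀ l, A l,
      m = fun r l => v l (r l) * Function.update (1 : ∀ l, A l) k (z r) l := ⟨_, rfl⟩
  refine ⟨∑ r, tprod (m r), ?_⟩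
  have h1 : ∀ r r', tprod (m r) * tprod x * star (tprod (m r'))
      = tprod fun l => m r l * x l * star (m r' l) := fun r r' => by
    rw [star_tprod, ← tprod_mul, ← tprod_mul]; rfl
  have h2 : (∑ r, tprod (m r)) * tprod x * star (∑ r, tprod (m r))
      = ∑ r, tprod fun l => m r l * x l * star (m r l) := by
    rw [star_sum, Finset.sum_mul, Finset.sum_mul_sum]
    refine Finset.sum_congr rfl fun r _ => ?_
    rw [Finset.sum_eq_single r (fun r' _ hr' => ?_) (fun h => absurd (Finset.mem_univ r) h), h1]
    rw [h1]
    refine ContinuousMultilinearMap.map_coord_zero _ k ?_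
    rw [hm]
    simp only [Function.update_self, star_mul]
    rw [show v k (r k) * z r * x k * (star (z r') * star (v k (r' k)))
      = v k (r k) * (z r * x k * star (z r')) * star (v k (r' k)) by simp only [mul_assoc],
      hzz r r' hr'.symm, mul_zero, zero_mul]
  have h3 := tprod_sum fun l j => v l j * Function.update x k Z l * star (v l j)
  simp only [hv] at h3
  have h4 : incl A k Z = tprod fun l => Function.update (1 : ∀ l, A l) k Z l := incl_eq_tprod k Z
  rw [h4, h3, h2]
  refine Finset.sum_le_sum fun r _ => tprod_mono (fun l => ?_) fun l => ?_
  · refine star_right_conjugate_nonneg ?_ _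
    by_cases h : l = k
    · subst h; rwa [Function.update_self]
    · rw [Function.update_of_ne h]; exact (hx l).1
  · rw [hm]
    by_cases h : l = k
    · subst h
      simp only [Function.update_self, star_mul]
      rw [show v l (r l) * z r * x l * (star (z r) * star (v l (r l)))
        = v l (r l) * (z r * x l * star (z r)) * star (v l (r l)) by simp only [mul_assoc]]
      exact star_right_conjugate_le_conjugate (hZz r) _
    · simp only [Function.update_of_ne h, Pi.one_apply, mul_one]
      exact le_rfl

/-- The complement of an elementary tensor of projections lies under the sum of the complements in
the factors, by exchanging the factors for `1` one after the other. -/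
lemma one_sub_tprod_le {p : ∀ k, A k} (hp : ∀ k, IsStarProjection (p k)) :
    1 - tprod p ≤ ∑ k, incl A k (1 - p k) := by
  classical
  have h1 : ∀ s : Finset (Fin n), 1 - tprod (s.piecewise p 1) ≤ ∑ k ∈ s, incl A k (1 - p k) := by
    intro s
    induction s using Finset.induction_on with
    | empty => simp [tprod_one]
    | insert k s hk ih =>
      have hsk : s.piecewise p 1 k = 1 := by simp [hk]
      have h2 : tprod (s.piecewise p 1) - tprod (Function.update (s.piecewise p 1) k (p k))
          = tprod (Function.update (s.piecewise p 1) k (1 - p k)) := by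
        rw [ContinuousMultilinearMap.map_update_sub]
        congr 2
        rw [eq_comm, Function.update_eq_self_iff, hsk]
      have hnn : ∀ l, 0 ≤ s.piecewise p 1 l ∧ s.piecewise p 1 l ≤ 1 := fun l => by
        by_cases hl : l ∈ s
        · simpa [hl] using ⟨(hp l).nonneg, (hp l).le_one⟩
        · simp [hl]
      have h3 : tprod (Function.update (s.piecewise p 1) k (1 - p k)) ≤ incl A k (1 - p k) := by
        rw [incl_eq_tprod]
        refine tprod_mono (fun l => ?_) fun l => ?_ <;>
        by_cases hl : l = k
        · subst hl; rw [Function.update_self]; exact (hp l).one_sub.nonneg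
        · rw [Function.update_of_ne hl]; exact (hnn l).1
        · subst hl; rw [Function.update_self, Function.update_self]
        · rw [Function.update_of_ne hl, Function.update_of_ne hl]; exact (hnn l).2
      rw [Finset.piecewise_insert, Finset.sum_insert hk]
      calc _ = (tprod (s.piecewise p 1) - tprod (Function.update (s.piecewise p 1) k (p k)))
            + (1 - tprod (s.piecewise p 1)) := by abel
        _ ≤ _ := by rw [h2]; exact add_le_add h3 ih
  simpa using h1 Finset.univ

lemma exists_commutator_small_finset (F : Finset (MinTensor A)) {ε : ℝ} (hε : 0 < ε) :
    ∃ (F' : ∀ k, Finset (A k)) (κ : ℝ), 0 < κ ∧ ∀ f : ∀ k, A k, (∀ k, IsStarProjection (f k)) →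
      (∀ k, ∀ a ∈ F' k, ‖f k * a - a * f k‖ < κ) →
        ∀ T ∈ F, ‖tprod f * T - T * tprod f‖ < ε := by
  classical
  induction F using Finset.induction_on with
  | empty => exact ⟨fun _ => ∅, 1, one_pos, fun f _ _ T hT => absurd hT (Finset.notMem_empty T)⟩
  | insert T F _ ih =>
    obtain ⟨F₁, κ₁, hκ₁, h₁⟩ := ih
    obtain ⟨F₂, κ₂, hκ₂, h₂⟩ := exists_commutator_small T hε
    refine ⟨fun k => F₁ k ∪ F₂ k, min κ₁ κ₂, lt_min hκ₁ hκ₂, fun f hf hc S hS => ?_⟩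
    rcases Finset.mem_insert.mp hS with rfl | hS
    · exact h₂ f hf fun k a ha =>
        (hc k a (Finset.mem_union_right _ ha)).trans_le (min_le_right _ _)
    · exact h₁ f hf (fun k a ha =>
        (hc k a (Finset.mem_union_left _ ha)).trans_le (min_le_left _ _)) S hS

end MinTensor

end Fullness

/-! ### Exact Rokhlin families for finite tensor products of actions -/

section FiniteTensor

variable {n : ℕ} {A : Fin n → Type*} [∀ k, CStarAlgebra (A k)]

lemma tensorAction_tprod {G : Fin n → Type*} [∀ k, Group (G k)] [∀ k, TopologicalSpace (G k)]
    (α : ∀ k, CStarAction (G k) (A k)) (g : ∀ k, G k) (x : ∀ k, A k) :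
    (tensorAction α).toAut g (MinTensor.tprod x)
      = MinTensor.tprod fun k => (α k).toAut (g k) (x k) := by
  rw [MinTensor.tprod_apply, MinTensor.tprod_apply, map_list_prod, List.map_map]
  congr 1
  refine List.map_congr_left fun k _ => ?_
  exact tensorAction_incl α g k (x k)

/-- Compressing by a projection that almost commutes with `w` cannot shrink `y` much more than it
shrinks an element which is dominated by `y` by means of `w`. -/
lemma norm_compression_le {C : Type*} [CStarAlgebra C] {X y w E : C} (hX : 0 ≤ X)
    (h : X ≤ w * y * star w) (hE : IsStarProjection E) {κ : ℝ} (hκ : ‖E * w - w * E‖ ≤ κ) :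
    ‖E * X * E‖ ≤ ‖w‖ * ‖w‖ * ‖E * y * E‖ + 2 * κ * (‖y‖ * ‖w‖) := by
  have hEsa := hE.isSelfAdjoint
  have hE1 : ‖E‖ ≤ 1 := hE.norm_le
  have hκ0 : 0 ≤ κ := (norm_nonneg _).trans hκ
  have hκ' : ‖star w * E - E * star w‖ ≤ κ := by
    have : star w * E - E * star w = star (E * w - w * E) := by
      rw [star_sub, star_mul, star_mul, hEsa.star_eq]
    rwa [this, norm_star]
  have h1 : ‖E * X * E‖ ≤ ‖E * (w * y * star w) * E‖ :=
    CStarAlgebra.norm_le_norm_of_nonneg_of_le (hEsa.conjugate_nonneg hX)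
      (hEsa.conjugate_le_conjugate h)
  have h2 : E * (w * y * star w) * E = w * (E * y * E) * star w
      + (E * w - w * E) * y * (star w * E) + w * E * y * (star w * E - E * star w) := by
    simp only [sub_mul, mul_sub, mul_assoc]
    abel
  have hwE : ‖star w * E‖ ≤ ‖w‖ := by
    refine (norm_mul_le _ _).trans ?_
    rw [norm_star]
    exact mul_le_of_le_one_right (norm_nonneg _) hE1
  have hwE' : ‖w * E‖ ≤ ‖w‖ := (norm_mul_le _ _).trans (mul_le_of_le_one_right (norm_nonneg _) hE1)
  have h3 : ‖w * (E * y * E) * star w‖ ≤ ‖w‖ * ‖w‖ * ‖E * y * E‖ := by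
    refine (norm_mul_le _ _).trans ?_
    rw [norm_star, mul_right_comm]
    exact mul_le_mul_of_nonneg_right (norm_mul_le _ _) (norm_nonneg _)
  have h4 : ‖(E * w - w * E) * y * (star w * E)‖ ≤ κ * ‖y‖ * ‖w‖ := by
    refine (norm_mul_le _ _).trans (mul_le_mul ((norm_mul_le _ _).trans ?_) hwE (norm_nonneg _)
      (by positivity))
    exact mul_le_mul_of_nonneg_right hκ (norm_nonneg _)
  have h5 : ‖w * E * y * (star w * E - E * star w)‖ ≤ ‖w‖ * ‖y‖ * κ := by
    refine (norm_mul_le _ _).trans (mul_le_mul ((norm_mul_le _ _).trans ?_) hκ' (norm_nonneg _)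
      (by positivity))
    exact mul_le_mul_of_nonneg_right hwE' (norm_nonneg _)
  rw [h2] at h1
  have h6 := h1.trans ((norm_add_le _ _).trans (add_le_add ((norm_add_le _ _).trans
    (add_le_add h3 h4)) h5))
  linarith

lemma IsRokhlinFamily.tprod {G : Fin n → Type*} [∀ k, Group (G k)] [∀ k, Fintype (G k)]
    [∀ k, TopologicalSpace (G k)] {α : ∀ k, CStarAction (G k) (A k)} {f : ∀ k, G k → A k}
    (hf : ∀ k, IsRokhlinFamily (α k).toAut (f k)) :
    IsRokhlinFamily (tensorAction α).toAut fun h => MinTensor.tprod fun k => f k (h k) where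
  proj h := MinTensor.isStarProjection_tprod fun k => (hf k).proj _
  orth g h hgh := by
    obtain ⟨k, hk⟩ := Function.ne_iff.mp hgh
    rw [← MinTensor.tprod_mul]
    exact ContinuousMultilinearMap.map_coord_zero _ k ((hf k).orth _ _ hk)
  equivariant g h := by
    rw [tensorAction_tprod]
    congr 1
    funext k
    exact (hf k).equivariant _ _

/-- A tensor product of finitely many actions with the tracial Rokhlin property has exact Rokhlin
families. The complement of the sum of a tensor product of Rokhlin families is dominated by a sum
of the complements in the factors, and an element that dominates an elementary tensor cannot become
small by compression. -/
theorem hasExactRokhlin_tensorAction (hn : 0 < n) {G : Fin n → Type*} [∀ k, Group (G k)]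
    [∀ k, Fintype (G k)] [∀ k, TopologicalSpace (G k)] (α : ∀ k, CStarAction (G k) (A k))
    (hα : ∀ k, HasTracialRokhlinProperty (α k)) : HasExactRokhlin (tensorAction α).toAut := by
  classical
  have hnt : ∀ k, Nontrivial (A k) := fun k => (hα k).simple.nontrivial
  have hnt' : Nontrivial (MinTensor A) := MinTensor.nontrivial
  have hA : ∀ k, ∀ x : A k, 0 ≤ x → x ≠ 0 → IsFullElement x :=
    fun k x hx hx0 => (hα k).simple.isFullElement hx hx0
  have hfull := MinTensor.isFullElement hA
  have hinf := MinTensor.not_finiteDimensional (hA ⟨0, hn⟩) (hα _).infiniteDimensional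
  intro y hy hy0
  obtain ⟨x, hx, w, hw⟩ := MinTensor.exists_tprod_dominated hy hy0
  -- in every factor the compression of `x k` has norm at least `1 / 4`, hence that of `tprod x` has
  -- norm at least `(1 / 8) ^ n`
  obtain ⟨c, hc⟩ : ∃ c : ℝ, c = (1 / 8) ^ n := ⟨_, rfl⟩
  have hc0 : 0 < c := by rw [hc]; positivity
  refine ⟨c / (2 * (‖w‖ * ‖w‖ + 1)), by positivity, fun F ε hε z hz hz0 => ?_⟩
  obtain ⟨κ, hκ⟩ : ∃ κ : ℝ, κ = min ε (c / (4 * (‖y‖ * ‖w‖ + 1))) := ⟨_, rfl⟩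
  have hκ0 : 0 < κ := by rw [hκ]; exact lt_min hε (by positivity)
  -- the defects in the factors are dominated by orthogonal copies of elements under `z`
  obtain ⟨zz, Z, hZ, hZ0, hzz, hZz⟩ := exists_orthogonal_copies hfull hinf (Fin n) hz hz0
  choose Y hY hY0 T hT using fun k =>
    MinTensor.exists_incl_dominated hA k (hα k).infiniteDimensional hZ hZ0
  obtain ⟨F', μ, hμ, hF'⟩ := MinTensor.exists_commutator_small_finset (insert w F) hκ0
  choose f hf hfc hfY hfx using fun k => (hα k).exists_isRokhlinFamily_of_pair (F' k)
    (ε := μ / Fintype.card (G k)) (div_pos hμ (Nat.cast_pos.mpr Fintype.card_pos)) (hx k).1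
    (hx k).2 (hY k) (hY0 k)
  have hproj : ∀ k, IsStarProjection (∑ g, f k g) := fun k => (hf k).isStarProjection_sum
  have hsum : ∑ h : ∀ k, G k, MinTensor.tprod (fun k => f k (h k))
      = MinTensor.tprod fun k => ∑ g, f k g := (MinTensor.tprod_sum f).symm
  refine ⟨_, IsRokhlinFamily.tprod hf, fun h a ha => ?_, ?_, ?_⟩
  · refine (hF' _ (fun k => (hf k).proj _) (fun k a ha => (hfc k _ a ha).trans_le ?_) a
      (Finset.mem_insert_of_mem ha)).trans_le (by rw [hκ]; exact min_le_left _ _)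
    exact div_le_self hμ.le (by exact_mod_cast Fintype.card_pos)
  · rw [hsum]
    choose S hS using hfY
    refine ⟨∑ k, MinTensor.incl A k (S k) * T k * zz k, (MinTensor.one_sub_tprod_le hproj).trans ?_⟩
    rw [star_sum, Finset.sum_mul, Finset.sum_mul_sum]
    refine Finset.sum_le_sum fun k _ => ?_
    rw [Finset.sum_eq_single k (fun l _ hl => ?_) (fun h => absurd (Finset.mem_univ k) h)]
    · calc MinTensor.incl A k (1 - ∑ g, f k g)
          ≤ MinTensor.incl A k (S k * Y k * star (S k)) := OrderHomClass.mono _ (hS k)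
        _ = MinTensor.incl A k (S k) * MinTensor.incl A k (Y k) * star (MinTensor.incl A k (S k)) := by
          rw [map_mul, map_mul, map_star]
        _ ≤ MinTensor.incl A k (S k) * (T k * (zz k * z * star (zz k)) * star (T k))
            * star (MinTensor.incl A k (S k)) :=
          star_right_conjugate_le_conjugate
            ((hT k).trans (star_right_conjugate_le_conjugate (hZz k) _)) _
        _ = _ := by simp only [star_mul, mul_assoc]
    · rw [star_mul, show ∀ a : MinTensor A, a * zz k * z * (star (zz l) * star
        (MinTensor.incl A l (S l) * T l)) = a * (zz k * z * star (zz l)) * star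
        (MinTensor.incl A l (S l) * T l) from fun a => by simp only [mul_assoc],
        hzz k l hl.symm, mul_zero, zero_mul]
  · rw [hsum]
    obtain ⟨E, hE⟩ : ∃ E, E = MinTensor.tprod fun k => ∑ g, f k g := ⟨_, rfl⟩
    rw [← hE]
    have hEp : IsStarProjection E := by rw [hE]; exact MinTensor.isStarProjection_tprod hproj
    have hEw : ‖E * w - w * E‖ ≤ c / (4 * (‖y‖ * ‖w‖ + 1)) := by
      rw [hE]
      refine (hF' _ hproj (fun k a ha => ?_) w (Finset.mem_insert_self w F)).le.trans
        (by rw [hκ]; exact min_le_right _ _)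
      rw [Finset.sum_mul, Finset.mul_sum, ← Finset.sum_sub_distrib]
      refine (norm_sum_le _ _).trans_lt ((Finset.sum_lt_sum_of_nonempty Finset.univ_nonempty
        fun g _ => hfc k g a ha).trans_eq ?_)
      rw [Finset.sum_const, nsmul_eq_mul, Finset.card_univ, mul_div_cancel₀]
      exact Nat.cast_ne_zero.mpr Fintype.card_ne_zero
    have h1 := norm_compression_le (MinTensor.tprod_nonneg fun k => (hx k).1) hw hEp hEw
    have h2 : c ≤ ‖E * MinTensor.tprod x * E‖ := by
      have := MinTensor.pow_le_norm_tprod hA (c := 1 / 8)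
        (fun k => (hproj k).isSelfAdjoint.conjugate_nonneg (hx k).1) (by norm_num)
        fun k => lt_of_lt_of_le (by norm_num) (hfx k)
      rw [← hc] at this
      convert this using 2
      rw [hE, ← MinTensor.tprod_mul, ← MinTensor.tprod_mul]
      rfl
    have h3 : 2 * (c / (4 * (‖y‖ * ‖w‖ + 1))) * (‖y‖ * ‖w‖) ≤ c / 2 := by
      have h0 : 0 ≤ ‖y‖ * ‖w‖ := by positivity
      rw [mul_div_assoc', div_mul_eq_mul_div, div_le_div_iff₀ (by positivity) two_pos]
      nlinarith
    rw [div_le_iff₀ (by positivity)]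
    nlinarith [norm_nonneg (E * y * E)]

end FiniteTensor

/-! ### Inclusions of partial tensor products -/

/-- A closed *-subalgebra of a product which is single valued is the graph of a homomorphism on the
first factor, provided that its first components generate that factor. -/
lemma exists_starAlgHom_of_graph {B C : Type*} [CStarAlgebra B] [CStarAlgebra C]
    (D : StarSubalgebra ℂ (B × C)) [hD : IsClosed (D : Set (B × C))]
    (hinj : ∀ d ∈ D, d.1 = 0 → d.2 = 0)
    (hgen : ∀ N : StarSubalgebra ℂ B, IsClosed (N : Set B) → (∀ d ∈ D, d.1 ∈ N) → ∀ b, b ∈ N) :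
    ∃ J : B →⋆ₐ[ℂ] C, ∀ d ∈ D, J d.1 = d.2 := by
  obtain ⟨π, hπ⟩ : ∃ π : D →⋆ₐ[ℂ] B, π = (StarAlgHom.fst ℂ B C).comp D.subtype := ⟨_, rfl⟩
  have hπd : ∀ d : D, π d = d.1.1 := fun d => by rw [hπ]; rfl
  have hπinj : Function.Injective π := by
    rw [injective_iff_map_eq_zero]
    intro d h0
    rw [hπd] at h0
    exact Subtype.ext (Prod.ext h0 (hinj d.1 d.2 h0))
  have hiso : Isometry π := NonUnitalStarAlgHom.isometry π hπinj
  have hπsurj : Function.Surjective π := fun b =>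
    hgen π.range hiso.isClosedEmbedding.isClosed_range (fun d hd => ⟨⟨d, hd⟩, hπd _⟩) b
  obtain ⟨σ, hσ⟩ : ∃ σ : D ≃⋆ₐ[ℂ] B, ∀ d, σ d = π d :=
    ⟨StarAlgEquiv.ofBijective π ⟨hπinj, hπsurj⟩, fun d => rfl⟩
  refine ⟨((StarAlgHom.snd ℂ B C).comp D.subtype).comp (σ.symm : B →⋆ₐ[ℂ] D), fun d hd => ?_⟩
  have h : σ.symm d.1 = ⟨d, hd⟩ := by
    rw [StarAlgEquiv.symm_apply_eq, hσ, hπd]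
  exact congrArg (fun d : D => d.1.2) h

section Embedding

variable {ι ι' : Type*} {A : ι → Type*} [∀ k, CStarAlgebra (A k)] {s : ι' → ι}

/-- The restriction of an index of the defining vectors to a part of the factors. -/
def restrictIndex (hs : Function.Injective s) (x : TensorIndex A) :
    TensorIndex fun k => A (s k) :=
  (fun k => x.1 (s k), ⟨fun k => x.2.1 (s k), x.2.2.preimage hs.injOn⟩)

open Classical in
/-- The part of the inner product of two defining vectors that belongs to the factors outside the
range of `s`. -/
def tailKernel (s : ι' → ι) (x y : TensorIndex A) : ℂ :=
  if x.1 = y.1 then ∏ᶠ k ∈ (Set.range s)ᶜ, (x.1 k).toLin (star (x.2.1 k) * y.2.1 k) else 0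

lemma tensorKernel_eq_mul_tailKernel (hs : Function.Injective s) (x y : TensorIndex A) :
    tensorKernel A x y = tensorKernel (fun k => A (s k)) (restrictIndex hs x) (restrictIndex hs y)
      * tailKernel s x y := by
  by_cases h : x.1 = y.1
  · have h' : (restrictIndex hs x).1 = (restrictIndex hs y).1 := by simp only [restrictIndex, h]
    have hf := hasFiniteMulSupport_tensorKernel x y
    rw [tensorKernel, tensorKernel, Matrix.of_apply, Matrix.of_apply, tailKernel, if_pos h,
      if_pos h, if_pos h', ← finprod_mem_univ, ← Set.union_compl_self (Set.range s),
      finprod_mem_union' disjoint_compl_right (hf.subset Set.inter_subset_right)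
        (hf.subset Set.inter_subset_right), finprod_mem_range hs]
    rfl
  · rw [tensorKernel, Matrix.of_apply, if_neg h, tailKernel, if_neg h, mul_zero]

lemma restrictIndex_tensorAct (hs : Function.Injective s) (k : ι') (a : A (s k))
    (x : TensorIndex A) :
    restrictIndex hs (tensorAct (s k) a x)
      = tensorAct (A := fun k => A (s k)) k a (restrictIndex hs x) := by
  classical
  ext l
  · rfl
  · by_cases h : l = k
    · subst h
      simp [restrictIndex, tensorAct]
    · simp only [restrictIndex, tensorAct, Function.update_of_ne h,
        Function.update_of_ne (hs.ne h)]

lemma tailKernel_tensorAct (k : ι') (a : A (s k)) (x y : TensorIndex A) :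
    tailKernel s (tensorAct (s k) a x) y = tailKernel s x y := by
  have h1 : (tensorAct (s k) a x).1 = x.1 := rfl
  rw [tailKernel, tailKernel, h1]
  congr 1
  refine finprod_congr fun l => finprod_congr fun hl => ?_
  rw [tensorAct_apply_of_ne fun h => hl ⟨k, h.symm⟩]

namespace MinTensor

/-- An operator on the partial tensor product and an operator on the tensor product are related if
the matrix coefficients of the second one are those of the first one, up to the inner products in
the remaining factors. -/
def Related (hs : Function.Injective s) (d : MinTensor (fun k => A (s k)) × MinTensor A) : Prop :=
  ∀ x y, ⟪KernelSpace.delta (posSemidef_tensorKernel A) x, val A d.2 (KernelSpace.delta _ y)⟫_ℂ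
    = ⟪KernelSpace.delta (posSemidef_tensorKernel _) (restrictIndex hs x),
        val _ d.1 (KernelSpace.delta _ (restrictIndex hs y))⟫_ℂ * tailKernel s x y

variable (hs : Function.Injective s)

lemma related_one : Related hs (1 : MinTensor (fun k => A (s k)) × MinTensor A) := fun x y => by
  rw [Prod.snd_one, Prod.fst_one, map_one (val A), map_one (val fun k => A (s k))]
  change ⟪_, KernelSpace.delta _ y⟫_ℂ = ⟪_, KernelSpace.delta _ _⟫_ℂ * _
  rw [KernelSpace.inner_delta, KernelSpace.inner_delta, tensorKernel_eq_mul_tailKernel hs]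

variable {hs} in
lemma Related.add {d e : MinTensor (fun k => A (s k)) × MinTensor A} (hd : Related hs d)
    (he : Related hs e) : Related hs (d + e) := fun x y => by
  rw [Prod.snd_add, Prod.fst_add, map_add (val A), map_add (val fun k => A (s k)), add_apply, add_apply,
    inner_add_right, inner_add_right, hd, he, add_mul]

variable {hs} in
lemma Related.smul {d : MinTensor (fun k => A (s k)) × MinTensor A} (hd : Related hs d) (r : ℂ) :
    Related hs (r • d) := fun x y => by
  rw [Prod.smul_snd, Prod.smul_fst, map_smul (val A), map_smul (val fun k => A (s k)), smul_apply, smul_apply,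
    inner_smul_right, inner_smul_right, hd, mul_assoc]

lemma isClosed_related :
    IsClosed {d : MinTensor (fun k => A (s k)) × MinTensor A | Related hs d} := by
  simp only [Related, Set.ofPred_forall]
  refine isClosed_iInter fun x => isClosed_iInter fun y => isClosed_eq ?_ ?_
  · have h : Continuous fun d : MinTensor (fun k => A (s k)) × MinTensor A => val A d.2 :=
      isometry_val.continuous.comp continuous_snd
    fun_prop
  · have h : Continuous fun d : MinTensor (fun k => A (s k)) × MinTensor A =>
        val (fun k => A (s k)) d.1 := isometry_val.continuous.comp continuous_fst
    fun_prop

variable (A s) in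
/-- The diagonal representation of a factor on the partial and on the whole tensor product. -/
def pairIncl (k : ι') : A (s k) →⋆ₐ[ℂ] MinTensor (fun k => A (s k)) × MinTensor A :=
  (incl (fun k => A (s k)) k).prod (incl A (s k))

lemma inner_delta_val_incl_mul (k : ι) (a : A k) (T : MinTensor A) (x y : TensorIndex A) :
    ⟪KernelSpace.delta (posSemidef_tensorKernel A) x,
        val A (incl A k a * T) (KernelSpace.delta _ y)⟫_ℂ
      = ⟪KernelSpace.delta (posSemidef_tensorKernel A) (tensorAct k (star a) x),
        val A T (KernelSpace.delta _ y)⟫_ℂ := by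
  rw [← val_incl_delta, map_star (incl A k), map_star (val A), map_mul (val A), mul_apply_eq_comp,
    ContinuousLinearMap.star_eq_adjoint, ContinuousLinearMap.adjoint_inner_left]

variable {hs} in
lemma Related.pairIncl_mul {d : MinTensor (fun k => A (s k)) × MinTensor A} (hd : Related hs d)
    (k : ι') (a : A (s k)) : Related hs (pairIncl A s k a * d) := fun x y => by
  have h1 := inner_delta_val_incl_mul (A := fun k => A (s k)) k a d.1 (restrictIndex hs x)
    (restrictIndex hs y)
  refine (inner_delta_val_incl_mul (s k) a d.2 x y).trans ((hd _ y).trans ?_)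
  rw [restrictIndex_tensorAct, tailKernel_tensorAct]
  exact congrArg (· * tailKernel s x y) h1.symm

/-- The multipliers of the related pairs form a closed *-subalgebra, which contains the diagonal
copies of the factors. -/
def relatedMultiplier : StarSubalgebra ℂ (MinTensor (fun k => A (s k)) × MinTensor A) where
  carrier := {d | ∀ r, Related hs r → Related hs (d * r) ∧ Related hs (star d * r)}
  mul_mem' {d e} hd he r hr := by
    rw [star_mul, mul_assoc, mul_assoc]
    exact ⟨(hd _ (he r hr).1).1, (he _ (hd r hr).2).2⟩
  add_mem' {d e} hd he r hr := by
    rw [star_add, add_mul, add_mul]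
    exact ⟨(hd r hr).1.add (he r hr).1, (hd r hr).2.add (he r hr).2⟩
  algebraMap_mem' c r hr := by
    rw [Algebra.algebraMap_eq_smul_one, star_smul, star_one, smul_mul_assoc, smul_mul_assoc,
      one_mul]
    exact ⟨hr.smul c, hr.smul _⟩
  star_mem' {d} hd r hr := by
    rw [star_star]
    exact ⟨(hd r hr).2, (hd r hr).1⟩

lemma isClosed_relatedMultiplier :
    IsClosed (relatedMultiplier (A := A) hs : Set (MinTensor (fun k => A (s k)) × MinTensor A)) := by
  have h : (relatedMultiplier (A := A) hs : Set (MinTensor (fun k => A (s k)) × MinTensor A))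
      = ⋂ r ∈ {r | Related hs r}, ((· * r) ⁻¹' {d | Related hs d})
        ∩ ((fun d => star d * r) ⁻¹' {d | Related hs d}) := by
    ext d
    simp [relatedMultiplier]
  rw [h]
  refine isClosed_biInter fun r _ => IsClosed.inter ?_ ?_
  · exact (isClosed_related hs).preimage (by fun_prop)
  · exact (isClosed_related hs).preimage (by fun_prop)

lemma related_of_mem {d : MinTensor (fun k => A (s k)) × MinTensor A}
    (hd : d ∈ generatedBy (pairIncl A s)) : Related hs d := by
  have h := generatedBy.le_of_isClosed (pairIncl A s) (N := relatedMultiplier hs)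
    (isClosed_relatedMultiplier hs) (fun k a r hr => ?_) hd
  · simpa using (h 1 (related_one hs)).1
  · rw [← map_star (pairIncl A s k)]
    exact ⟨hr.pairIncl_mul k a, hr.pairIncl_mul k (star a)⟩

include hs in
lemma exists_embed : ∃ J : MinTensor (fun k => A (s k)) →⋆ₐ[ℂ] MinTensor A,
    ∀ (k : ι') (a : A (s k)), J (incl (fun k => A (s k)) k a) = incl A (s k) a := by
  obtain ⟨J, hJ⟩ := exists_starAlgHom_of_graph (generatedBy (pairIncl A s)) (fun d hd h1 =>
    val_injective (KernelSpace.op_ext fun x y => by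
      rw [related_of_mem hs hd, h1, map_zero (val fun k => A (s k)), map_zero (val A), zero_apply,
        zero_apply, inner_zero_right, inner_zero_right, zero_mul]))
    (fun N hN h b => mem_of_isClosed hN
      (fun k a => h _ (generatedBy.apply_mem (pairIncl A s) k a)) b)
  exact ⟨J, fun k a => hJ _ (generatedBy.apply_mem (pairIncl A s) k a)⟩

/-- The inclusion of a partial tensor product in the tensor product, `T ↦ T ⊗ 1`. -/
def embed : MinTensor (fun k => A (s k)) →⋆ₐ[ℂ] MinTensor A := (exists_embed hs).choose

lemma embed_incl (k : ι') (a : A (s k)) : embed hs (incl (fun k => A (s k)) k a)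
    = incl A (s k) a :=
  (exists_embed hs).choose_spec k a

/-- The inclusions of partial tensor products are equivariant. -/
lemma tensorAction_embed {G : ι → Type*} [∀ k, Group (G k)] [∀ k, TopologicalSpace (G k)]
    (α : ∀ k, CStarAction (G k) (A k)) (g : ∀ k, G k) (T : MinTensor fun k => A (s k)) :
    (tensorAction α).toAut g (embed hs T)
      = embed hs ((tensorAction fun k => α (s k)).toAut (fun k => g (s k)) T) := by
  refine starAlgHom_ext (θ := ((((tensorAction α).toAut g : MinTensor A ≃⋆ₐ[ℂ] MinTensor A) :
    MinTensor A →⋆ₐ[ℂ] MinTensor A)).comp (embed hs))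
    (θ' := (embed hs).comp (((tensorAction fun k => α (s k)).toAut fun k => g (s k) :
      _ ≃⋆ₐ[ℂ] _) : _ →⋆ₐ[ℂ] _)) (fun k a => ?_) T
  change (tensorAction α).toAut g (embed hs (incl (fun k => A (s k)) k a)) = embed hs
    ((tensorAction fun k => α (s k)).toAut (fun k => g (s k)) (incl (fun k => A (s k)) k a))
  rw [tensorAction_incl, embed_incl, embed_incl, tensorAction_incl]

end MinTensor

end Embedding

/-! ### Homomorphisms and domination -/

section Hom

variable {C D : Type*} [CStarAlgebra C] [CStarAlgebra D]

lemma StarAlgHom.continuous_of_cstarAlgebra (θ : C →⋆ₐ[ℂ] D) : Continuous θ :=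
  AddMonoidHomClass.continuous_of_bound θ 1 fun a => by
    rw [one_mul]; exact NonUnitalStarAlgHom.norm_apply_le θ a

lemma StarAlgHom.map_cutDown (θ : C →⋆ₐ[ℂ] D) {δ : ℝ} {b : C} (hb : IsSelfAdjoint b) :
    θ (cutDown δ b) = cutDown δ (θ b) :=
  StarAlgHom.map_cfc θ _ b (by fun_prop) θ.continuous_of_cstarAlgebra hb (hb.map θ)

lemma Dominated.cuntzSubeq {q x : C} (hq : IsStarProjection q) (h : Dominated q x) :
    CuntzSubeq q x := by
  obtain ⟨t, ht⟩ := h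
  refine subset_closure ⟨projNormalizer q (t * x * star t) * t, ?_⟩
  have h1 := projNormalizer_mul_mul_star hq one_pos (smul_le_conj_of_le hq ht)
  simpa only [star_mul, mul_assoc] using h1

lemma DominatedIn.exists_eq {H : Type*} [Group H] {β : H →* (C ≃⋆ₐ[ℂ] C)} {q x : C}
    (hq : IsStarProjection q) (hqf : ∀ h, β h q = q) (hxf : ∀ h, β h x = x)
    (h : DominatedIn β q x) : ∃ v, (∀ h, β h v = v) ∧ v * x * star v = q := by
  obtain ⟨t, htf, ht⟩ := h
  have h0 := smul_le_conj_of_le hq ht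
  refine ⟨projNormalizer q (t * x * star t) * t, fun h => ?_, ?_⟩
  · have h1 := map_projNormalizer (β h : C →⋆ₐ[ℂ] C) hq one_pos h0
    have h2 : β h (projNormalizer q (t * x * star t)) = projNormalizer q (t * x * star t) := by
      refine h1.trans ?_
      change projNormalizer (β h q) (β h (t * x * star t)) = _
      rw [map_mul, map_mul, map_star, hqf, htf, hxf]
    rw [map_mul, h2, htf]
  · have h1 := projNormalizer_mul_mul_star hq one_pos h0
    simpa only [star_mul, mul_assoc] using h1

/-- A *-homomorphism is completely positive. -/
lemma isCompletelyPositive_of_starAlgHom (φ : D →⋆ₙₐ[ℂ] C) :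
    IsCompletelyPositive (φ : D →ₗ[ℂ] C) :=
  ⟨CompletelyPositiveMapClass.toCompletelyPositiveLinearMap φ, rfl⟩

lemma norm_sum_smul_le {H : Type*} [Fintype H] {e : H → C} (he : ∀ h, IsStarProjection (e h))
    (horth : ∀ g h, g ≠ h → e g * e h = 0) (c : H → ℂ) {r : ℝ} (hr : 0 ≤ r)
    (hc : ∀ h, ‖c h‖ ≤ r) : ‖∑ h, c h • e h‖ ≤ r := by
  classical
  have h1 : star (∑ h, c h • e h) * (∑ h, c h • e h) = ∑ h, (‖c h‖ * ‖c h‖) • e h := by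
    rw [star_sum, Finset.sum_mul_sum]
    refine Finset.sum_congr rfl fun g _ => ?_
    rw [Finset.sum_eq_single g (fun h _ hh => by
      rw [star_smul, (he g).isSelfAdjoint.star_eq, smul_mul_assoc, mul_smul_comm,
        horth g h hh.symm, smul_zero, smul_zero]) (fun h => absurd (Finset.mem_univ g) h),
      star_smul, (he g).isSelfAdjoint.star_eq, smul_mul_assoc, mul_smul_comm,
      (he g).isIdempotentElem.eq, smul_smul, ← starRingEnd_apply, Complex.conj_mul', ← pow_two,
      ← Complex.coe_smul]
    push_cast
    rfl
  have hE : IsStarProjection (∑ h, e h) := by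
    refine ⟨?_, ?_⟩
    · change (∑ h, e h) * (∑ h, e h) = ∑ h, e h
      rw [Finset.sum_mul_sum]
      refine Finset.sum_congr rfl fun g _ => ?_
      rw [Finset.sum_eq_single g (fun h _ hh => horth g h hh.symm)
        (fun h => absurd (Finset.mem_univ g) h)]
      exact (he g).isIdempotentElem
    · change star (∑ h, e h) = ∑ h, e h
      rw [star_sum]
      exact Finset.sum_congr rfl fun g _ => (he g).isSelfAdjoint
  have h2 : ∑ h, (‖c h‖ * ‖c h‖) • e h ≤ (r * r) • (1 : C) := by
    calc ∑ h, (‖c h‖ * ‖c h‖) • e h ≤ ∑ h, (r * r) • e h := Finset.sum_le_sum fun h _ =>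
          smul_le_smul_of_nonneg_right (mul_self_le_mul_self (norm_nonneg _) (hc h)) (he h).nonneg
      _ = (r * r) • ∑ h, e h := (Finset.smul_sum ..).symm
      _ ≤ _ := smul_le_smul_of_nonneg_left hE.le_one (mul_nonneg hr hr)
  have h3 := norm_le_of_nonneg_of_le_smul_one (star_mul_self_nonneg (∑ h, c h • e h))
    (h1.trans_le h2) (mul_nonneg hr hr)
  rw [CStarRing.norm_star_mul_self] at h3
  exact (mul_self_le_mul_self_iff (norm_nonneg _) hr).mpr h3

lemma exists_isSelfAdjoint_near (θ : C →⋆ₐ[ℂ] D) {T : D} (hT : IsSelfAdjoint T) {b : C} {ε : ℝ}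
    (h : ‖T - θ b‖ < ε) : ∃ b', IsSelfAdjoint b' ∧ ‖θ b' - T‖ < ε := by
  refine ⟨(1 / 2 : ℂ) • (b + star b), ?_, ?_⟩
  · rw [IsSelfAdjoint, star_smul, star_add, star_star, add_comm (star b)]
    simp
  rw [norm_sub_rev]
  have h1 : T - θ ((1 / 2 : ℂ) • (b + star b)) = (1 / 2 : ℂ) • ((T - θ b) + star (T - θ b)) := by
    rw [map_smul, map_add, map_star, star_sub, hT.star_eq]
    module
  rw [h1, norm_smul]
  have h2 := norm_add_le (T - θ b) (star (T - θ b))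
  rw [norm_star] at h2
  have h3 : ‖(1 / 2 : ℂ)‖ = 1 / 2 := by norm_num
  rw [h3]
  linarith

end Hom

/-! ### Approximation by finite stages -/

section Stages

/-- A continuous function on a product of compact spaces nearly depends on finitely many coordinates
only, by compactness of the set of pairs of points at which its values differ by at least `ε`. -/
lemma exists_forall_norm_sub_lt {G : ℕ → Type*} [∀ k, TopologicalSpace (G k)]
    [∀ k, CompactSpace (G k)] [∀ k, T2Space (G k)] (f : C(∀ k, G k, ℂ)) {ε : ℝ} (hε : 0 < ε) :
    ∃ N, ∀ n ≥ N, ∀ g h : ∀ k, G k, (∀ k < n, g k = h k) → ‖f g - f h‖ < ε := by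
  by_contra! hcon
  have h1 : ∀ n, ∃ m ≥ n, ∃ g h : ∀ k, G k, (∀ k < m, g k = h k) ∧ ε ≤ ‖f g - f h‖ := hcon
  obtain ⟨t, ht⟩ : ∃ t : ℕ → Set ((∀ k, G k) × (∀ k, G k)),
    t = fun n => {p | (∀ k < n, p.1 k = p.2 k) ∧ ε ≤ ‖f p.1 - f p.2‖} := ⟨_, rfl⟩
  have hcl : ∀ n, IsClosed (t n) := fun n => by
    have : t n = (⋂ k, ⋂ _ : k < n, {p | p.1 k = p.2 k}) ∩ {p | ε ≤ ‖f p.1 - f p.2‖} := by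
      ext p; simp [ht]
    rw [this]
    refine IsClosed.inter (isClosed_iInter fun k => isClosed_iInter fun _ =>
      isClosed_eq (by fun_prop) (by fun_prop)) (isClosed_le (by fun_prop) (by fun_prop))
  obtain ⟨p, hp⟩ := IsCompact.nonempty_iInter_of_sequence_nonempty_isCompact_isClosed t
    (fun n p hp => by
      rw [ht] at hp ⊢
      exact ⟨fun k hk => hp.1 k (hk.trans n.lt_succ_self), hp.2⟩)
    (fun n => by
      obtain ⟨m, hm, g, h, hgh, hf⟩ := h1 n
      exact ⟨(g, h), by rw [ht]; exact ⟨fun k hk => hgh k (hk.trans_le hm), hf⟩⟩)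
    (hcl 0).isCompact hcl
  rw [Set.mem_iInter] at hp
  have h2 : p.1 = p.2 := funext fun k => by
    have := hp (k + 1)
    rw [ht] at this
    exact this.1 k k.lt_succ_self
  have h3 := hp 0
  rw [ht] at h3
  have h4 := h3.2
  rw [h2, sub_self, norm_zero] at h4
  exact hε.not_ge h4

variable {A : ℕ → Type*} [∀ k, CStarAlgebra (A k)]

namespace MinTensor

variable (A) in
/-- The inclusion of the tensor product of the first `n` factors in the infinite tensor product. -/
def stage (n : ℕ) : MinTensor (fun k : Fin n => A k) →⋆ₐ[ℂ] MinTensor A :=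
  embed Fin.val_injective

lemma stage_incl (n : ℕ) (k : Fin n) (a : A k) :
    stage A n (incl (fun k : Fin n => A k) k a) = incl A k a :=
  embed_incl Fin.val_injective k a

lemma tensorAction_stage {G : ℕ → Type*} [∀ k, Group (G k)] [∀ k, TopologicalSpace (G k)]
    (α : ∀ k, CStarAction (G k) (A k)) (g : ∀ k, G k) (n : ℕ)
    (T : MinTensor fun k : Fin n => A k) : (tensorAction α).toAut g (stage A n T)
      = stage A n ((tensorAction fun k : Fin n => α k).toAut (fun k => g k) T) :=
  tensorAction_embed Fin.val_injective α g T

/-- The finite stages are increasing with dense union. -/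
lemma exists_stage_near (T : MinTensor A) {ε : ℝ} (hε : 0 < ε) :
    ∃ N, ∀ n ≥ N, ∃ b, ‖T - stage A n b‖ < ε := by
  obtain ⟨S, hS⟩ : ∃ S : ℕ → StarSubalgebra ℂ (MinTensor A),
    ∀ n, S n = (stage A n).range.topologicalClosure := ⟨_, fun _ => rfl⟩
  have hcl : ∀ n, IsClosed (S n : Set (MinTensor A)) := fun n => by
    rw [hS]; exact StarSubalgebra.isClosed_topologicalClosure _
  have hmem : ∀ n b, stage A n b ∈ S n := fun n b => by
    rw [hS]; exact StarSubalgebra.le_topologicalClosure _ ⟨b, rfl⟩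
  have hmono : Monotone S := fun n m hnm => by
    rw [hS n]
    refine StarSubalgebra.topologicalClosure_minimal ?_ (hcl m)
    rintro _ ⟨b, rfl⟩
    refine mem_of_isClosed (N := (S m).comap (stage A n))
      ((hcl m).preimage (stage A n).continuous_of_cstarAlgebra) (fun k a => ?_) b
    change stage A n (incl _ k a) ∈ S m
    rw [stage_incl]
    have := hmem m (incl (fun k : Fin m => A k) ⟨k, k.2.trans_le hnm⟩ a)
    rwa [stage_incl] at this
  have h1 : T ∈ (⨆ n, S n).topologicalClosure := mem_of_isClosed
    (StarSubalgebra.isClosed_topologicalClosure _) (fun k a => by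
      refine StarSubalgebra.le_topologicalClosure _ (le_iSup S (k + 1) ?_)
      have := hmem (k + 1) (incl (fun k : Fin (k + 1) => A k) ⟨k, k.lt_succ_self⟩ a)
      rwa [stage_incl] at this) T
  obtain ⟨U, hU, hTU⟩ := Metric.mem_closure_iff.mp h1 (ε / 2) (half_pos hε)
  have hU' : U ∈ ((⨆ n, S n : StarSubalgebra ℂ (MinTensor A)) : Set (MinTensor A)) := hU
  rw [StarSubalgebra.coe_iSup_of_directed hmono.directed_le, Set.mem_iUnion] at hU'
  obtain ⟨N, hN⟩ := hU'
  refine ⟨N, fun n hn => ?_⟩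
  have h2 : U ∈ S n := hmono hn hN
  rw [hS] at h2
  obtain ⟨_, ⟨b, rfl⟩, hb⟩ := Metric.mem_closure_iff.mp h2 (ε / 2) (half_pos hε)
  refine ⟨b, ?_⟩
  rw [← dist_eq_norm]
  have := dist_triangle T U (stage A n b)
  change dist U (stage A n b) < _ at hb
  linarith

lemma exists_isSelfAdjoint_stage_near {T : MinTensor A} (hT : IsSelfAdjoint T) {ε : ℝ}
    (hε : 0 < ε) : ∃ N, ∀ n ≥ N, ∃ b, IsSelfAdjoint b ∧ ‖stage A n b - T‖ < ε := by
  obtain ⟨N, hN⟩ := exists_stage_near T hε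
  refine ⟨N, fun n hn => ?_⟩
  obtain ⟨b, hb⟩ := hN n hn
  exact exists_isSelfAdjoint_near (stage A n) hT hb

/-- Cutting down an approximation of a nonzero positive element by an element of a finite stage. -/
lemma exists_cube_le {y : MinTensor A} (hy : 0 ≤ y) (hy0 : y ≠ 0) {n : ℕ}
    {b : MinTensor fun k : Fin n => A k} (hb : IsSelfAdjoint b)
    (h : ‖stage A n b - y‖ ≤ ‖y‖ / 4) :
    0 ≤ cutDown (‖y‖ / 4) b * cutDown (‖y‖ / 4) b * cutDown (‖y‖ / 4) b ∧
    cutDown (‖y‖ / 4) b * cutDown (‖y‖ / 4) b * cutDown (‖y‖ / 4) b ≠ 0 ∧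
    stage A n (cutDown (‖y‖ / 4) b * cutDown (‖y‖ / 4) b * cutDown (‖y‖ / 4) b)
      ≤ stage A n (cutDown (‖y‖ / 4) b) * y * star (stage A n (cutDown (‖y‖ / 4) b)) := by
  have hy1 : 0 < ‖y‖ := norm_pos_iff.mpr hy0
  refine ⟨cube_nonneg cutDown_nonneg, fun h0 => ?_, ?_⟩
  · have h1 := cutDown_ne_zero_of_norm_lt (hb.map (stage A n)) hy h (by linarith)
    rw [← StarAlgHom.map_cutDown _ hb, cube_eq_zero_of_nonneg cutDown_nonneg h0, map_zero] at h1
    exact h1 rfl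
  · have h1 := cutDown_cube_le (hb.map (stage A n)) (IsSelfAdjoint.of_nonneg hy) h
    rw [← StarAlgHom.map_cutDown _ hb] at h1
    rw [map_mul, map_mul, ← map_star, isSelfAdjoint_cutDown.star_eq]
    exact h1

lemma isFullElement_infinite (hA : ∀ k, ∀ x : A k, 0 ≤ x → x ≠ 0 → IsFullElement x)
    {y : MinTensor A} (hy : 0 ≤ y) (hy0 : y ≠ 0) : IsFullElement y := by
  have hy1 : 0 < ‖y‖ := norm_pos_iff.mpr hy0
  obtain ⟨N, hN⟩ := exists_isSelfAdjoint_stage_near (IsSelfAdjoint.of_nonneg hy)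
    (ε := ‖y‖ / 4) (by linarith)
  obtain ⟨b, hb, hby⟩ := hN N le_rfl
  obtain ⟨h1, h2, h3⟩ := exists_cube_le hy hy0 hb hby.le
  exact ((isFullElement (fun k => hA k) _ h1 h2).map (stage A N)).of_le h3

end MinTensor

end Stages

/-! ### From Rokhlin families to approximately equivariant maps -/

section Sample

variable {C H X : Type*} [CStarAlgebra C] [Fintype H] [TopologicalSpace X]

/-- The homomorphism `f ↦ ∑ h, f (x h) • e h` given by points `x h` and orthogonal projections
`e h`. -/
def sampleHom (x : H → X) (e : H → C) (he : ∀ h, IsStarProjection (e h))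
    (horth : ∀ g h, g ≠ h → e g * e h = 0) : C(X, ℂ) →⋆ₙₐ[ℂ] C where
  toFun f := ∑ h, f (x h) • e h
  map_smul' c f := by
    simp only [ContinuousMap.smul_apply, smul_eq_mul, mul_smul, Finset.smul_sum, MonoidHom.id_apply]
  map_zero' := by simp
  map_add' f f' := by simp only [ContinuousMap.add_apply, add_smul, Finset.sum_add_distrib]
  map_mul' f f' := by
    classical
    rw [Finset.sum_mul_sum]
    refine Finset.sum_congr rfl fun g _ => ?_
    rw [Finset.sum_eq_single g (fun h _ hh => by
      rw [smul_mul_assoc, mul_smul_comm, horth g h hh.symm, smul_zero, smul_zero])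
      (fun h => absurd (Finset.mem_univ g) h), smul_mul_assoc, mul_smul_comm,
      (he g).isIdempotentElem.eq, smul_smul, ContinuousMap.mul_apply]
  map_star' f := by
    rw [star_sum]
    refine Finset.sum_congr rfl fun g _ => ?_
    rw [star_smul, (he g).isSelfAdjoint.star_eq, ContinuousMap.star_apply]

variable (x : H → X) (e : H → C) (he : ∀ h, IsStarProjection (e h))
    (horth : ∀ g h, g ≠ h → e g * e h = 0)

lemma sampleHom_apply (f : C(X, ℂ)) : sampleHom x e he horth f = ∑ h, f (x h) • e h := rfl

/-- If the projections nearly commute with an approximation of `a`, then the values of the sampling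
homomorphism nearly commute with `a`. -/
lemma norm_sampleHom_commutator_le [CompactSpace X] {f : C(X, ℂ)} {M η κ : ℝ} (hM : ‖f‖ ≤ M) {a b : C}
    (hab : ‖a - b‖ ≤ κ) (hb : ∀ h, ‖e h * b - b * e h‖ ≤ η) :
    ‖sampleHom x e he horth f * a - a * sampleHom x e he horth f‖
      ≤ 2 * M * κ + Fintype.card H * (M * η) := by
  have hM0 : 0 ≤ M := (norm_nonneg f).trans hM
  have hfx : ∀ h, ‖f (x h)‖ ≤ M := fun h => (f.norm_coe_le_norm _).trans hM
  obtain ⟨T, hT⟩ : ∃ T, T = sampleHom x e he horth f := ⟨_, rfl⟩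
  have hTM : ‖T‖ ≤ M := by rw [hT]; exact norm_sum_smul_le he horth _ hM0 hfx
  have h1 : ‖T * b - b * T‖ ≤ Fintype.card H * (M * η) := by
    have : T * b - b * T = ∑ h, f (x h) • (e h * b - b * e h) := by
      rw [hT, sampleHom_apply, Finset.sum_mul, Finset.mul_sum, ← Finset.sum_sub_distrib]
      simp only [smul_sub, smul_mul_assoc, mul_smul_comm]
    rw [this, ← nsmul_eq_mul, ← Finset.card_univ, ← Finset.sum_const]
    refine (norm_sum_le _ _).trans (Finset.sum_le_sum fun h _ => ?_)
    rw [norm_smul]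
    exact mul_le_mul (hfx h) (hb h) (norm_nonneg _) hM0
  have h2 : T * a - a * T = T * (a - b) - (a - b) * T + (T * b - b * T) := by
    simp only [mul_sub, sub_mul]; abel
  rw [← hT, h2]
  have h3 : ‖T * (a - b)‖ ≤ M * κ :=
    (norm_mul_le _ _).trans (mul_le_mul hTM hab (norm_nonneg _) hM0)
  have h4 : ‖(a - b) * T‖ ≤ M * κ := by
    rw [mul_comm M]
    exact (norm_mul_le _ _).trans
      (mul_le_mul hab hTM (norm_nonneg _) ((norm_nonneg _).trans hab))
  have h5 := norm_add_le (T * (a - b) - (a - b) * T) (T * b - b * T)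
  have h6 := norm_sub_le (T * (a - b)) ((a - b) * T)
  linarith

end Sample

section Transfer

variable {C D H K : Type*} [CStarAlgebra C] [CStarAlgebra D] [Group H] [Group K]
  {β : H →* (C ≃⋆ₐ[ℂ] C)} {γ : K →* (D ≃⋆ₐ[ℂ] D)}

lemma DominatedIn.map (θ : C →⋆ₐ[ℂ] D)
    (hθ : ∀ t, (∀ h, β h t = t) → ∀ k, γ k (θ t) = θ t) {a b : C} (h : DominatedIn β a b) :
    DominatedIn γ (θ a) (θ b) := by
  obtain ⟨t, htf, ht⟩ := h
  refine ⟨θ t, hθ t htf, ?_⟩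
  rw [← map_star θ, ← map_mul, ← map_mul]
  exact OrderHomClass.mono θ ht

lemma norm_map_commutator_le {θ : C →⋆ₐ[ℂ] D} {e b : C} :
    ‖θ e * θ b - θ b * θ e‖ ≤ ‖e * b - b * e‖ := by
  rw [← map_mul, ← map_mul, ← map_sub]
  exact NonUnitalStarAlgHom.norm_apply_le θ _

/-- Averaging over a finite group turns an approximation of `y`, all of whose translates approximate
`y`, into a fixed one. -/
lemma exists_fixed_near [Fintype H] (θ : C →⋆ₐ[ℂ] D) {b : C} (hb : IsSelfAdjoint b) {y : D} {r : ℝ}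
    (h : ∀ g, ‖θ (β g b) - y‖ ≤ r) :
    ∃ b', IsSelfAdjoint b' ∧ (∀ g, β g b' = b') ∧ ‖θ b' - y‖ ≤ r := by
  have hN : (0 : ℝ) < Fintype.card H := by exact_mod_cast Fintype.card_pos
  have hN' : (Fintype.card H : ℂ) ≠ 0 := by exact_mod_cast hN.ne'
  refine ⟨(Fintype.card H : ℂ)⁻¹ • ∑ g, β g b, ?_, fun g => ?_, ?_⟩
  · rw [IsSelfAdjoint, star_smul, star_sum]
    congr 1
    · simp
    · exact Finset.sum_congr rfl fun g _ => (hb.map (β g)).star_eq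
  · rw [map_smul, map_sum]
    congr 1
    refine Fintype.sum_equiv (Equiv.mulLeft g) _ _ fun k => ?_
    change _ = β (g * k) b
    rw [map_mul β]; rfl
  · have h1 : θ ((Fintype.card H : ℂ)⁻¹ • ∑ g, β g b) - y
        = (Fintype.card H : ℂ)⁻¹ • ∑ g, (θ (β g b) - y) := by
      rw [map_smul, map_sum, Finset.sum_sub_distrib, smul_sub, Finset.sum_const, Finset.card_univ,
        ← Nat.cast_smul_eq_nsmul ℂ, smul_smul, inv_mul_cancel₀ hN', one_smul]
    have h2 : ‖∑ g, (θ (β g b) - y)‖ ≤ Fintype.card H * r := by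
      rw [← nsmul_eq_mul, ← Finset.card_univ, ← Finset.sum_const]
      exact (norm_sum_le _ _).trans (Finset.sum_le_sum fun g _ => h g)
    rw [h1, norm_smul, norm_inv, Complex.norm_natCast, inv_mul_le_iff₀ hN]
    exact h2

end Transfer

section Main

/-- The extension of a family indexed by the numbers below `n` by the units of the remaining
groups. -/
def extendOne {G : ℕ → Type*} [∀ k, Group (G k)] {n : ℕ} (h : ∀ k : Fin n, G k) (k : ℕ) : G k :=
  if hk : k < n then h ⟨k, hk⟩ else 1

lemma extendOne_coe {G : ℕ → Type*} [∀ k, Group (G k)] {n : ℕ} (h : ∀ k : Fin n, G k)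
    (k : Fin n) : extendOne h (k : ℕ) = h k := dif_pos k.2

variable {A : ℕ → Type*} [∀ k, CStarAlgebra (A k)] {G : ℕ → Type*} [∀ k, Group (G k)]
  [∀ k, TopologicalSpace (G k)] (α : ∀ k, CStarAction (G k) (A k))

lemma tensorAction_stage_of_fixed {n : ℕ} {t : MinTensor fun k : Fin n => A k}
    (ht : ∀ h, (tensorAction fun k : Fin n => α k).toAut h t = t) (g : ∀ k, G k) :
    (tensorAction α).toAut g (MinTensor.stage A n t) = MinTensor.stage A n t := by
  rw [MinTensor.tensorAction_stage, ht]

/-- A nonzero positive element that is fixed by the infinite product action dominates, within the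
fixed point algebra, fixed elements of all late finite stages. -/
lemma exists_dominatedIn_stage [∀ k, Fintype (G k)] {y : MinTensor A} (hy : 0 ≤ y) (hy0 : y ≠ 0)
    (hyf : ∀ g, (tensorAction α).toAut g y = y) :
    ∃ N, ∀ n ≥ N, ∃ y' : MinTensor fun k : Fin n => A k, 0 ≤ y' ∧ y' ≠ 0 ∧
      (∀ h, (tensorAction fun k : Fin n => α k).toAut h y' = y') ∧
      DominatedIn (tensorAction α).toAut (MinTensor.stage A n y') y := by
  have hy1 : 0 < ‖y‖ := norm_pos_iff.mpr hy0
  obtain ⟨N, hN⟩ := MinTensor.exists_isSelfAdjoint_stage_near (IsSelfAdjoint.of_nonneg hy)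
    (ε := ‖y‖ / 4) (by linarith)
  refine ⟨N, fun n hn => ?_⟩
  obtain ⟨b₀, hb₀, hby₀⟩ := hN n hn
  -- the approximation of `y` is averaged over the group of the stage, which acts through the
  -- elements `extendOne h` that fix `y`
  obtain ⟨b, hb, hbf, hby⟩ := exists_fixed_near (β := (tensorAction fun k : Fin n => α k).toAut)
    (MinTensor.stage A n) hb₀ (y := y) (r := ‖y‖ / 4) fun h => by
      have h1 := MinTensor.tensorAction_stage α (extendOne h) n b₀
      simp only [extendOne_coe] at h1
      rw [← h1, ← hyf (extendOne h), ← map_sub, StarAlgEquiv.norm_map, hyf]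
      exact hby₀.le
  obtain ⟨h1, h2, h3⟩ := MinTensor.exists_cube_le hy hy0 hb hby
  have hg : ∀ h, (tensorAction fun k : Fin n => α k).toAut h (cutDown (‖y‖ / 4) b)
      = cutDown (‖y‖ / 4) b := fun h => by rw [map_cutDown _ hb, hbf]
  exact ⟨_, h1, h2, fun h => by rw [map_mul, map_mul, hg], _,
    tensorAction_stage_of_fixed α hg, h3⟩

lemma exists_dominated_stage {x : MinTensor A} (hx : 0 ≤ x) (hx0 : x ≠ 0) :
    ∃ N, ∀ n ≥ N, ∃ x' : MinTensor fun k : Fin n => A k, 0 ≤ x' ∧ x' ≠ 0 ∧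
      Dominated (MinTensor.stage A n x') x := by
  have hx1 : 0 < ‖x‖ := norm_pos_iff.mpr hx0
  obtain ⟨N, hN⟩ := MinTensor.exists_isSelfAdjoint_stage_near (IsSelfAdjoint.of_nonneg hx)
    (ε := ‖x‖ / 4) (by linarith)
  refine ⟨N, fun n hn => ?_⟩
  obtain ⟨b, hb, hbx⟩ := hN n hn
  obtain ⟨h1, h2, h3⟩ := MinTensor.exists_cube_le hx hx0 hb hbx.le
  exact ⟨_, h1, h2, _, h3⟩

end Main

/-! ### Rokhlin families in infinite tensor products -/

section Infinite

variable {A : ℕ → Type*} [∀ k, CStarAlgebra (A k)]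
  {G : ℕ → Type*} [∀ k, Group (G k)] [∀ k, Fintype (G k)] [∀ k, TopologicalSpace (G k)]
  {α : ∀ k, CStarAction (G k) (A k)}

/-- Exact Rokhlin families of the infinite tensor product, indexed by the group of a finite stage,
with comparison in the fixed point algebra. -/
lemma exists_stage_isRokhlinFamily (rokhlin : ∀ k, HasTracialRokhlinProperty (α k)) {n : ℕ}
    (hn : 1 ≤ n) (hC : HasStrictComparison (MinTensor fun k : Fin n => A k))
    (F : Finset (MinTensor fun k : Fin n => A k)) {ε : ℝ} (hε : 0 < ε)
    {x y : MinTensor fun k : Fin n => A k} (hx : 0 ≤ x) (hx0 : x ≠ 0) (hy : 0 ≤ y) (hy0 : y ≠ 0)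
    (hyf : ∀ h, (tensorAction fun k : Fin n => α k).toAut h y = y) :
    ∃ e : (∀ k : Fin n, G k) → MinTensor A, (∀ h, IsStarProjection (e h)) ∧
      (∀ g h, g ≠ h → e g * e h = 0) ∧
      (∀ (g : ∀ k, G k) h, (tensorAction α).toAut g (e h) = e ((fun k : Fin n => g k) * h)) ∧
      (∀ h, ∀ a ∈ F, ‖e h * MinTensor.stage A n a - MinTensor.stage A n a * e h‖ ≤ ε) ∧
      Dominated (1 - ∑ h, e h) (MinTensor.stage A n x) ∧
      DominatedIn (tensorAction α).toAut (1 - ∑ h, e h) (MinTensor.stage A n y) ∧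
      DominatedIn (tensorAction α).toAut (1 - ∑ h, e h) (∑ h, e h) := by
  have hfull := MinTensor.isFullElement (A := fun k : Fin n => A k)
    fun k x hx hx0 => (rokhlin k).simple.isFullElement hx hx0
  have hnt : ∀ k : Fin n, Nontrivial (A k) := fun k => (rokhlin k).simple.nontrivial
  have hnt' : Nontrivial (MinTensor fun k : Fin n => A k) := MinTensor.nontrivial
  have hinf := MinTensor.not_finiteDimensional (A := fun k : Fin n => A k) (k := ⟨0, hn⟩)
    (fun x hx hx0 => (rokhlin 0).simple.isFullElement hx hx0) (rokhlin 0).infiniteDimensional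
  obtain ⟨e, he, heF, hex, hey, hep⟩ := HasExactRokhlin.exists_isRokhlinFamily
    (hasExactRokhlin_tensorAction hn (fun k : Fin n => α k) fun k => rokhlin k) hfull hinf hC F hε
    hx hx0 hy hy0 hyf
  have hsum : 1 - ∑ h, MinTensor.stage A n (e h) = MinTensor.stage A n (1 - ∑ h, e h) := by
    rw [map_sub, map_one, map_sum]
  refine ⟨fun h => MinTensor.stage A n (e h), fun h => (he.proj h).map _, fun g h hgh => ?_,
    fun g h => ?_, fun h a ha => norm_map_commutator_le.trans (heF h a ha).le, ?_, ?_, ?_⟩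
  · change MinTensor.stage A n (e g) * MinTensor.stage A n (e h) = 0
    rw [← map_mul, he.orth g h hgh, map_zero]
  · change (tensorAction α).toAut g (MinTensor.stage A n (e h)) = _
    rw [MinTensor.tensorAction_stage, he.equivariant]
  · rw [hsum]; exact hex.map _
  · rw [hsum]; exact hey.map _ fun t ht => tensorAction_stage_of_fixed α ht
  · rw [hsum, ← map_sum]; exact hep.map _ fun t ht => tensorAction_stage_of_fixed α ht

lemma DominatedIn.cuntzSubeq_fixedPointAlgebra {K B : Type*} [Group K] [TopologicalSpace K]
    [CStarAlgebra B] {γ : CStarAction K B} {q x : fixedPointAlgebra γ}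
    (hq : IsStarProjection (q : B)) (h : DominatedIn γ.toAut (q : B) x) : CuntzSubeq q x := by
  obtain ⟨v, hvf, hv⟩ := h.exists_eq hq q.2 x.2
  exact subset_closure ⟨⟨v, hvf⟩, Subtype.ext hv⟩

lemma isSimpleCStar_infinite (simple : ∀ k, IsSimpleCStar (A k)) : IsSimpleCStar (MinTensor A) := by
  have hnt : ∀ k, Nontrivial (A k) := fun k => (simple k).nontrivial
  have hnt' : Nontrivial (MinTensor A) := MinTensor.nontrivial
  exact isSimpleCStar_of_isFullElement fun y hy hy0 =>
    MinTensor.isFullElement_infinite (fun k x hx hx0 => (simple k).isFullElement hx hx0) hy hy0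

variable [∀ k, DiscreteTopology (G k)]

/-- Sampling on a Rokhlin family of a finite stage is equivariant up to the oscillation of the
function on the cosets of the remaining factors. -/
lemma norm_sampleHom_leftTranslate_sub_le {n : ℕ} {e : (∀ k : Fin n, G k) → MinTensor A}
    (he : ∀ h, IsStarProjection (e h)) (horth : ∀ g h, g ≠ h → e g * e h = 0)
    (hα : ∀ (g : ∀ k, G k) h, (tensorAction α).toAut g (e h) = e ((fun k : Fin n => g k) * h))
    {f : C(∀ k, G k, ℂ)} {r : ℝ} (hr : 0 ≤ r)
    (hf : ∀ g h : ∀ k, G k, (∀ k < n, g k = h k) → ‖f g - f h‖ ≤ r) (g : ∀ k, G k) :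
    ‖sampleHom extendOne e he horth (leftTranslate g f)
      - (tensorAction α).toAut g (sampleHom extendOne e he horth f)‖ ≤ r := by
  have h1 : (tensorAction α).toAut g (sampleHom extendOne e he horth f)
      = ∑ h, f (extendOne ((fun k : Fin n => g k)⁻¹ * h)) • e h := by
    rw [sampleHom_apply, map_sum]
    refine Fintype.sum_equiv (Equiv.mulLeft fun k : Fin n => g k) _ _ fun h => ?_
    rw [map_smul, hα, Equiv.coe_mulLeft, inv_mul_cancel_left]
  rw [h1, sampleHom_apply, ← Finset.sum_sub_distrib]
  simp only [← sub_smul]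
  refine norm_sum_smul_le he horth _ hr fun h => hf _ _ fun k hk => ?_
  have h2 := extendOne_coe h ⟨k, hk⟩
  have h3 := extendOne_coe ((fun k : Fin n => g k)⁻¹ * h) ⟨k, hk⟩
  change extendOne h k = _ at h2
  change extendOne ((fun k : Fin n => g k)⁻¹ * h) k = _ at h3
  change (g k)⁻¹ * extendOne h k = _
  rw [h2, h3]
  rfl

/-- An infinite tensor product of actions with the tracial Rokhlin property has the restricted
tracial Rokhlin property with comparison if the finite partial tensor products have strict
comparison. -/
theorem hasRestrictedTracialRokhlinPropertyWithComparison_tensorAction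
    (rokhlin : ∀ k, HasTracialRokhlinProperty (α k))
    (comparison : ∀ n : ℕ, 1 ≤ n → HasStrictComparison (MinTensor fun k : Fin n => A k)) :
    HasRestrictedTracialRokhlinPropertyWithComparison (tensorAction α) := by
  classical
  have simple : ∀ k, IsSimpleCStar (A k) := fun k => (rokhlin k).simple
  have hsimple := isSimpleCStar_infinite simple
  have hnt : Nontrivial (MinTensor A) := hsimple.nontrivial
  refine ⟨hsimple, MinTensor.not_finiteDimensional
    (fun x hx hx0 => (simple 0).isFullElement hx hx0) (rokhlin 0).infiniteDimensional, ?_⟩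
  intro F S ε hε x hx hx0 y hy hy0
  obtain ⟨M, hM⟩ : ∃ M : ℝ, M = 1 + ∑ f ∈ S, ‖f‖ := ⟨_, rfl⟩
  have hM0 : 0 < M := by
    rw [hM]; exact add_pos_of_pos_of_nonneg one_pos (Finset.sum_nonneg fun f _ => norm_nonneg f)
  have hSM : ∀ f ∈ S, ‖f‖ ≤ M := fun f hf => by
    rw [hM]
    linarith [Finset.single_le_sum (f := fun f => ‖f‖) (fun f _ => norm_nonneg f) hf]
  have hκ : 0 < ε / (8 * M) := by positivity
  -- a stage which is late enough for all the given data
  obtain ⟨n, hn1, hnF, hnS, hnx, hny⟩ : ∃ n : ℕ, 1 ≤ n ∧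
      (∀ a ∈ F, ∃ b, ‖a - MinTensor.stage A n b‖ < ε / (8 * M)) ∧
      (∀ f ∈ S, ∀ g h : ∀ k, G k, (∀ k < n, g k = h k) → ‖f g - f h‖ < ε / 2) ∧
      (∃ x' : MinTensor fun k : Fin n => A k, 0 ≤ x' ∧ x' ≠ 0 ∧
        Dominated (MinTensor.stage A n x') x) ∧
      ∃ y' : MinTensor fun k : Fin n => A k, 0 ≤ y' ∧ y' ≠ 0 ∧
        (∀ h, (tensorAction fun k : Fin n => α k).toAut h y' = y') ∧
        DominatedIn (tensorAction α).toAut (MinTensor.stage A n y') y := by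
    have h1 := (Filter.eventually_all_finset F).mpr fun a _ =>
      Filter.eventually_atTop.mpr (MinTensor.exists_stage_near a hκ)
    have h2 := (Filter.eventually_all_finset S).mpr fun f _ =>
      Filter.eventually_atTop.mpr (exists_forall_norm_sub_lt f (half_pos hε))
    have h3 := Filter.eventually_atTop.mpr (exists_dominated_stage hx hx0)
    have h4 := Filter.eventually_atTop.mpr (exists_dominatedIn_stage α hy
      (fun h => hy0 (Subtype.ext h)) y.2)
    exact ((Filter.eventually_ge_atTop 1).and (h1.and (h2.and (h3.and h4)))).exists
  choose! b hb using hnF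
  obtain ⟨x', hx', hx0', hxx'⟩ := hnx
  obtain ⟨y', hy', hy0', hyf', hyy'⟩ := hny
  have hN : (0 : ℝ) < Fintype.card (∀ k : Fin n, G k) := by exact_mod_cast Fintype.card_pos
  obtain ⟨e, he, horth, hequi, hcomm, hex, hey, hep⟩ := exists_stage_isRokhlinFamily rokhlin hn1
    (comparison n hn1) (F.image b) (ε := ε / (4 * (M * Fintype.card (∀ k : Fin n, G k))))
    (by positivity) hx' hx0' hy' hy0' hyf'
  obtain ⟨φ, hφ⟩ : ∃ φ : C(∀ k, G k, ℂ) →⋆ₙₐ[ℂ] MinTensor A,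
    φ = sampleHom extendOne e he horth := ⟨_, rfl⟩
  have hφ1 : φ 1 = ∑ h, e h := by
    rw [hφ, sampleHom_apply]
    simp
  have hp : IsStarProjection (∑ h, e h) := by
    rw [← hφ1]
    exact (IsStarProjection.one C(∀ k, G k, ℂ)).map φ
  have hpf : ∀ g, (tensorAction α).toAut g (∑ h, e h) = ∑ h, e h := fun g => by
    rw [map_sum]
    exact Fintype.sum_equiv (Equiv.mulLeft fun k : Fin n => g k) _ _ fun h => hequi g h
  refine ⟨⟨∑ h, e h, hpf⟩, (φ : C(∀ k, G k, ℂ) →ₗ[ℂ] MinTensor A), ⟨Subtype.ext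
    hp.isIdempotentElem, Subtype.ext hp.isSelfAdjoint⟩, isCompletelyPositive_of_starAlgHom φ,
    hφ1, fun f => ?_, ⟨fun f₁ _ f₂ _ => ?_, fun f hf a ha => ?_, fun f hf => ?_⟩,
    (hex.trans hxx').cuntzSubeq hp.one_sub, (hey.trans hyy').cuntzSubeq_fixedPointAlgebra
      hp.one_sub, hep.cuntzSubeq_fixedPointAlgebra hp.one_sub⟩
  · change (∑ h, e h) * φ f * (∑ h, e h) = φ f
    rw [← hφ1, ← map_mul, ← map_mul, one_mul, mul_one]
  · change ‖φ (f₁ * f₂) - φ f₁ * φ f₂‖ < ε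
    rw [map_mul, sub_self, norm_zero]
    exact hε
  · change ‖φ f * a - a * φ f‖ < ε
    rw [hφ]
    refine (norm_sampleHom_commutator_le extendOne e he horth (hSM f hf) (hb a ha).le
      fun h => hcomm h _ (Finset.mem_image_of_mem b ha)).trans_lt ?_
    have h1 : 2 * M * (ε / (8 * M)) + Fintype.card (∀ k : Fin n, G k)
        * (M * (ε / (4 * (M * Fintype.card (∀ k : Fin n, G k))))) = ε / 2 := by
      field_simp
      ring
    rw [h1]
    exact half_lt_self hε
  · refine ⟨ε / 2, half_lt_self hε, fun g => ?_⟩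
    change ‖φ (leftTranslate g f) - (tensorAction α).toAut g (φ f)‖ ≤ ε / 2
    rw [hφ]
    exact norm_sampleHom_leftTranslate_sub_le he horth hequi (half_pos hε).le
      (fun g h hgh => (hnS f hf g h hgh).le) g

end Infinite

end

theorem mainTheorem1 {A : ℕ → Type*} [∀ k, CStarAlgebra (A k)]
    {G : ℕ → Type*} [∀ k, Group (G k)] [∀ k, Fintype (G k)]
    [∀ k, TopologicalSpace (G k)] [∀ k, DiscreteTopology (G k)]
    (α : ∀ k, CStarAction (G k) (A k))
    (simple : ∀ k, IsSimpleCStar (A k))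
    (rokhlin : ∀ k, HasTracialRokhlinProperty (α k))
    (stablyFinite : IsStablyFiniteCStar (MinTensor A))
    (comparison : ∀ n : ℕ, 1 ≤ n → HasStrictComparison (MinTensor fun k : Fin n => A k)) :
    HasRestrictedTracialRokhlinPropertyWithComparison (tensorAction α) :=
  hasRestrictedTracialRokhlinPropertyWithComparison_tensorAction rokhlin comparison
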